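/- **Conventions.** Let $d,k,n\ge 1$ be integers, $\Lambda>0$, $r_{\min}\in[0,\Lambda]$, $\varepsilon,\delta,\beta\in(0,1]$; $\log$ is the natural logarithm, $\|\cdot\|$ the Euclidean norm, $B(c,r)$ the closed ball, and $\mathrm{Lap}(b)$ has density $\frac1{2b}e^{-|x|/b}$. A $k$-tuple is an unordered $k$-tuple (multiset of size $k$) of points of $\mathbb R^d$. Two databases $(X_1,\dots,X_n)$, $(X_1',\dots,X_n')$ are neighboring if $X_i\ne X_i'$ for exactly one index $i$. Laws $\mu,\nu$ are $(\varepsilon,\delta)$-indistinguishable if $\mu(S)\le e^{\varepsilon}\nu(S)+\delta$ for every event $S$; an algorithm is $(\varepsilon,\delta)$-differentially private if its output laws (probability measures) on any two neighboring databases are $(\varepsilon,\delta)$-indistinguishable. Outputs are unordered $k$-tuples or $\perp$. **Far balls.** Balls $B_i=B(c_i,r_i)$, $i\in[k]$, form a set of $k$ $\Delta$-far balls if the centers are pairwise distinct and $\|c_i-c_j\|\ge\Delta\max\{r_i,r_j\}$ for $i\ne j$. A $k$-tuple $Y$ is partitioned by $B_1,\dots,B_k$ if these are a set of $k$ $\Delta$-far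 balls and each $B_i$ contains exactly one entry of $Y$. For $X=\{x_1,\dots,x_k\}$ let $\mathcal B_X=\{B(x_i,r_i^X)\}_i$ with $r_i^X=\frac1\Delta\min_{j\ne i}\|x_i-x_j\|$ (with $\min\emptyset=+\infty$). **Parameters.** $m(n,\varepsilon,\delta,\beta)$ is the smallest positive integer $m$ such that $\varepsilon_1:=\log(\frac{\varepsilon n}{2m}-3)$ is defined and positive and $m>\frac1{\varepsilon_1}(2\log\frac1\delta+\log\frac1\beta)$, and $\ell(n,\varepsilon,\delta,\beta)=\frac{2m}{\varepsilon}\log\frac{m}{\beta\delta}$ for this $m$. **PrivateTestPartition**$(T,\varepsilon,\delta,\beta,\Delta)$. Let $m,\varepsilon_1$ be as above and $\varepsilon_2=\varepsilon/2$; let $T_1$ be a uniform (ordered) sample of $m$ rows of $T$ without replacement. For each $X\in T_1$ let $\ell_X$ be the number of rows of $T$ not partitioned by $\mathcal B_X$, and let $X$ pass if $\ell_X+\mathrm{Lap}(m/\varepsilon_2)\le\frac{m}{\varepsilon_2}\log\frac m\beta$. Let $\hat s$ be the number of passing $X\in T_1$ plus $\mathrm{Lap}(1/\varepsilon_1)$;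 all noises are independent. The status is "Failure" if $\hat s<m-\frac1{\varepsilon_1}\log\frac1\beta$ and "Success" otherwise. On success with at least one passing tuple, the balls are $\mathcal B_{X^*}$ for the first passing $X^*\in T_1$; otherwise they are $k$ empty balls (with centers $0$ by convention). **PrivatekAverages**$(T,\varepsilon,\delta,\beta,r_{\min})$, with an averaging subroutine. Run PrivateTestPartition$(T,\varepsilon/2,\delta/4,\beta/2,7)$; on "Failure" output $\perp$. Otherwise let $c_1,\dots,c_k$ be the centers of the returned balls, let $Q_i$ be the multiset of all points $x$ of the tuples of $T$ with $i=\arg\min_j\|x-c_j\|$ (ties broken by the smallest index), let $\ell=\ell(n,\varepsilon/2,\delta/4,\beta/2)$, compute independently noisy averages $\hat a_i$ of $Q_i$ by the subroutine with parameters $\Lambda,r_{\min},\hat\beta=\frac{\beta}{2k},\hat\varepsilon=\frac{\varepsilon}{4k(\ell+1)},\hat\delta=\frac{\delta}{8k e^{\varepsilon/2}(\ell+1)}$, and output $\{\hat a_1,\dots,\hat a_k\}$. **The standard averaging subroutine**, for a finite multiset in $\mathbb R^d$ and parameters $(\Lambda,r_{\min},\beta,\varepsilon,\delta)$. Independently for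 each coordinate, apply the following one-dimensional algorithm to the multiset $S$ of the coordinates, with parameters $\tilde\beta=\beta/d$, $\tilde\varepsilon=\varepsilon/(2\sqrt{2d\log(2/\delta)})$, $\tilde\delta=\delta/(2d)$. (1) Let $g=r_{\min}$ and $t=\lceil\frac{16}{\tilde\varepsilon}\log\frac{8\Lambda}{g\tilde\beta}\rceil+1$ (a negative ceiling being replaced by $0$). Let $S_0,S_1$ be the $\min(t,|S|)$ smallest, respectively largest, elements of $S$. For $b\in\{0,1\}$ choose, independently, $z_b$ in the grid $G=\{-\Lambda+jg:0\le j\le\lceil 2\Lambda/g\rceil\}$ with probability proportional to $\exp(\frac{\tilde\varepsilon}{8}q(S_b,z_b))$, where $q(S_b,y)=\min\{\#\{x\in S_b:\mathrm{left}(x)\le y\},\#\{x\in S_b:\mathrm{right}(x)\ge y\}\}$, $\mathrm{left}(x)=-\Lambda+\lfloor\frac{x+\Lambda}g\rfloor g$ and $\mathrm{right}(x)=-\Lambda+\lceil\frac{x+\Lambda}g\rceil g$. (For $g=0$ the grid is taken to be $\{-\Lambda\}$, so that $z_b=-\Lambda$.) Let $[u,v]=[z_0-g,z_1+g]$. (2)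 Let $S'=S\cap[u,v]$ and $\varepsilon_0=\tilde\varepsilon/2$, and let $N'=|S'|+\mathrm{Lap}(\frac2{\varepsilon_0})-\frac2{\varepsilon_0}\log\frac2{\tilde\delta}$. If $N'\le0$, output $\frac{u+v}2$. Otherwise output $a+\frac{2(v-u)}{\varepsilon_0N'}\sqrt{2\log(4/\tilde\delta)}\,\xi$, where $a$ is the average of $S'$ (or $\frac{u+v}2$ if $S'=\emptyset$) and $\xi\sim\mathcal N(0,1)$ is independent. **Theorem (Privacy of PrivatekAverages).** Suppose that $m(n,\varepsilon/2,\delta/4,\beta/2)$ exists and that $n\ge 2\,\ell(n,\varepsilon/2,\delta/4,\beta/2)+2$. Then PrivatekAverages with the standard averaging subroutine is $(\varepsilon,\delta)$-differentially private on databases of $n$ unordered $k$-tuples of points of $B(0,\Lambda)$. More generally, the same holds with any averaging subroutine which, for the given $\Lambda,r_{\min}$ and all parameters $\beta',\varepsilon',\delta'\in(0,1)$, is $(\varepsilon',\delta')$-differentially private on finite multisets in $B(0,\Lambda)$ with respect to the addition and the deletion of one point. -/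

import Mathlib

open MeasureTheory ProbabilityTheory
open scoped ENNReal

noncomputable section

namespace KTuple

/-! ### Differential privacy -/

/-- `(ε, δ)`-indistinguishability of two output laws. -/
def Indistinguishable {Ω : Type*} [MeasurableSpace Ω] (ε δ : ℝ) (μ ν : Measure Ω) : Prop :=
  ∀ S : Set Ω, MeasurableSet S →
    μ S ≤ ENNReal.ofReal (Real.exp ε) * ν S + ENNReal.ofReal δ

/-- Two databases of size `n` are neighboring if they differ in exactly one index. -/
def Neighboring {X : Type*} {n : ℕ} (D D' : Fin n → X) : Prop :=
  ∃! i : Fin n, D i ≠ D' i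

/-- A randomized algorithm on databases of size `n` (given by its output laws) is
`(ε, δ)`-differentially private for databases whose rows lie in `dom`. The output laws have to be
probability measures. -/
def DifferentiallyPrivateOn {X Ω : Type*} [MeasurableSpace Ω] {n : ℕ} (dom : Set X) (ε δ : ℝ)
    (A : (Fin n → X) → Measure Ω) : Prop :=
  (∀ D : Fin n → X, (∀ i, D i ∈ dom) → IsProbabilityMeasure (A D)) ∧
  ∀ D D' : Fin n → X, (∀ i, D i ∈ dom) → (∀ i, D' i ∈ dom) → Neighboring D D' →
    Indistinguishable ε δ (A D) (A D')

/-- The Laplace distribution `Lap(b)`, with density `exp (-|x| / b) / (2 b)`. -/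
def laplace (b : ℝ) : Measure ℝ :=
  volume.withDensity fun x => ENNReal.ofReal (Real.exp (-|x| / b) / (2 * b))

/-! ### Points, unordered tuples and far balls -/

/-- The Euclidean space `ℝ^d`. -/
abbrev Pt (d : ℕ) : Type := EuclideanSpace ℝ (Fin d)

/-- The unordered `k`-tuple (multiset of size `k`) `{a 0, …, a (k-1)}`. -/
def toTuple {d k : ℕ} (a : Fin k → Pt d) : Sym (Pt d) k :=
  ⟨Finset.univ.val.map a, by simp⟩

/-- An (arbitrary, fixed) enumeration `x_1, …, x_k` of an unordered `k`-tuple. -/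
def enum {d k : ℕ} (X : Sym (Pt d) k) : Fin k → Pt d := fun i =>
  (X : Multiset (Pt d)).toList.get (i.cast (by simp))

/-- Events about unordered tuples: the sets of tuples whose set of orderings is Borel. -/
instance {d k : ℕ} : MeasurableSpace (Sym (Pt d) k) :=
  MeasurableSpace.map (toTuple (d := d) (k := k)) inferInstance

/-- Outputs are unordered tuples or `⊥ = none`. -/
instance {d k : ℕ} : MeasurableSpace (Option (Sym (Pt d) k)) :=
  MeasurableSpace.map Option.some inferInstance

/-- A closed ball; the radius is extended real, so that a ball can be the whole space (`⊤`)
or empty (negative radius). -/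
structure Ball (d : ℕ) where
  center : Pt d
  radius : EReal

/-- The set of points of a ball. -/
def Ball.carrier {d : ℕ} (B : Ball d) : Set (Pt d) :=
  {x | ((dist x B.center : ℝ) : EReal) ≤ B.radius}

/-- A set of `k` `Δ`-far balls: the `k` balls have distinct centers, and
`‖c_i - c_j‖ ≥ Δ * max r_i r_j` for `i ≠ j`. -/
def FarBalls {d k : ℕ} (Δ : ℝ) (B : Fin k → Ball d) : Prop :=
  Function.Injective (fun i => (B i).center) ∧
  ∀ i j, i ≠ j → (Δ : EReal) * max (B i).radius (B j).radius ≤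
    ((dist (B i).center (B j).center : ℝ) : EReal)

open Classical in
/-- The tuple `Y` is partitioned by the set `B` of `k` `Δ`-far balls: each ball contains exactly
one entry of `Y`. -/
def PartitionedBy {d k : ℕ} (Δ : ℝ) (B : Fin k → Ball d) (Y : Sym (Pt d) k) : Prop :=
  FarBalls Δ B ∧ ∀ i, Multiset.countP (fun y => y ∈ (B i).carrier) (Y : Multiset (Pt d)) = 1

/-- The balls `B_X = {B(x_i, r_i)}`, `r_i = (1/Δ) * min_{j ≠ i} ‖x_i - x_j‖`
(the minimum over the empty set is `⊤`). -/
def ballsOf {d k : ℕ} (Δ : ℝ) (X : Sym (Pt d) k) : Fin k → Ball d := fun i =>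
  { center := enum X i
    radius := ⨅ j : Fin k, ⨅ _ : j ≠ i, ((dist (enum X i) (enum X j) / Δ : ℝ) : EReal) }

/-- `k` empty balls. -/
def emptyBalls (d k : ℕ) : Fin k → Ball d := fun _ => { center := 0, radius := ⊥ }

/-! ### The private test -/

/-- The output of the test: a status bit (`true` is "Success") and `k` balls. The law of the test
is discrete, so every set of outcomes is an event. -/
structure TestOutcome (d k : ℕ) where
  success : Bool
  balls : Fin k → Ball d

instance {d k : ℕ} : MeasurableSpace (TestOutcome d k) := ⊤

open Classical in
/-- `ℓ_X`: the number of tuples of `T₂` that are not partitioned by `B_X`. -/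
def numBad {d k n : ℕ} (Δ : ℝ) (T₂ : Fin n → Sym (Pt d) k) (X : Sym (Pt d) k) : ℕ :=
  (Finset.univ.filter fun j => ¬ PartitionedBy Δ (ballsOf Δ X) (T₂ j)).card

/-- `pass_X = 1`, where `z` is the noise added to `ℓ_X`. -/
def Passes {d k n : ℕ} (m : ℕ) (ε₂ β Δ : ℝ) (T₂ : Fin n → Sym (Pt d) k) (X : Sym (Pt d) k)
    (z : ℝ) : Prop :=
  (numBad Δ T₂ X : ℝ) + z ≤ (m / ε₂) * Real.log (m / β)

open Classical in
/-- One run of `PrivateTestCloseTuples` with the noises fixed: `z i` is the noise for the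
`i`-th tuple of `T₁`, and `w` is the noise added to the number of passing tuples. -/
def testCloseTuplesRun {d k m n : ℕ} (T₁ : Fin m → Sym (Pt d) k) (T₂ : Fin n → Sym (Pt d) k)
    (ε₁ ε₂ β Δ : ℝ) (z : Fin m → ℝ) (w : ℝ) : TestOutcome d k :=
  let pass : Fin m → Prop := fun i => Passes m ε₂ β Δ T₂ (T₁ i) (z i)
  let s : ℝ := ((Finset.univ.filter pass).card : ℝ) + w
  if s < m - (1 / ε₁) * Real.log (1 / β) then
    { success := false, balls := emptyBalls d k }
  else if h : ∃ i, pass i then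
    { success := true, balls := ballsOf Δ (T₁ (Fin.find pass h)) }
  else
    { success := true, balls := emptyBalls d k }

/-- `PrivateTestCloseTuples`: all noises are independent, `z i ∼ Lap(m/ε₂)`, `w ∼ Lap(1/ε₁)`. -/
def privateTestCloseTuples {d k m n : ℕ} (T₁ : Fin m → Sym (Pt d) k)
    (T₂ : Fin n → Sym (Pt d) k) (ε₁ ε₂ β Δ : ℝ) : Measure (TestOutcome d k) :=
  ((Measure.pi fun _ : Fin m => laplace (m / ε₂)).prod (laplace (1 / ε₁))).map
    fun ω => testCloseTuplesRun T₁ T₂ ε₁ ε₂ β Δ ω.1 ω.2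

/-- `ε₁ = log (ε n / (2 m) - 3)`. -/
def epsOne (n : ℕ) (ε : ℝ) (m : ℕ) : ℝ := Real.log (ε * n / (2 * m) - 3)

/-- The positive integers `m` such that `ε₁` is a well-defined positive number and
`m > (1/ε₁) (2 log (1/δ) + log (1/β))`. -/
def AdmissibleSizes (n : ℕ) (ε δ β : ℝ) : Set ℕ :=
  {m | 0 < m ∧ 1 < ε * n / (2 * m) - 3 ∧
    (1 / epsOne n ε m) * (2 * Real.log (1 / δ) + Real.log (1 / β)) < m}

/-- `m(n, ε, δ, β)`, the smallest admissible sample size (meaningful if one exists). -/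
def sampleSize (n : ℕ) (ε δ β : ℝ) : ℕ := sInf (AdmissibleSizes n ε δ β)

/-- `ℓ(n, ε, δ, β) = (2 m / ε) log (m / (β δ))`, where `m = m(n, ε, δ, β)`. -/
def ell (n : ℕ) (ε δ β : ℝ) : ℝ :=
  (2 * sampleSize n ε δ β / ε) * Real.log (sampleSize n ε δ β / (β * δ))

/-- `PrivateTestPartition`: run `PrivateTestCloseTuples` on `T₂ = T` and a uniformly random sample
`T₁` of `m` rows of `T` without replacement (a uniformly random injection of indices). -/
def privateTestPartition {d k n : ℕ} (T : Fin n → Sym (Pt d) k) (ε δ β Δ : ℝ) :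
    Measure (TestOutcome d k) :=
  let m := sampleSize n ε δ β
  ((Fintype.card (Fin m ↪ Fin n) : ℝ≥0∞)⁻¹) •
    ∑ e : Fin m ↪ Fin n,
      privateTestCloseTuples (fun i => T (e i)) T (epsOne n ε m) (ε / 2) β Δ

/-! ### `PrivatekAverages`, with a given averaging subroutine -/

/-- An averaging subroutine: the arguments are `Λ`, `r_min`, `β`, `ε`, `δ` and a finite multiset of
points of `ℝ^d`, and the value is the law of the noisy average. -/
abbrev Averager (d : ℕ) : Type :=
  ℝ → ℝ → ℝ → ℝ → ℝ → Multiset (Pt d) → Measure (Pt d)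

/-- `i = argmin_j ‖x - c_j‖`, ties being broken by the smallest index. -/
def IsNearest {d k : ℕ} (c : Fin k → Pt d) (x : Pt d) (i : Fin k) : Prop :=
  (∀ j, dist x (c i) ≤ dist x (c j)) ∧ ∀ j, j < i → dist x (c i) < dist x (c j)

/-- `Points(T)`, the multiset of all points in all tuples of `T`. -/
def points {d k n : ℕ} (T : Fin n → Sym (Pt d) k) : Multiset (Pt d) :=
  ∑ j, (T j : Multiset (Pt d))

open Classical in
/-- The cluster `Q_i` of the points whose closest center is `c_i`. -/
def cluster {d k n : ℕ} (T : Fin n → Sym (Pt d) k) (c : Fin k → Pt d) (i : Fin k) :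
    Multiset (Pt d) :=
  (points T).filter fun x => IsNearest c x i

/-- `PrivatekAverages`, using the averaging subroutine `avg`. -/
def privatekAverages {d k n : ℕ} (avg : Averager d) (Λ rmin ε δ β : ℝ)
    (T : Fin n → Sym (Pt d) k) : Measure (Option (Sym (Pt d) k)) :=
  let l := ell n (ε / 2) (δ / 4) (β / 2)
  let β' := β / (2 * k)
  let ε' := ε / (4 * k * (l + 1))
  let δ' := δ / (8 * k * Real.exp (ε / 2) * (l + 1))
  (privateTestPartition T (ε / 2) (δ / 4) (β / 2) 7).bind fun o =>
    if o.success then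
      (Measure.pi fun i : Fin k =>
        avg Λ rmin β' ε' δ' (cluster T (fun j => (o.balls j).center) i)).map
          fun a => some (toTuple a)
    else Measure.dirac none

/-- `avg` is a private averaging subroutine for points in the ball `B(0, Λ)`: with parameters
`β, ε, δ ∈ (0,1)`, it is `(ε, δ)`-differentially private with respect to addition and deletion
of a point. -/
def PrivateAverager {d : ℕ} (Λ rmin : ℝ) (avg : Averager d) : Prop :=
  ∀ β ε δ : ℝ, 0 < β → β < 1 → 0 < ε → ε < 1 → 0 < δ → δ < 1 →
    ∀ S : Multiset (Pt d), (∀ y ∈ S, ‖y‖ ≤ Λ) →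
      IsProbabilityMeasure (avg Λ rmin β ε δ S) ∧
      ∀ x : Pt d, ‖x‖ ≤ Λ →
        Indistinguishable ε δ (avg Λ rmin β ε δ S) (avg Λ rmin β ε δ (x ::ₘ S)) ∧
        Indistinguishable ε δ (avg Λ rmin β ε δ (x ::ₘ S)) (avg Λ rmin β ε δ S)

/-! ### A concrete averaging algorithm -/

/-- The index of the last point of the grid `-Λ, -Λ + g, …, -Λ + ⌈2Λ/g⌉ g`. -/
def gridTop (Λ g : ℝ) : ℕ := ⌈2 * Λ / g⌉₊

/-- The closest grid point to the left of `x`. -/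
def gridLeft (Λ g x : ℝ) : ℝ := -Λ + ⌊(x + Λ) / g⌋ * g

/-- The closest grid point to the right of `x`. -/
def gridRight (Λ g x : ℝ) : ℝ := -Λ + ⌈(x + Λ) / g⌉ * g

open Classical in
/-- The quality `min {#{x ∈ S : left(x) ≤ y}, #{x ∈ S : right(x) ≥ y}}` of `y`. -/
def quality (Λ g : ℝ) (S : Multiset ℝ) (y : ℝ) : ℕ :=
  min (Multiset.countP (fun x => gridLeft Λ g x ≤ y) S)
    (Multiset.countP (fun x => y ≤ gridRight Λ g x) S)

/-- Private interior point: the exponential mechanism, which selects a grid point `y` with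
probability proportional to `exp (ε q(S, y) / 2)`. -/
def interiorPoint (Λ g ε : ℝ) (S : Multiset ℝ) : Measure ℝ :=
  let y : ℕ → ℝ := fun j => -Λ + j * g
  let p : ℕ → ℝ := fun j => Real.exp (ε * quality Λ g S (y j) / 2)
  let Z : ℝ := ∑ j ∈ Finset.range (gridTop Λ g + 1), p j
  ∑ j ∈ Finset.range (gridTop Λ g + 1), ENNReal.ofReal (p j / Z) • Measure.dirac (y j)

/-- Private bounding segment, returned as the pair of its endpoints: find interior points `z₀`,
`z₁` of the smallest and of the largest `t` elements of `S`, each with privacy parameter `ε / 2`,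
and return `[z₀ - g, z₁ + g]`. -/
def boundingSegment (Λ g β ε : ℝ) (S : Multiset ℝ) : Measure (ℝ × ℝ) :=
  let t : ℕ := ⌈8 / ε * Real.log (4 * Λ / (g * β))⌉₊ + 1
  let S₀ : Multiset ℝ := ((S.sort (· ≤ ·)).take t : List ℝ)
  let S₁ : Multiset ℝ := ((S.sort (· ≥ ·)).take t : List ℝ)
  ((interiorPoint Λ g (ε / 2) S₀).prod (interiorPoint Λ g (ε / 2) S₁)).map
    fun z => (z.1 - g, z.2 + g)

open Classical in
/-- The Gaussian mechanism for the average of the points of `S` in the segment `[I.1, I.2]`,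
in its version for addition and deletion of points: the number of points is first replaced by a
noisy underestimate `N'`, and the Gaussian noise is then calibrated to `(I.2 - I.1) / N'`. If
`N' ≤ 0` then the midpoint of the segment is returned; the midpoint also serves as the average
of the empty multiset. -/
def noisyAverage (ε δ : ℝ) (S : Multiset ℝ) (I : ℝ × ℝ) : Measure ℝ :=
  let S' : Multiset ℝ := S.filter fun x => I.1 ≤ x ∧ x ≤ I.2
  let mid : ℝ := (I.1 + I.2) / 2
  let a : ℝ := if S' = 0 then mid else S'.sum / Multiset.card S'
  let N' : ℝ → ℝ := fun z => Multiset.card S' + z - 2 / ε * Real.log (2 / δ)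
  let σ : ℝ → ℝ := fun z => 2 * (I.2 - I.1) / (ε * N' z) * Real.sqrt (2 * Real.log (4 / δ))
  ((laplace (2 / ε)).prod (gaussianReal 0 1)).map fun ω =>
    if N' ω.1 ≤ 0 then mid else a + σ ω.1 * ω.2

/-- Private average of a multiset of numbers in `[-Λ, Λ]`: a private bounding segment, followed
by a noisy average of the points in it, each with privacy parameter `ε / 2`. -/
def average₁ (Λ rmin β ε δ : ℝ) (S : Multiset ℝ) : Measure ℝ :=
  (boundingSegment Λ rmin (β / 2) (ε / 2) S).bind fun I => noisyAverage (ε / 2) δ S I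

/-- Private average of a multiset of points in `B(0, Λ) ⊆ ℝ^d`: the coordinates are averaged
independently, with privacy parameters `ε / (2 √(2 d log (2/δ)))` and `δ / (2 d)`. -/
def boundedAverager (d : ℕ) : Averager d := fun Λ rmin β ε δ S =>
  (Measure.pi fun i : Fin d =>
    average₁ Λ rmin (β / d) (ε / (2 * Real.sqrt (2 * d * Real.log (2 / δ)))) (δ / (2 * d))
      (S.map fun x => x i)).map (WithLp.toLp 2)

end KTuple

end

/-!
The theorem compares the law of the output on a database `T` with the law on a database `T'` which
differs from `T` in the single row `j`.

*Closeness of the clusters.* Given centers `c`, the noisy averages are a product of `k` independent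
laws, one for each cluster. Changing one row moves at most `2 k` points, and by group privacy this
costs `2 k` times the privacy parameters of the averages. If the centers themselves change from
those of a row `X` to those of a row `X'`, then every row which is partitioned by both families of
balls is split in the same way by the two families of centers, up to a permutation of the clusters
(`exists_perm_nearest`), and the permutation is invisible in an unordered output. Hence the cost is
governed by the numbers of rows which are not partitioned
(`averagesLaw_indistinguishable_of_numBadOff`), and a passing `X` has few of those, except with
small probability.

*The sample.* A sample `e` which avoids `j` is compared with itself: only the counts of the rows that
are not partitioned change, each by at most one, and the Laplace noise hides this at the cost of
`ε / 4` (`sampleProb_le_of_notMem`). A sample which contains `j` is compared with the sample in which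
`j` is exchanged for a fresh index `j'` (`sampleProb_le_of_mem`): now the noise of the number of
passing tuples costs a factor `exp ε₁`, and the centers may change. Counting pairs of samples related
by such an exchange (`sum_embedding_le`) shows that the second kind carries a weight of
`m / (n - m)`, and `exp ε₁` is chosen such that `exp ε₁ * m / (n - m) ≤ ε / 4`. With convexity of
the exponential, the two contributions sum to at most `exp ε` (`budget_mul`, `budget_add`). The
minimality of the sample size `m` bounds it by a logarithm of the other parameters
(`sampleSize_mul_le`), which makes a union bound over the sample affordable.

*The standard averages.* In one dimension, the bounding segment is found by two exponential
mechanisms, and the noisy average is a Gaussian mechanism whose scale is private by Laplace noise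
(`average₁_private_cons`). The coordinates are put together by advanced composition
(`pi_indistinguishable`): mutually `(ε, δ)`-indistinguishable laws have large parts of equal masses
with a density ratio in `[exp (-ε), exp ε]` (`exists_pure_part`), and the logarithm of the ratio of
the products is a sum of independent bounded variables, to which Hoeffding's inequality applies.
-/


namespace KTuple

/-! ### Indistinguishability and the Laplace distribution -/

section Indistinguishable

variable {Ω Ω' : Type*} [MeasurableSpace Ω] [MeasurableSpace Ω']

theorem Indistinguishable.map {ε δ : ℝ} {μ ν : Measure Ω} (h : Indistinguishable ε δ μ ν)
    {f : Ω → Ω'} (hf : Measurable f) : Indistinguishable ε δ (μ.map f) (ν.map f) := by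
  intro S hS
  rw [Measure.map_apply hf hS, Measure.map_apply hf hS]
  exact h _ (hf hS)

theorem Indistinguishable.refl (μ : Measure Ω) : Indistinguishable 0 0 μ μ := by
  intro S _
  simp

theorem Indistinguishable.mono {ε δ ε' δ' : ℝ} {μ ν : Measure Ω}
    (h : Indistinguishable ε δ μ ν) (hε : ε ≤ ε') (hδ : δ ≤ δ') :
    Indistinguishable ε' δ' μ ν := by
  intro S hS
  refine (h S hS).trans ?_
  gcongr

theorem Indistinguishable.trans {ε₁ δ₁ ε₂ δ₂ : ℝ} {μ ν ρ : Measure Ω}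
    (hδ₁ : 0 ≤ δ₁) (hδ₂ : 0 ≤ δ₂)
    (h₁ : Indistinguishable ε₁ δ₁ μ ν) (h₂ : Indistinguishable ε₂ δ₂ ν ρ) :
    Indistinguishable (ε₁ + ε₂) (δ₁ + Real.exp ε₁ * δ₂) μ ρ := by
  intro S hS
  calc μ S ≤ ENNReal.ofReal (Real.exp ε₁) * ν S + ENNReal.ofReal δ₁ := h₁ S hS
    _ ≤ ENNReal.ofReal (Real.exp ε₁) *
          (ENNReal.ofReal (Real.exp ε₂) * ρ S + ENNReal.ofReal δ₂) + ENNReal.ofReal δ₁ := by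
        gcongr; exact h₂ S hS
    _ = _ := by
        rw [Real.exp_add, ENNReal.ofReal_mul (Real.exp_pos _).le,
          ENNReal.ofReal_add hδ₁ (by positivity), ENNReal.ofReal_mul (Real.exp_pos _).le]
        ring

/-- Replacing one factor of a product of independent components. -/
theorem Indistinguishable.prod_right {ε δ : ℝ} {μ ν : Measure Ω} [SFinite μ] [SFinite ν]
    (h : Indistinguishable ε δ μ ν) (ρ : Measure Ω') [IsProbabilityMeasure ρ] :
    Indistinguishable ε δ (μ.prod ρ) (ν.prod ρ) := by
  intro S hS
  rw [Measure.prod_apply_symm hS, Measure.prod_apply_symm hS]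
  calc ∫⁻ y, μ ((fun x => (x, y)) ⁻¹' S) ∂ρ
      ≤ ∫⁻ y, (ENNReal.ofReal (Real.exp ε) * ν ((fun x => (x, y)) ⁻¹' S)
          + ENNReal.ofReal δ) ∂ρ :=
        lintegral_mono fun y => h _ (measurable_prodMk_right hS)
    _ = _ := by
        rw [lintegral_add_right _ measurable_const,
          lintegral_const_mul _ (measurable_measure_prodMk_right hS)]
        simp

/-- Replacing one component of a product of `k` independent components. -/
theorem Indistinguishable.pi_of_eq_off {k : ℕ} {ε δ : ℝ} {μ ν : Fin k → Measure Ω}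
    [∀ i, IsProbabilityMeasure (μ i)] [∀ i, IsProbabilityMeasure (ν i)] (i : Fin k)
    (h : Indistinguishable ε δ (μ i) (ν i)) (hoff : ∀ j, j ≠ i → μ j = ν j) :
    Indistinguishable ε δ (Measure.pi μ) (Measure.pi ν) := by
  cases k with
  | zero => exact i.elim0
  | succ k =>
    have key : ∀ ρ : Fin (k + 1) → Measure Ω, (∀ i, IsProbabilityMeasure (ρ i)) →
        Measure.pi ρ = ((ρ i).prod (Measure.pi fun j => ρ (i.succAbove j))).map
          (MeasurableEquiv.piFinSuccAbove (fun _ => Ω) i).symm := by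
      intro ρ _
      exact ((measurePreserving_piFinSuccAbove ρ i).symm).map_eq.symm
    rw [key μ inferInstance, key ν inferInstance]
    have : (fun j => μ (i.succAbove j)) = fun j => ν (i.succAbove j) := by
      funext j
      exact hoff _ (Fin.succAbove_ne i j)
    rw [this]
    exact (h.prod_right _).map (MeasurableEquiv.measurable _)

end Indistinguishable

theorem integral_exp_neg_abs_div {b : ℝ} (hb : 0 < b) :
    ∫ x : ℝ, Real.exp (-|x| / b) / (2 * b) = 1 := by
  rw [integral_comp_abs (f := fun x => Real.exp (-x / b) / (2 * b)), integral_div]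
  have : ∫ x in Set.Ioi (0 : ℝ), Real.exp (-x / b) = b := by
    have h := integral_exp_mul_Ioi (a := -b⁻¹) (by simpa using hb) 0
    simp only [mul_zero, Real.exp_zero] at h
    rw [show (fun x : ℝ => Real.exp (-x / b)) = fun x => Real.exp (-b⁻¹ * x) by
      funext x; congr 1; ring, h]
    field_simp
  rw [this]
  field_simp

theorem isProbabilityMeasure_laplace {b : ℝ} (hb : 0 < b) : IsProbabilityMeasure (laplace b) := by
  constructor
  rw [laplace, withDensity_apply _ MeasurableSet.univ, Measure.restrict_univ,
    ← ofReal_integral_eq_lintegral_ofReal, integral_exp_neg_abs_div hb, ENNReal.ofReal_one]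
  · exact Integrable.of_integral_ne_zero (by rw [integral_exp_neg_abs_div hb]; exact one_ne_zero)
  · exact ae_of_all _ fun x => by positivity

theorem measurable_laplace_density (b : ℝ) :
    Measurable fun x : ℝ => ENNReal.ofReal (Real.exp (-|x| / b) / (2 * b)) := by
  fun_prop

/-- Translating Laplace noise by `a` changes expectations by a factor of at most `exp (|a| / b)`. -/
theorem lintegral_laplace_shift_le {b : ℝ} (hb : 0 < b) (a : ℝ) {f : ℝ → ℝ≥0∞}
    (hf : Measurable f) :
    ∫⁻ x, f (x + a) ∂laplace b ≤ ENNReal.ofReal (Real.exp (|a| / b)) * ∫⁻ x, f x ∂laplace b := by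
  have hm := measurable_laplace_density b
  rw [laplace, lintegral_withDensity_eq_lintegral_mul _ hm (by fun_prop),
    lintegral_withDensity_eq_lintegral_mul _ hm hf,
    ← lintegral_const_mul _ (hm.mul hf),
    ← lintegral_add_right_eq_self (μ := volume) (fun x => ENNReal.ofReal (Real.exp (|a| / b)) *
      ((fun x : ℝ => ENNReal.ofReal (Real.exp (-|x| / b) / (2 * b))) * f) x) a]
  refine lintegral_mono fun x => ?_
  simp only [Pi.mul_apply]
  rw [← mul_assoc, ← ENNReal.ofReal_mul (Real.exp_pos _).le]
  gcongr
  rw [← mul_div_assoc, ← Real.exp_add, ← add_div]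
  gcongr
  have := abs_add_le x a
  linarith

theorem laplace_preimage_shift_le {b : ℝ} (hb : 0 < b) (a : ℝ) {s : Set ℝ} (hs : MeasurableSet s) :
    laplace b {x | x + a ∈ s} ≤ ENNReal.ofReal (Real.exp (|a| / b)) * laplace b s := by
  have h := lintegral_laplace_shift_le hb a (f := s.indicator 1)
    (measurable_const.indicator hs)
  rw [lintegral_indicator_one hs] at h
  have h2 : (fun x => s.indicator (1 : ℝ → ℝ≥0∞) (x + a)) = {x | x + a ∈ s}.indicator 1 := by
    funext x
    simp [Set.indicator]
  rwa [h2, lintegral_indicator_one (by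
    exact (measurable_id.add_const a) hs)] at h

theorem laplace_Iic_neg_le {b : ℝ} (hb : 0 < b) (t : ℝ) :
    laplace b (Set.Iic (-t)) ≤ ENNReal.ofReal (Real.exp (-t / b)) := by
  have := isProbabilityMeasure_laplace hb
  rcases le_total t 0 with ht | ht
  · refine prob_le_one.trans ?_
    rw [← ENNReal.ofReal_one]
    apply ENNReal.ofReal_le_ofReal
    rw [Real.one_le_exp_iff]
    exact div_nonneg (by linarith) hb.le
  calc laplace b (Set.Iic (-t))
      = ∫⁻ x in Set.Iic (-t), ENNReal.ofReal (Real.exp (-|x| / b) / (2 * b)) := by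
        rw [laplace, withDensity_apply _ measurableSet_Iic]
    _ ≤ ∫⁻ x in Set.Iic (-t), ENNReal.ofReal (Real.exp (-t / b)) *
          ENNReal.ofReal (Real.exp (-|x + t| / b) / (2 * b)) := by
        refine setLIntegral_mono' measurableSet_Iic fun x hx => ?_
        rw [← ENNReal.ofReal_mul (Real.exp_pos _).le, ← mul_div_assoc, ← Real.exp_add, ← add_div]
        have hx : x ≤ -t := hx
        rw [abs_of_nonpos (by linarith), abs_of_nonpos (by linarith)]
        gcongr
        linarith
    _ ≤ ∫⁻ x, ENNReal.ofReal (Real.exp (-t / b)) *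
          ENNReal.ofReal (Real.exp (-|x + t| / b) / (2 * b)) := setLIntegral_le_lintegral _ _
    _ = ENNReal.ofReal (Real.exp (-t / b)) * laplace b Set.univ := by
        rw [lintegral_const_mul _ (by fun_prop), laplace, withDensity_apply _ MeasurableSet.univ,
          Measure.restrict_univ, lintegral_add_right_eq_self
            (fun x => ENNReal.ofReal (Real.exp (-|x| / b) / (2 * b)))]
    _ = _ := by rw [measure_univ, mul_one]

theorem laplace_map_neg (b : ℝ) : (laplace b).map (fun x => -x) = laplace b := by
  ext s hs
  rw [Measure.map_apply measurable_neg hs, laplace, withDensity_apply _ hs,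
    withDensity_apply _ (measurable_neg hs), ← lintegral_indicator hs,
    ← lintegral_indicator (measurable_neg hs), ← lintegral_neg_eq_self]
  congr 1
  funext x
  have h : -x ∈ Neg.neg ⁻¹' s ↔ x ∈ s := by rw [Set.mem_preimage, neg_neg]
  by_cases hx : x ∈ s
  · rw [Set.indicator_of_mem hx, Set.indicator_of_mem (h.2 hx), abs_neg]
  · rw [Set.indicator_of_notMem hx, Set.indicator_of_notMem (mt h.1 hx)]

theorem laplace_Ici_le {b : ℝ} (hb : 0 < b) (t : ℝ) :
    laplace b (Set.Ici t) ≤ ENNReal.ofReal (Real.exp (-t / b)) := by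
  rw [← laplace_map_neg, Measure.map_apply measurable_neg measurableSet_Ici]
  simpa using laplace_Iic_neg_le hb t


/-! ### Group privacy for independently averaged clusters -/

open Classical in
/-- The points with label `i` in a multiset of labelled points. -/
noncomputable def labelClass {d k : ℕ} (L : Multiset (Fin k × Pt d)) (i : Fin k) : Multiset (Pt d) :=
  (L.filter fun a => a.1 = i).map Prod.snd

/-- The joint law of independent runs of the algorithm `A` on the label classes of `L`. -/
noncomputable def labelledLaw {d k : ℕ} (A : Multiset (Pt d) → Measure (Pt d))
    (L : Multiset (Fin k × Pt d)) : Measure (Fin k → Pt d) :=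
  Measure.pi fun i => A (labelClass L i)

section GroupPrivacy

variable {d k : ℕ} {Λ ε δ : ℝ} {A : Multiset (Pt d) → Measure (Pt d)}

theorem labelClass_cons_self (a : Fin k × Pt d) (L : Multiset (Fin k × Pt d)) :
    labelClass (a ::ₘ L) a.1 = a.2 ::ₘ labelClass L a.1 := by
  simp [labelClass]

theorem labelClass_cons_of_ne (a : Fin k × Pt d) (L : Multiset (Fin k × Pt d)) {i : Fin k}
    (h : i ≠ a.1) : labelClass (a ::ₘ L) i = labelClass L i := by
  simp [labelClass, h.symm]

theorem mem_ball_of_mem_labelClass {L : Multiset (Fin k × Pt d)} (hL : ∀ a ∈ L, ‖a.2‖ ≤ Λ)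
    (i : Fin k) : ∀ y ∈ labelClass L i, ‖y‖ ≤ Λ := by
  intro y hy
  simp only [labelClass, Multiset.mem_map, Multiset.mem_filter] at hy
  obtain ⟨a, ⟨ha, -⟩, rfl⟩ := hy
  exact hL a ha

/-- `A` is a private algorithm on multisets of points of `B(0, Λ)`, with respect to addition and
deletion of a point. -/
def PrivateOnBall (Λ ε δ : ℝ) (A : Multiset (Pt d) → Measure (Pt d)) : Prop :=
  ∀ S : Multiset (Pt d), (∀ y ∈ S, ‖y‖ ≤ Λ) →
    IsProbabilityMeasure (A S) ∧ ∀ x : Pt d, ‖x‖ ≤ Λ →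
      Indistinguishable ε δ (A S) (A (x ::ₘ S)) ∧ Indistinguishable ε δ (A (x ::ₘ S)) (A S)

theorem PrivateOnBall.isProbabilityMeasure_labelledLaw (hA : PrivateOnBall Λ ε δ A)
    {L : Multiset (Fin k × Pt d)} (hL : ∀ a ∈ L, ‖a.2‖ ≤ Λ) :
    IsProbabilityMeasure (labelledLaw A L) := by
  have : ∀ i, IsProbabilityMeasure (A (labelClass L i)) := fun i =>
    (hA _ (mem_ball_of_mem_labelClass hL i)).1
  unfold labelledLaw
  infer_instance

theorem PrivateOnBall.labelledLaw_cons (hA : PrivateOnBall Λ ε δ A)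
    {L : Multiset (Fin k × Pt d)} (hL : ∀ a ∈ L, ‖a.2‖ ≤ Λ) {a : Fin k × Pt d}
    (ha : ‖a.2‖ ≤ Λ) :
    Indistinguishable ε δ (labelledLaw A L) (labelledLaw A (a ::ₘ L)) ∧
      Indistinguishable ε δ (labelledLaw A (a ::ₘ L)) (labelledLaw A L) := by
  have haL : ∀ b ∈ a ::ₘ L, ‖b.2‖ ≤ Λ := by
    intro b hb
    rcases Multiset.mem_cons.1 hb with rfl | hb
    exacts [ha, hL b hb]
  have h1 : ∀ i, IsProbabilityMeasure (A (labelClass L i)) := fun i =>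
    (hA _ (mem_ball_of_mem_labelClass hL i)).1
  have h2 : ∀ i, IsProbabilityMeasure (A (labelClass (a ::ₘ L) i)) := fun i =>
    (hA _ (mem_ball_of_mem_labelClass haL i)).1
  have h3 := (hA _ (mem_ball_of_mem_labelClass hL a.1)).2 a.2 ha
  rw [← labelClass_cons_self] at h3
  exact ⟨h3.1.pi_of_eq_off a.1 fun j hj => by rw [labelClass_cons_of_ne a L hj],
    h3.2.pi_of_eq_off a.1 fun j hj => by rw [labelClass_cons_of_ne a L hj]⟩

theorem PrivateOnBall.labelledLaw_add (hA : PrivateOnBall Λ ε δ A) (hε : 0 ≤ ε) (hδ : 0 ≤ δ)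
    {C : Multiset (Fin k × Pt d)} (hC : ∀ a ∈ C, ‖a.2‖ ≤ Λ) (D : Multiset (Fin k × Pt d))
    (hD : ∀ a ∈ D, ‖a.2‖ ≤ Λ) :
    Indistinguishable (D.card * ε) (D.card * Real.exp (D.card * ε) * δ)
        (labelledLaw A C) (labelledLaw A (C + D)) ∧
      Indistinguishable (D.card * ε) (D.card * Real.exp (D.card * ε) * δ)
        (labelledLaw A (C + D)) (labelledLaw A C) := by
  induction D using Multiset.induction with
  | empty => simpa using Indistinguishable.refl (labelledLaw A C)
  | cons a D ih =>
    have hD' : ∀ b ∈ D, ‖b.2‖ ≤ Λ := fun b hb => hD b (Multiset.mem_cons_of_mem hb)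
    have hCD : ∀ b ∈ C + D, ‖b.2‖ ≤ Λ := by
      intro b hb
      rcases Multiset.mem_add.1 hb with hb | hb
      exacts [hC b hb, hD' b hb]
    obtain ⟨ih1, ih2⟩ := ih hD'
    obtain ⟨s1, s2⟩ := hA.labelledLaw_cons hCD (hD a (Multiset.mem_cons_self a D))
    rw [Multiset.add_cons, Multiset.card_cons]
    have hexp : Real.exp ((D.card + 1 : ℕ) * ε) = Real.exp ε * Real.exp (D.card * ε) := by
      rw [← Real.exp_add]; push_cast; ring_nf
    have h1 : 1 ≤ Real.exp ε := Real.one_le_exp hε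
    have h2 : 1 ≤ Real.exp (D.card * ε) := Real.one_le_exp (by positivity)
    have hX : 0 ≤ (D.card : ℝ) * Real.exp (D.card * ε) * δ := by positivity
    constructor
    · refine (ih1.trans hX hδ s1).mono (le_of_eq (by push_cast; ring)) ?_
      rw [hexp]
      push_cast
      calc (D.card : ℝ) * Real.exp (D.card * ε) * δ + Real.exp (D.card * ε) * δ
          = 1 * ((D.card + 1) * Real.exp (D.card * ε) * δ) := by ring
        _ ≤ Real.exp ε * ((D.card + 1) * Real.exp (D.card * ε) * δ) := by gcongr
        _ = _ := by ring
    · refine (s2.trans hδ hX ih2).mono (le_of_eq (by push_cast; ring)) ?_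
      rw [hexp]
      push_cast
      calc δ + Real.exp ε * ((D.card : ℝ) * Real.exp (D.card * ε) * δ)
          ≤ (Real.exp ε * Real.exp (D.card * ε)) * δ
              + Real.exp ε * ((D.card : ℝ) * Real.exp (D.card * ε) * δ) := by
            gcongr
            exact le_mul_of_one_le_left hδ (by nlinarith)
        _ = _ := by ring

/-- Group privacy: `N` additions and deletions of labelled points, whichever labels they have,
cost `N ε` in total. -/
theorem PrivateOnBall.labelledLaw_add_add (hA : PrivateOnBall Λ ε δ A) (hε : 0 ≤ ε) (hδ : 0 ≤ δ)
    {C D D' : Multiset (Fin k × Pt d)} (hCD : ∀ a ∈ C + D, ‖a.2‖ ≤ Λ)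
    (hCD' : ∀ a ∈ C + D', ‖a.2‖ ≤ Λ) {N : ℝ} (hN : (D.card + D'.card : ℝ) ≤ N) :
    Indistinguishable (N * ε) (N * Real.exp (N * ε) * δ)
      (labelledLaw A (C + D)) (labelledLaw A (C + D')) := by
  have hC : ∀ a ∈ C, ‖a.2‖ ≤ Λ := fun a ha => hCD a (Multiset.mem_add.2 (Or.inl ha))
  have h1 := (hA.labelledLaw_add hε hδ hC D fun a ha => hCD a (Multiset.mem_add.2 (Or.inr ha))).2
  have h2 := (hA.labelledLaw_add hε hδ hC D' fun a ha => hCD' a (Multiset.mem_add.2 (Or.inr ha))).1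
  have hN0 : 0 ≤ N := le_trans (by positivity) hN
  refine (h1.trans (by positivity) (by positivity) h2).mono ?_ ?_
  · rw [← add_mul]; gcongr
  · have e1 : 1 ≤ Real.exp (D'.card * ε) := Real.one_le_exp (by positivity)
    calc (D.card : ℝ) * Real.exp (D.card * ε) * δ
          + Real.exp (D.card * ε) * (D'.card * Real.exp (D'.card * ε) * δ)
        ≤ (D.card : ℝ) * (Real.exp (D.card * ε) * Real.exp (D'.card * ε)) * δ
          + Real.exp (D.card * ε) * (D'.card * Real.exp (D'.card * ε) * δ) := by
          gcongr
          exact le_mul_of_one_le_right (Real.exp_pos _).le e1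
      _ = (D.card + D'.card) * Real.exp ((D.card + D'.card) * ε) * δ := by
          rw [add_mul (D.card : ℝ) _ ε, Real.exp_add]; ring
      _ ≤ N * Real.exp (N * ε) * δ := by gcongr

end GroupPrivacy

theorem toTuple_comp_equiv {d k : ℕ} (σ : Fin k ≃ Fin k) (a : Fin k → Pt d) :
    toTuple (a ∘ σ) = toTuple a := by
  apply Subtype.ext
  simp only [toTuple]
  rw [← Multiset.map_map, Multiset.map_univ_val_equiv]

theorem labelClass_map_label {d k : ℕ} (L : Multiset (Fin k × Pt d)) (σ : Fin k ≃ Fin k)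
    (i : Fin k) : labelClass (L.map fun a => (σ a.1, a.2)) (σ i) = labelClass L i := by
  simp [labelClass, Multiset.filter_map]

/-- As the output is unordered, permuting the labels does not change its law. -/
theorem labelledLaw_map_label {d k : ℕ} (A : Multiset (Pt d) → Measure (Pt d))
    (L : Multiset (Fin k × Pt d)) (σ : Fin k ≃ Fin k)
    (hL : ∀ i, IsProbabilityMeasure (A (labelClass L i))) :
    (labelledLaw A (L.map fun a => (σ a.1, a.2))).map toTuple = (labelledLaw A L).map toTuple := by
  have hμ : ∀ i, IsProbabilityMeasure (A (labelClass (L.map fun a => (σ a.1, a.2)) i)) := by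
    intro i
    rw [← σ.apply_symm_apply i, labelClass_map_label]
    exact hL _
  have h := Measure.pi_map_piCongrLeft σ (β := fun _ => Pt d)
    (fun i => A (labelClass (L.map fun a => (σ a.1, a.2)) i))
  simp only [labelClass_map_label] at h
  have ht : Measurable (toTuple (d := d) (k := k)) := fun s hs => hs
  unfold labelledLaw
  rw [← h, Measure.map_map ht (MeasurableEquiv.measurable _)]
  congr 1
  funext a
  rw [Function.comp_apply, ← toTuple_comp_equiv σ]
  congr 1
  funext i
  simp [MeasurableEquiv.piCongrLeft]


/-! ### Far balls determine the clusters of the tuples they partition -/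

section Geometry

variable {d k n : ℕ}

theorem existsUnique_isNearest (hk : 0 < k) (c : Fin k → Pt d) (x : Pt d) :
    ∃! i, IsNearest c x i := by
  have : Nonempty (Fin k) := ⟨⟨0, hk⟩⟩
  have hex : ∃ i, ∀ j, dist x (c i) ≤ dist x (c j) := by
    obtain ⟨i, hi⟩ := Finite.exists_min fun i => dist x (c i)
    exact ⟨i, hi⟩
  classical
  refine ⟨Fin.find _ hex, ⟨Fin.find_spec hex, fun j hj => ?_⟩, ?_⟩
  · have hmin := Fin.find_min hex hj
    push Not at hmin
    obtain ⟨l, hl⟩ := hmin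
    exact (Fin.find_spec hex l).trans_lt hl
  · rintro i ⟨hi, hi'⟩
    rw [eq_comm, Fin.find_eq_iff]
    refine ⟨hi, fun j hj h => ?_⟩
    exact absurd (h i) (not_le.2 (hi' j hj))

/-- The index of the nearest center, ties being broken by the smallest index. -/
noncomputable def nearest (hk : 0 < k) (c : Fin k → Pt d) (x : Pt d) : Fin k :=
  (existsUnique_isNearest hk c x).choose

theorem isNearest_iff_nearest_eq (hk : 0 < k) (c : Fin k → Pt d) (x : Pt d) (i : Fin k) :
    IsNearest c x i ↔ nearest hk c x = i := by
  have h := (existsUnique_isNearest hk c x).choose_spec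
  exact ⟨fun hi => (h.2 i hi).symm, fun hi => hi ▸ h.1⟩

/-- The points of a database, labelled by the index of their nearest center. -/
noncomputable def nearestLabels (hk : 0 < k) (c : Fin k → Pt d) (T : Fin n → Sym (Pt d) k) :
    Multiset (Fin k × Pt d) :=
  ∑ j, (T j : Multiset (Pt d)).map fun x => (nearest hk c x, x)

theorem labelClass_nearestLabels (hk : 0 < k) (c : Fin k → Pt d) (T : Fin n → Sym (Pt d) k)
    (i : Fin k) : labelClass (nearestLabels hk c T) i = cluster T c i := by
  classical
  have h : nearestLabels hk c T = (points T).map fun x => (nearest hk c x, x) :=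
    (map_sum (Multiset.mapAddMonoidHom fun x => (nearest hk c x, x)) _ _).symm
  rw [h, labelClass, cluster, Multiset.filter_map, Multiset.map_map]
  simp only [Function.comp_def, Multiset.map_id']
  exact Multiset.filter_congr fun x _ => (isNearest_iff_nearest_eq hk c x i).symm

/-- A family of `7`-far balls with real radii. -/
def RealFarBalls (c : Fin k → Pt d) (r : Fin k → ℝ) : Prop :=
  Function.Injective c ∧ (∀ i, 0 ≤ r i) ∧ ∀ i j, i ≠ j → 7 * r i ≤ dist (c i) (c j)

/-- Far balls that partition a tuple are not empty, so that their radii are nonnegative; if there are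
at least two of them, then the radii are finite as well. -/
theorem PartitionedBy.exists_realFarBalls [Nontrivial (Fin k)] {B : Fin k → Ball d}
    {Y : Sym (Pt d) k} (h : PartitionedBy 7 B Y) :
    ∃ r : Fin k → ℝ, RealFarBalls (fun i => (B i).center) r ∧
      ∀ i x, x ∈ (B i).carrier ↔ dist x (B i).center ≤ r i := by
  classical
  obtain ⟨⟨hinj, hfar⟩, hcount⟩ := h
  have h0 : ∀ i, (0 : EReal) ≤ (B i).radius := by
    intro i
    have : 0 < Multiset.countP (fun y => y ∈ (B i).carrier) (Y : Multiset (Pt d)) := by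
      rw [hcount i]; exact one_pos
    obtain ⟨y, -, hy⟩ := Multiset.countP_pos.1 this
    exact le_trans (EReal.coe_nonneg.2 dist_nonneg) hy
  have h1 : ∀ i j, i ≠ j → (7 : EReal) * (B i).radius ≤
      ((dist (B i).center (B j).center : ℝ) : EReal) := by
    intro i j hij
    refine le_trans ?_ (hfar i j hij)
    exact mul_le_mul_of_nonneg_left (le_max_left _ _) (by norm_num)
  have htop : ∀ i, (B i).radius ≠ ⊤ := by
    intro i hi
    obtain ⟨j, hj⟩ := exists_ne i
    have := h1 i j hj.symm
    rw [hi, EReal.mul_top_of_pos (by norm_num)] at this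
    exact absurd (top_le_iff.1 this) (EReal.coe_ne_top _)
  have hcoe : ∀ i, (((B i).radius.toReal : ℝ) : EReal) = (B i).radius := fun i =>
    EReal.coe_toReal (htop i) (fun hb => by simpa [hb] using h0 i)
  refine ⟨fun i => (B i).radius.toReal, ⟨hinj, fun i => EReal.toReal_nonneg (h0 i), ?_⟩, ?_⟩
  · intro i j hij
    have := h1 i j hij
    have h7 : (7 : EReal) = ((7 : ℝ) : EReal) := rfl
    rwa [← hcoe i, h7, ← EReal.coe_mul, EReal.coe_le_coe_iff] at this
  · intro i x
    rw [← EReal.coe_le_coe_iff, hcoe i]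
    rfl

variable {c c' : Fin k → Pt d} {r r' : Fin k → ℝ}

/-- The center of the ball that contains a point is the nearest one, and there is no tie: two centers
are at least seven radii apart, and distinct if the radius is zero. -/
theorem RealFarBalls.nearest_eq (hk : 0 < k) (h : RealFarBalls c r) {x : Pt d} {i : Fin k}
    (hx : dist x (c i) ≤ r i) : nearest hk c x = i := by
  obtain ⟨hinj, h0, hfar⟩ := h
  have hlt : ∀ j, j ≠ i → dist x (c i) < dist x (c j) := by
    intro j hj
    have h1 := hfar i j hj.symm
    have h2 := dist_triangle_left (c i) (c j) x
    have h3 : 0 < dist (c i) (c j) := dist_pos.2 fun hc => hj (hinj hc).symm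
    rcases (h0 i).eq_or_lt with hr | hr <;> linarith
  rw [← isNearest_iff_nearest_eq]
  refine ⟨fun j => ?_, fun j hj => hlt j hj.ne⟩
  rcases eq_or_ne j i with rfl | hj
  exacts [le_rfl, (hlt j hj).le]

/-- A tuple that is partitioned by far balls consists of one entry from each ball. -/
theorem RealFarBalls.exists_enumeration (hk : 0 < k) (h : RealFarBalls c r) {Y : Sym (Pt d) k}
    (hY : ∀ i, ∃ y ∈ Y, dist y (c i) ≤ r i) :
    ∃ y : Fin k → Pt d, (∀ i, dist (y i) (c i) ≤ r i) ∧ (∀ i, y i ∈ Y) ∧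
      Function.Injective y ∧ ∀ z ∈ Y, ∃ i, y i = z := by
  choose y hyY hy using hY
  have hinj : Function.Injective y := by
    intro i j hij
    have h1 := h.nearest_eq hk (hy i)
    have h2 := h.nearest_eq hk (hy j)
    rw [← h1, ← h2, hij]
  refine ⟨y, hy, hyY, hinj, fun z hz => ?_⟩
  have hle : Finset.univ.val.map y ≤ (Y : Multiset (Pt d)) := by
    rw [Multiset.le_iff_subset ((Multiset.nodup_map_iff_of_injective hinj).2 Finset.univ.nodup)]
    intro w hw
    obtain ⟨i, -, rfl⟩ := Multiset.mem_map.1 hw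
    exact hyY i
  have heq : Finset.univ.val.map y = (Y : Multiset (Pt d)) := by
    apply Multiset.eq_of_le_of_card_le hle
    simp
  have hz' : z ∈ Finset.univ.val.map y := by rw [heq]; exact hz
  obtain ⟨i, -, hi⟩ := Multiset.mem_map.1 hz'
  exact ⟨i, hi⟩

/-- Two families of far balls match in at most one way: if ball `i` meets both `a` and `b`, and
`b` also meets another ball `i'`, then all the radii involved would have to vanish. -/
theorem RealFarBalls.eq_of_meet (h : RealFarBalls c r) (h' : RealFarBalls c' r') {i i' a b : Fin k}
    (hia : dist (c i) (c' a) ≤ r i + r' a) (hib : dist (c i) (c' b) ≤ r i + r' b)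
    (hib' : dist (c i') (c' b) ≤ r i' + r' b) (hi : i' ≠ i) : a = b := by
  by_contra hab
  obtain ⟨-, h0, hfar⟩ := h
  obtain ⟨hinj', h0', hfar'⟩ := h'
  have e1 := hfar i i' hi.symm
  have e2 := hfar i' i hi
  have e3 := hfar' a b hab
  have e4 := hfar' b a (Ne.symm hab)
  have t1 := dist_triangle_left (c' a) (c' b) (c i)
  have t2 := dist_triangle_right (c i) (c i') (c' b)
  rw [dist_comm (c i') (c i)] at e2
  rw [dist_comm (c' b) (c' a)] at e4
  have p : 0 < dist (c' a) (c' b) := dist_pos.2 fun hc => hab (hinj' hc)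
  have := h0 i
  have := h0 i'
  have := h0' a
  have := h0' b
  linarith

/-- Two families of far balls induce the same clustering, up to a permutation of the clusters, on
all the tuples that both of them partition. -/
theorem exists_perm_nearest (hk : 0 < k) (B B' : Fin k → Ball d) :
    ∃ σ : Fin k ≃ Fin k, ∀ Y : Sym (Pt d) k, PartitionedBy 7 B Y → PartitionedBy 7 B' Y →
      ∀ y ∈ Y, σ (nearest hk (fun i => (B' i).center) y) =
        nearest hk (fun i => (B i).center) y := by
  classical
  rcases subsingleton_or_nontrivial (Fin k) with hs | hs
  · exact ⟨Equiv.refl _, fun _ _ _ _ _ => Subsingleton.elim _ _⟩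
  by_cases hex : ∃ Z, PartitionedBy 7 B Z ∧ PartitionedBy 7 B' Z
  swap
  · exact ⟨Equiv.refl _, fun Y h h' => (hex ⟨Y, h, h'⟩).elim⟩
  obtain ⟨Z, hZ, hZ'⟩ := hex
  obtain ⟨r, hr, hB⟩ := hZ.exists_realFarBalls
  obtain ⟨r', hr', hB'⟩ := hZ'.exists_realFarBalls
  have hmem : ∀ {B : Fin k → Ball d} {r : Fin k → ℝ},
      (∀ i x, x ∈ (B i).carrier ↔ dist x (B i).center ≤ r i) → ∀ {Y : Sym (Pt d) k},
      PartitionedBy 7 B Y → ∀ i, ∃ y ∈ Y, dist y (B i).center ≤ r i := by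
    intro B r hB Y hY i
    have : 0 < Multiset.countP (fun y => y ∈ (B i).carrier) (Y : Multiset (Pt d)) := by
      rw [hY.2 i]; exact one_pos
    obtain ⟨y, hy, hyB⟩ := Multiset.countP_pos.1 this
    exact ⟨y, hy, (hB i y).1 hyB⟩
  obtain ⟨z, hz, hzZ, hzinj, -⟩ := hr.exists_enumeration hk (hmem hB hZ)
  obtain ⟨z', hz', -, -, hsurj'⟩ := hr'.exists_enumeration hk (hmem hB' hZ')
  set f : Fin k → Fin k := fun i => nearest hk (fun i => (B' i).center) (z i) with hf
  have hzf : ∀ i, z' (f i) = z i := by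
    intro i
    obtain ⟨a, ha⟩ := hsurj' (z i) (hzZ i)
    have : f i = a := by rw [hf]; exact hr'.nearest_eq hk (ha ▸ hz' a)
    rw [this, ha]
  have hfinj : Function.Injective f := by
    intro i j hij
    apply hzinj
    rw [← hzf i, ← hzf j, hij]
  have hfbij := Finite.injective_iff_bijective.1 hfinj
  refine ⟨(Equiv.ofBijective f hfbij).symm, fun W hW hW' w hw => ?_⟩
  obtain ⟨y, hy, -, -, hys⟩ := hr.exists_enumeration hk (hmem hB hW)
  obtain ⟨y', hy', -, -, hys'⟩ := hr'.exists_enumeration hk (hmem hB' hW')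
  obtain ⟨i, hi⟩ := hys w hw
  obtain ⟨b, hb⟩ := hys' w hw
  have hwi : dist w (B i).center ≤ r i := hi ▸ hy i
  have hwb : dist w (B' b).center ≤ r' b := hb ▸ hy' b
  rw [hr.nearest_eq hk hwi, hr'.nearest_eq hk hwb, Equiv.symm_apply_eq, Equiv.ofBijective_apply]
  have hmeet : ∀ i, dist (B i).center (B' (f i)).center ≤ r i + r' (f i) := fun i =>
    (dist_triangle_left _ _ (z i)).trans (add_le_add (hz i) (hzf i ▸ hz' (f i)))
  obtain ⟨i', hi'⟩ := hfbij.2 b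
  by_contra hne
  have hii : i' ≠ i := fun h => hne (by rw [← h, hi'])
  exact hne (hr.eq_of_meet hr' (hmeet i)
    ((dist_triangle_left _ _ w).trans (add_le_add hwi hwb)) (hi' ▸ hmeet i') hii).symm

end Geometry

/-! ### Comparing the noisy averages of neighboring databases -/

section Compare

variable {d k n : ℕ} {Λ ε δ : ℝ} {A : Multiset (Pt d) → Measure (Pt d)}

/-- The law of the noisy averages of the clusters around the centers `c`. -/
noncomputable def averagesLaw (A : Multiset (Pt d) → Measure (Pt d)) (T : Fin n → Sym (Pt d) k)
    (c : Fin k → Pt d) : Measure (Sym (Pt d) k) :=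
  (Measure.pi fun i => A (cluster T c i)).map toTuple

theorem averagesLaw_eq (hk : 0 < k) (A : Multiset (Pt d) → Measure (Pt d))
    (T : Fin n → Sym (Pt d) k) (c : Fin k → Pt d) :
    averagesLaw A T c = (labelledLaw A (nearestLabels hk c T)).map toTuple := by
  simp only [averagesLaw, labelledLaw, labelClass_nearestLabels]

theorem measurable_toTuple : Measurable (toTuple (d := d) (k := k)) := fun _ hs => hs

theorem norm_le_of_mem_nearestLabels (hk : 0 < k) {T : Fin n → Sym (Pt d) k}
    (hT : ∀ i, ∀ x ∈ T i, ‖x‖ ≤ Λ) (c : Fin k → Pt d) :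
    ∀ a ∈ nearestLabels hk c T, ‖a.2‖ ≤ Λ := by
  intro a ha
  rw [nearestLabels, Multiset.mem_sum] at ha
  obtain ⟨j, -, hj⟩ := ha
  obtain ⟨x, hx, rfl⟩ := Multiset.mem_map.1 hj
  exact hT j x hx

theorem isProbabilityMeasure_averagesLaw (hk : 0 < k) (hA : PrivateOnBall Λ ε δ A)
    {T : Fin n → Sym (Pt d) k} (hT : ∀ i, ∀ x ∈ T i, ‖x‖ ≤ Λ) (c : Fin k → Pt d) :
    IsProbabilityMeasure (averagesLaw A T c) := by
  rw [averagesLaw_eq hk]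
  have := hA.isProbabilityMeasure_labelledLaw (norm_le_of_mem_nearestLabels hk hT c)
  exact Measure.isProbabilityMeasure_map measurable_toTuple.aemeasurable

/-- If two clusterings agree, up to a permutation, on the tuples of `G`, where the two databases
agree as well, then the laws of the noisy averages are indistinguishable, at the price of deleting
and adding all the points of the other tuples. -/
theorem averagesLaw_indistinguishable (hk : 0 < k) (hA : PrivateOnBall Λ ε δ A) (hε : 0 ≤ ε)
    (hδ : 0 ≤ δ) {T T' : Fin n → Sym (Pt d) k} (hT : ∀ i, ∀ x ∈ T i, ‖x‖ ≤ Λ)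
    (hT' : ∀ i, ∀ x ∈ T' i, ‖x‖ ≤ Λ) (c c' : Fin k → Pt d) (σ : Fin k ≃ Fin k)
    (G : Finset (Fin n)) (hG : ∀ i ∈ G, T i = T' i)
    (hσ : ∀ i ∈ G, ∀ y ∈ T i, σ (nearest hk c' y) = nearest hk c y) {N : ℝ}
    (hN : 2 * (k * (Gᶜ.card : ℝ)) ≤ N) :
    Indistinguishable (N * ε) (N * Real.exp (N * ε) * δ)
      (averagesLaw A T c) (averagesLaw A T' c') := by
  classical
  set f : Pt d → Fin k × Pt d := fun x => (nearest hk c x, x)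
  set f' : Pt d → Fin k × Pt d := fun x => (σ (nearest hk c' x), x)
  have e1 : nearestLabels hk c T = ∑ j ∈ G, (T j : Multiset (Pt d)).map f +
      ∑ j ∈ Gᶜ, (T j : Multiset (Pt d)).map f := (Finset.sum_add_sum_compl G _).symm
  have e2 : (nearestLabels hk c' T').map (fun a => (σ a.1, a.2)) =
      ∑ j ∈ G, (T j : Multiset (Pt d)).map f + ∑ j ∈ Gᶜ, (T' j : Multiset (Pt d)).map f' := by
    have : (nearestLabels hk c' T').map (fun a => (σ a.1, a.2)) =
        ∑ j, (T' j : Multiset (Pt d)).map f' := by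
      rw [nearestLabels, ← Multiset.coe_mapAddMonoidHom, map_sum]
      simp [f']
    rw [this, ← Finset.sum_add_sum_compl G]
    congr 1
    refine Finset.sum_congr rfl fun j hj => ?_
    rw [← hG j hj]
    exact Multiset.map_congr rfl fun y hy => by simp only [f, f', hσ j hj y hy]
  have hn1 := norm_le_of_mem_nearestLabels hk hT c
  have hn2 := norm_le_of_mem_nearestLabels hk hT' c'
  have hn3 : ∀ a ∈ (nearestLabels hk c' T').map (fun a => (σ a.1, a.2)), ‖a.2‖ ≤ Λ := by
    intro a ha
    obtain ⟨b, hb, rfl⟩ := Multiset.mem_map.1 ha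
    exact hn2 b hb
  have hcard : ∀ (S : Fin n → Sym (Pt d) k) (g : Pt d → Fin k × Pt d),
      (∑ j ∈ Gᶜ, (S j : Multiset (Pt d)).map g).card = Gᶜ.card * k := by
    intro S g
    rw [Multiset.card_sum]
    simp
  rw [averagesLaw_eq hk, averagesLaw_eq hk, ← labelledLaw_map_label A (nearestLabels hk c' T') σ
    fun i => (hA _ (mem_ball_of_mem_labelClass hn2 i)).1]
  refine Indistinguishable.map ?_ measurable_toTuple
  rw [e2] at hn3 ⊢
  rw [e1] at hn1 ⊢
  refine hA.labelledLaw_add_add hε hδ hn1 hn3 ?_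
  rw [hcard, hcard]
  push_cast
  linarith

/-- The same centers: only the changed row `j` matters. -/
theorem averagesLaw_indistinguishable_same (hk : 0 < k) (hA : PrivateOnBall Λ ε δ A) (hε : 0 ≤ ε)
    (hδ : 0 ≤ δ) {T T' : Fin n → Sym (Pt d) k} (hT : ∀ i, ∀ x ∈ T i, ‖x‖ ≤ Λ)
    (hT' : ∀ i, ∀ x ∈ T' i, ‖x‖ ≤ Λ) {j : Fin n} (hj : ∀ i, i ≠ j → T i = T' i)
    (c : Fin k → Pt d) :
    Indistinguishable (2 * k * ε) (2 * k * Real.exp (2 * k * ε) * δ)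
      (averagesLaw A T c) (averagesLaw A T' c) := by
  refine averagesLaw_indistinguishable hk hA hε hδ hT hT' c c (Equiv.refl _) {j}ᶜ
    (fun i hi => hj i (by simpa using hi)) (fun _ _ _ _ => rfl) (by simp)

open Classical in
/-- The number of rows other than `j` that are not partitioned by the balls `B_X`. -/
noncomputable def numBadOff (T : Fin n → Sym (Pt d) k) (j : Fin n) (X : Sym (Pt d) k) : ℕ :=
  (Finset.univ.filter fun i => i ≠ j ∧ ¬ PartitionedBy 7 (ballsOf 7 X) (T i)).card

theorem numBadOff_congr {T T' : Fin n → Sym (Pt d) k} {j : Fin n} (hj : ∀ i, i ≠ j → T i = T' i)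
    (X : Sym (Pt d) k) : numBadOff T j X = numBadOff T' j X := by
  classical
  unfold numBadOff
  congr 1
  refine Finset.filter_congr fun i _ => ?_
  refine and_congr_right fun hi => ?_
  rw [hj i hi]

theorem numBadOff_le_numBad (T : Fin n → Sym (Pt d) k) (j : Fin n) (X : Sym (Pt d) k) :
    numBadOff T j X ≤ numBad 7 T X := by
  unfold numBadOff numBad
  exact Finset.card_le_card fun i hi => by
    simp only [Finset.mem_filter] at hi ⊢
    exact ⟨hi.1, hi.2.2⟩

theorem numBad_le_numBadOff_add_one (T : Fin n → Sym (Pt d) k) (j : Fin n) (X : Sym (Pt d) k) :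
    numBad 7 T X ≤ numBadOff T j X + 1 := by
  classical
  unfold numBadOff numBad
  refine (Finset.card_le_card (t := insert j _) fun i hi => ?_).trans (Finset.card_insert_le _ _)
  simp only [Finset.mem_filter, Finset.mem_insert] at hi ⊢
  by_cases h : i = j
  exacts [Or.inl h, Or.inr ⟨hi.1, h, hi.2⟩]

/-- Different centers: every row has to be replaced that is changed, or is not partitioned by both
families of balls. -/
theorem averagesLaw_indistinguishable_of_numBadOff (hk : 0 < k) (hA : PrivateOnBall Λ ε δ A)
    (hε : 0 ≤ ε) (hδ : 0 ≤ δ) {T T' : Fin n → Sym (Pt d) k} (hT : ∀ i, ∀ x ∈ T i, ‖x‖ ≤ Λ)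
    (hT' : ∀ i, ∀ x ∈ T' i, ‖x‖ ≤ Λ) {j : Fin n} (hj : ∀ i, i ≠ j → T i = T' i)
    (X X' : Sym (Pt d) k) {N : ℝ}
    (hN : 2 * k * (numBadOff T j X + numBadOff T j X' + 1 : ℝ) ≤ N) :
    Indistinguishable (N * ε) (N * Real.exp (N * ε) * δ)
      (averagesLaw A T (enum X)) (averagesLaw A T' (enum X')) := by
  classical
  obtain ⟨σ, hσ⟩ := exists_perm_nearest hk (ballsOf 7 X) (ballsOf 7 X')
  refine averagesLaw_indistinguishable hk hA hε hδ hT hT' _ _ σ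
    (Finset.univ.filter fun i => i ≠ j ∧ PartitionedBy 7 (ballsOf 7 X) (T i) ∧
      PartitionedBy 7 (ballsOf 7 X') (T i)) ?_ ?_ (le_trans ?_ hN)
  · intro i hi
    exact hj i (Finset.mem_filter.1 hi).2.1
  · intro i hi y hy
    obtain ⟨-, -, h1, h2⟩ := Finset.mem_filter.1 hi
    exact hσ _ h1 h2 y hy
  · have hle : (Finset.univ.filter fun i => i ≠ j ∧ PartitionedBy 7 (ballsOf 7 X) (T i) ∧
        PartitionedBy 7 (ballsOf 7 X') (T i))ᶜ.card ≤
        numBadOff T j X + numBadOff T j X' + 1 := by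
      refine (Finset.card_le_card (t := insert j
        ((Finset.univ.filter fun i => i ≠ j ∧ ¬ PartitionedBy 7 (ballsOf 7 X) (T i)) ∪
        (Finset.univ.filter fun i => i ≠ j ∧ ¬ PartitionedBy 7 (ballsOf 7 X') (T i))))
        fun i hi => ?_).trans
        ((Finset.card_insert_le _ _).trans (add_le_add_left (Finset.card_union_le _ _) 1))
      simp only [Finset.mem_compl, Finset.mem_filter, Finset.mem_univ, true_and, Finset.mem_insert,
        Finset.mem_union] at hi ⊢
      tauto
    have : ((Finset.univ.filter fun i => i ≠ j ∧ PartitionedBy 7 (ballsOf 7 X) (T i) ∧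
        PartitionedBy 7 (ballsOf 7 X') (T i))ᶜ.card : ℝ) ≤
        numBadOff T j X + numBadOff T j X' + 1 := by exact_mod_cast hle
    nlinarith [(Nat.cast_nonneg k : (0 : ℝ) ≤ k)]

end Compare


/-! ### Random passing vectors -/

section PassingVectors

/-- The number of coordinates that are `true`. -/
def countTrue {m : ℕ} (v : Fin m → Bool) : ℕ := (Finset.univ.filter fun i => v i = true).card

/-- The value of `γ` at the first coordinate that is `true`, and `γ₀` if there is none. -/
def firstValue {α : Type*} {m : ℕ} (γ : Fin m → α) (γ₀ : α) (v : Fin m → Bool) : α :=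
  if h : ∃ i, v i = true then γ (Fin.find _ h) else γ₀

/-- The expectation of `H v`, where the coordinates `v i ∼ ρ i` are independent. -/
noncomputable def boolExpect {m : ℕ} (ρ : Fin m → Bool → ℝ≥0∞) (H : (Fin m → Bool) → ℝ≥0∞) :
    ℝ≥0∞ :=
  ∑ v, (∏ i, ρ i (v i)) * H v

theorem boolExpect_mono {m : ℕ} (ρ : Fin m → Bool → ℝ≥0∞) {H H' : (Fin m → Bool) → ℝ≥0∞}
    (h : ∀ v, H v ≤ H' v) : boolExpect ρ H ≤ boolExpect ρ H' :=
  Finset.sum_le_sum fun v _ => by gcongr; exact h v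

theorem boolExpect_add {m : ℕ} (ρ : Fin m → Bool → ℝ≥0∞) (H H' : (Fin m → Bool) → ℝ≥0∞) :
    boolExpect ρ (fun v => H v + H' v) = boolExpect ρ H + boolExpect ρ H' := by
  simp only [boolExpect, mul_add, Finset.sum_add_distrib]

theorem boolExpect_const_mul {m : ℕ} (ρ : Fin m → Bool → ℝ≥0∞) (c : ℝ≥0∞)
    (H : (Fin m → Bool) → ℝ≥0∞) : boolExpect ρ (fun v => c * H v) = c * boolExpect ρ H := by
  simp only [boolExpect, Finset.mul_sum]
  exact Finset.sum_congr rfl fun v _ => by ring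

theorem boolExpect_const {m : ℕ} {ρ : Fin m → Bool → ℝ≥0∞} (hρ : ∀ i, ∑ b, ρ i b = 1)
    (c : ℝ≥0∞) : boolExpect ρ (fun _ => c) = c := by
  simp only [boolExpect, ← Finset.sum_mul]
  rw [← Fintype.piFinset_univ, ← Finset.prod_univ_sum, Finset.prod_congr rfl fun i _ => hρ i]
  simp

theorem boolExpect_le_of_le {m : ℕ} {ρ ρ' : Fin m → Bool → ℝ≥0∞} {E : ℝ≥0∞}
    (h : ∀ i b, ρ i b ≤ E * ρ' i b) (H : (Fin m → Bool) → ℝ≥0∞) :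
    boolExpect ρ H ≤ E ^ m * boolExpect ρ' H := by
  simp only [boolExpect, Finset.mul_sum]
  refine Finset.sum_le_sum fun v _ => ?_
  rw [← mul_assoc]
  gcongr
  calc ∏ i, ρ i (v i) ≤ ∏ i, E * ρ' i (v i) := Finset.prod_le_prod' fun i _ => h i _
    _ = _ := by rw [Finset.prod_mul_distrib]; simp

/-- Averaging over coordinate `p` first, for fixed values of the other coordinates. -/
theorem boolExpect_insertNth {m : ℕ} (p : Fin (m + 1)) (ρ : Fin (m + 1) → Bool → ℝ≥0∞)
    (H : (Fin (m + 1) → Bool) → ℝ≥0∞) :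
    boolExpect ρ H = boolExpect (fun i => ρ (p.succAbove i)) fun u =>
      ∑ b, ρ p b * H (p.insertNth b u) := by
  simp only [boolExpect]
  rw [← (Fin.insertNthEquiv (fun _ => Bool) p).sum_comp, Fintype.sum_prod_type_right]
  refine Finset.sum_congr rfl fun u _ => ?_
  rw [Finset.mul_sum]
  refine Finset.sum_congr rfl fun b _ => ?_
  rw [Fin.prod_univ_succAbove _ p]
  simp [Fin.insertNthEquiv]
  ring

open Classical in
/-- Union bound. -/
theorem boolExpect_exists_le {m : ℕ} {ρ : Fin m → Bool → ℝ≥0∞} (hρ : ∀ i, ∑ b, ρ i b = 1)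
    (P : Fin m → Prop) {τ : ℝ≥0∞} (hτ : ∀ i, P i → ρ i true ≤ τ) :
    boolExpect ρ (fun v => if ∃ i, P i ∧ v i = true then 1 else 0) ≤ m * τ := by
  have h1 : ∀ i, P i → boolExpect ρ (fun v => if v i = true then 1 else 0) ≤ τ := by
    intro i hi
    cases m with
    | zero => exact i.elim0
    | succ m =>
      rw [boolExpect_insertNth i]
      simp only [Fintype.sum_bool, Fin.insertNth_apply_same]
      simp only [if_true, mul_one, Bool.false_eq_true, if_false, mul_zero, add_zero]
      rw [boolExpect_const fun j => hρ _]
      exact hτ i hi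
  calc boolExpect ρ (fun v => if ∃ i, P i ∧ v i = true then 1 else 0)
      ≤ boolExpect ρ (fun v => ∑ i, if P i then (if v i = true then 1 else 0) else 0) := by
        refine boolExpect_mono ρ fun v => ?_
        split_ifs with h
        · obtain ⟨i, hi, hv⟩ := h
          refine le_trans ?_ (Finset.single_le_sum (fun _ _ => zero_le) (Finset.mem_univ i))
          simp [hi, hv]
        · exact zero_le
    _ = ∑ i, boolExpect ρ (fun v => if P i then (if v i = true then 1 else 0) else 0) := by
        simp only [boolExpect, Finset.mul_sum]
        rw [Finset.sum_comm]
    _ ≤ ∑ _i : Fin m, τ := by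
        refine Finset.sum_le_sum fun i _ => ?_
        by_cases hi : P i
        · simpa [hi] using h1 i hi
        · simp [hi, boolExpect]
    _ = m * τ := by simp

theorem countTrue_insertNth {m : ℕ} (p : Fin (m + 1)) (b : Bool) (u : Fin m → Bool) :
    countTrue (p.insertNth (α := fun _ => Bool) b u) = countTrue u + if b then 1 else 0 := by
  simp only [countTrue, Finset.card_filter]
  rw [Fin.sum_univ_succAbove _ p]
  simp [add_comm]

/-- Inserting one more coordinate `b` at `p` into a vector which is not identically `false`: the
first `true` coordinate is the one of the given vector, or possibly `p` if `b` is `true`. -/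
theorem exists_firstValue_insertNth (α : Type*) {m : ℕ} (p : Fin (m + 1)) {u : Fin m → Bool}
    (hu : ∃ i, u i = true) :
    ∃ o : Fin m, u o = true ∧ ∃ q : Fin (m + 1), (q = p.succAbove o ∨ q = p) ∧
      ∀ (γ : Fin (m + 1) → α) (γ₀ : α),
        firstValue γ γ₀ (p.insertNth (α := fun _ => Bool) false u) = γ (p.succAbove o) ∧
        firstValue γ γ₀ (p.insertNth (α := fun _ => Bool) true u) = γ q := by
  obtain ⟨i, hi⟩ := hu
  have h0 : ∃ l, p.insertNth (α := fun _ => Bool) false u l = true := ⟨p.succAbove i, by simpa⟩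
  have h1 : ∃ l, p.insertNth (α := fun _ => Bool) true u l = true := ⟨p, by simp⟩
  have s0 := Fin.find_spec h0
  have s1 := Fin.find_spec h1
  obtain ⟨o, ho⟩ : ∃ o, p.succAbove o = Fin.find _ h0 := by
    apply Fin.exists_succAbove_eq
    intro h
    rw [h] at s0
    simp at s0
  refine ⟨o, by rw [← ho] at s0; simpa using s0, Fin.find _ h1, ?_, fun γ γ₀ => ⟨?_, ?_⟩⟩
  · by_cases hp : Fin.find _ h1 = p
    · exact Or.inr hp
    left
    obtain ⟨o', ho'⟩ := Fin.exists_succAbove_eq hp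
    rw [ho, ← ho']
    rw [← ho'] at s1
    rw [← ho] at s0
    apply le_antisymm
    · rw [ho']
      exact Fin.find_le_of_pos h1 (by rw [← ho]; simpa using s0)
    · exact Fin.find_le_of_pos h0 (by simpa using s1)
  · rw [firstValue, dif_pos h0, ho]
  · rw [firstValue, dif_pos h1]

/-- The probability of an event after the test, given the vector `v` of the passing tuples: the
test fails with probability `F`, resp. succeeds with probability `W`, in terms of the number of
passing tuples; given failure, resp. success with first passing tuple `i`, the event has
probability `φ`, resp. `γ i`. -/
noncomputable def outcomeProb {m : ℕ} (F W : ℕ → ℝ≥0∞) (φ : ℝ≥0∞) (γ : Fin m → ℝ≥0∞) (γ₀ : ℝ≥0∞)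
    (v : Fin m → Bool) : ℝ≥0∞ :=
  F (countTrue v) * φ + W (countTrue v) * firstValue γ γ₀ v

theorem firstValue_mem {m : ℕ} {γ : Fin m → ℝ≥0∞} {γ₀ : ℝ≥0∞} {P : ℝ≥0∞ → Prop}
    (h : ∀ i, P (γ i)) (h₀ : P γ₀) (v : Fin m → Bool) : P (firstValue γ γ₀ v) := by
  unfold firstValue
  split_ifs
  exacts [h _, h₀]

theorem outcomeProb_le_one {m : ℕ} {F W : ℕ → ℝ≥0∞} {φ γ₀ : ℝ≥0∞} {γ : Fin m → ℝ≥0∞}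
    (hFW : ∀ s, F s + W s = 1) (hφ : φ ≤ 1) (hγ : ∀ i, γ i ≤ 1) (hγ₀ : γ₀ ≤ 1)
    (v : Fin m → Bool) : outcomeProb F W φ γ γ₀ v ≤ 1 := by
  rw [← hFW (countTrue v), outcomeProb]
  gcongr
  · exact mul_le_of_le_one_right' hφ
  · exact mul_le_of_le_one_right' (firstValue_mem (P := (· ≤ 1)) hγ hγ₀ v)

/-- If the probabilities of passing change by factors of at most `E`, and the conditional
probabilities of the event by a factor of at most `R` and an error `η`, then the expected
probability changes by a factor of at most `E ^ m * R` and an error `η`. -/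
theorem boolExpect_outcomeProb_le {m : ℕ} {ρ ρ' : Fin m → Bool → ℝ≥0∞} {E R η : ℝ≥0∞}
    (hρ : ∀ i, ∑ b, ρ i b = 1) (hE : ∀ i b, ρ i b ≤ E * ρ' i b) {F W : ℕ → ℝ≥0∞}
    {φ γ₀ γ₀' : ℝ≥0∞} {γ γ' : Fin m → ℝ≥0∞} (hFW : ∀ s, F s + W s = 1) (hR : 1 ≤ R)
    (hγ : ∀ i, γ i ≤ R * γ' i + η) (hγ₀ : γ₀ ≤ R * γ₀' + η) :
    boolExpect ρ (outcomeProb F W φ γ γ₀) ≤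
      E ^ m * R * boolExpect ρ' (outcomeProb F W φ γ' γ₀') + η := by
  have h : ∀ v, outcomeProb F W φ γ γ₀ v ≤ R * outcomeProb F W φ γ' γ₀' v + η := by
    intro v
    have hv : firstValue γ γ₀ v ≤ R * firstValue γ' γ₀' v + η := by
      unfold firstValue
      split_ifs
      exacts [hγ _, hγ₀]
    have hW : W (countTrue v) ≤ 1 := by rw [← hFW (countTrue v)]; exact le_add_self
    unfold outcomeProb
    calc F (countTrue v) * φ + W (countTrue v) * firstValue γ γ₀ v
        ≤ R * (F (countTrue v) * φ) + W (countTrue v) * (R * firstValue γ' γ₀' v + η) := by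
          exact add_le_add (le_mul_of_one_le_left' hR) (by gcongr)
      _ = R * (F (countTrue v) * φ + W (countTrue v) * firstValue γ' γ₀' v)
          + W (countTrue v) * η := by ring
      _ ≤ _ := by
          gcongr
          exact mul_le_of_le_one_left' hW
  calc boolExpect ρ (outcomeProb F W φ γ γ₀)
      ≤ boolExpect ρ (fun v => R * outcomeProb F W φ γ' γ₀' v + η) := boolExpect_mono ρ h
    _ = R * boolExpect ρ (outcomeProb F W φ γ' γ₀') + η := by
        rw [boolExpect_add, boolExpect_const_mul, boolExpect_const hρ]
    _ ≤ R * (E ^ m * boolExpect ρ' (outcomeProb F W φ γ' γ₀')) + η := by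
        gcongr
        exact boolExpect_le_of_le hE _
    _ = _ := by ring

/-- The averaged comparison at one coordinate `p`, given the passing vector `u` of the other
coordinates, if the first passing tuple among them is good. -/
theorem outcomeProb_insertNth_le {m : ℕ} (p : Fin (m + 1)) {ρ ρ' : Bool → ℝ≥0∞}
    (hρ : ∑ b, ρ b = 1) (hρ' : ∑ b, ρ' b = 1) {F W : ℕ → ℝ≥0∞}
    {φ γ₀ γ₀' : ℝ≥0∞} {γ γ' : Fin (m + 1) → ℝ≥0∞} {E₁ R η κ ω : ℝ≥0∞}
    (hFW : ∀ s, F s + W s = 1) (hWmono : Monotone W) (hWE : ∀ s, W (s + 1) ≤ E₁ * W s)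
    (hFE : ∀ s, F s ≤ E₁ * F (s + 1)) (hFanti : Antitone F) (hω : W 1 ≤ ω)
    (hR : 1 ≤ R) (hγ1 : ∀ i, γ i ≤ 1) (hγ₀1 : γ₀ ≤ 1)
    {good : Fin m → Prop} {goodp goodp' : Prop}
    (h₁ : ∀ i, γ (p.succAbove i) ≤ R * γ' (p.succAbove i) + η)
    (h₂ : ∀ i, good i → goodp → γ p ≤ R * γ' (p.succAbove i) + η)
    (h₃ : ∀ i, good i → goodp' → γ (p.succAbove i) ≤ R * γ' p + η)
    (h₄ : goodp → goodp' → γ p ≤ R * γ' p + η)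
    (hκ : ¬ goodp → ρ true ≤ κ) (hκ' : ¬ goodp' → ρ' true ≤ κ)
    (u : Fin m → Bool) (hu : ∀ i, u i = true → good i) :
    ∑ b, ρ b * outcomeProb F W φ γ γ₀ (p.insertNth b u) ≤
      E₁ * R * (∑ b, ρ' b * outcomeProb F W φ γ' γ₀' (p.insertNth b u)) + (2 * κ + η + ω) := by
  have hW1 : ∀ s, W s ≤ 1 := fun s => by rw [← hFW s]; exact le_add_self
  set s := countTrue u with hs
  have hsplit : ∀ (ρ : Bool → ℝ≥0∞) (γ : Fin (m + 1) → ℝ≥0∞) (γ₀ : ℝ≥0∞),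
      ∑ b, ρ b * outcomeProb F W φ γ γ₀ (p.insertNth b u) =
      (∑ b, ρ b * F (s + if b then 1 else 0)) * φ + ∑ b, ρ b * (W (s + if b then 1 else 0) *
        firstValue γ γ₀ (p.insertNth (α := fun _ => Bool) b u)) := by
    intro ρ γ γ₀
    simp only [outcomeProb, countTrue_insertNth, mul_add, Finset.sum_add_distrib, Finset.sum_mul,
      ← hs, mul_assoc]
  rw [hsplit, hsplit]
  have hF : (∑ b, ρ b * F (s + if b then 1 else 0)) * φ ≤
      E₁ * R * ((∑ b, ρ' b * F (s + if b then 1 else 0)) * φ) := by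
    rw [← mul_assoc]
    gcongr
    calc ∑ b, ρ b * F (s + if b then 1 else 0) ≤ ∑ b, ρ b * F s := by
          refine Finset.sum_le_sum fun b _ => ?_
          gcongr
          exact hFanti (Nat.le_add_right _ _)
      _ = 1 * F s := by rw [← Finset.sum_mul, hρ]
      _ ≤ ∑ b, ρ' b * (E₁ * R * F (s + if b then 1 else 0)) := by
          rw [← hρ', Finset.sum_mul]
          refine Finset.sum_le_sum fun b _ => ?_
          gcongr
          calc F s ≤ E₁ * F (s + 1) := hFE s
            _ ≤ E₁ * F (s + if b then 1 else 0) := by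
                gcongr
                apply hFanti
                split_ifs <;> omega
            _ ≤ _ := by
                gcongr
                exact le_mul_of_one_le_right' hR
      _ = _ := by
          rw [Finset.mul_sum]
          exact Finset.sum_congr rfl fun b _ => by ring
  rw [mul_add, add_assoc]
  refine add_le_add hF ?_
  by_cases hex : ∃ i, u i = true
  swap
  · -- no other tuple passes, and success would need an exceptionally large noise
    have hs0 : s = 0 := by
      rw [hs, countTrue, Finset.card_eq_zero, Finset.filter_eq_empty_iff]
      exact fun i _ hi => hex ⟨i, hi⟩
    have hle : ∑ b, ρ b * (W (s + if b then 1 else 0) *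
        firstValue γ γ₀ (p.insertNth (α := fun _ => Bool) b u)) ≤ ω := by
      calc _ ≤ ∑ b, ρ b * ω := by
            refine Finset.sum_le_sum fun b _ => ?_
            gcongr
            calc _ ≤ W (s + if b then 1 else 0) * 1 := by
                  gcongr
                  exact firstValue_mem (P := (· ≤ 1)) hγ1 hγ₀1 _
              _ ≤ W 1 := by
                  rw [mul_one, hs0]
                  apply hWmono
                  split_ifs <;> omega
              _ ≤ ω := hω
        _ = ω := by rw [← Finset.sum_mul, hρ, one_mul]
    exact hle.trans (le_add_self.trans le_add_self)
  -- the first passing tuple is at `p.succAbove o` if the tuple at `p` does not pass, else at `q`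
  obtain ⟨o, ho, q, hq, hval⟩ := exists_firstValue_insertNth ℝ≥0∞ p hex
  obtain ⟨hv0, hv1⟩ := hval γ γ₀
  obtain ⟨hv0', hv1'⟩ := hval γ' γ₀'
  have hgo := hu o ho
  set Y : ℝ≥0∞ := ∑ b, ρ' b * (W (s + if b then 1 else 0) *
        firstValue γ' γ₀' (p.insertNth (α := fun _ => Bool) b u)) with hY
  have hstep : ∀ (b : Bool) (x y : ℝ≥0∞), x ≤ R * y + η →
      W (s + 1) * x ≤ E₁ * R * (W (s + if b then 1 else 0) * y) + η := by
    intro b x y hxy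
    calc W (s + 1) * x ≤ W (s + 1) * (R * y + η) := by gcongr
      _ = R * (W (s + 1) * y) + W (s + 1) * η := by ring
      _ ≤ R * ((E₁ * W (s + if b then 1 else 0)) * y) + 1 * η := by
          gcongr
          · exact (hWE s).trans (by gcongr; exact hWmono (Nat.le_add_right _ _))
          · exact hW1 _
      _ = _ := by ring
  -- `x` is the conditional probability for a good center of the first database
  have hgood : ∀ x, x ≤ 1 → x ≤ R * γ' (p.succAbove o) + η →
      (q = p.succAbove o ∨ goodp' → x ≤ R * γ' q + η) →
      W (s + 1) * x ≤ E₁ * R * Y + (κ + η) := by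
    intro x hx1 hxo hxq
    have hx : W (s + 1) * x ≤ 1 := mul_le_one' (hW1 _) hx1
    have hfalse := hstep false x _ hxo
    by_cases hc : q = p.succAbove o ∨ goodp'
    · have htrue := hstep true x _ (hxq hc)
      calc W (s + 1) * x = ∑ b, ρ' b * (W (s + 1) * x) := by rw [← Finset.sum_mul, hρ', one_mul]
        _ ≤ ∑ b, ρ' b * (E₁ * R * (W (s + if b then 1 else 0) *
              firstValue γ' γ₀' (p.insertNth (α := fun _ => Bool) b u)) + η) := by
            refine Finset.sum_le_sum fun b _ => ?_
            gcongr
            cases b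
            · rw [hv0']; exact hfalse
            · rw [hv1']; exact htrue
        _ = E₁ * R * Y + η := by
            simp only [mul_add, Finset.sum_add_distrib, ← Finset.sum_mul, hρ', one_mul]
            rw [hY, Finset.mul_sum]
            congr 1
            exact Finset.sum_congr rfl fun b _ => by ring
        _ ≤ _ := by gcongr; exact le_add_self
    · push Not at hc
      have hκ1 := hκ' hc.2
      calc W (s + 1) * x = ∑ b, ρ' b * (W (s + 1) * x) := by rw [← Finset.sum_mul, hρ', one_mul]
        _ = ρ' true * (W (s + 1) * x) + ρ' false * (W (s + 1) * x) := Fintype.sum_bool _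
        _ ≤ κ * 1 + ρ' false * (E₁ * R * (W (s + if false then 1 else 0) *
              γ' (p.succAbove o)) + η) := by
            gcongr
        _ = κ + E₁ * R * (ρ' false * (W (s + if false then 1 else 0) *
              γ' (p.succAbove o))) + ρ' false * η := by ring
        _ ≤ κ + E₁ * R * Y + 1 * η := by
            gcongr
            · rw [hY, Fintype.sum_bool, ← hv0']
              exact le_add_self
            · rw [← hρ', Fintype.sum_bool]
              exact le_add_self
        _ = _ := by ring
  have hfirst : W (s + 1) * γ (p.succAbove o) ≤ E₁ * R * Y + (κ + η) := by
    refine hgood _ (hγ1 _) (h₁ o) ?_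
    rintro (hqo | hg)
    · rw [hqo]; exact h₁ o
    · rcases hq with hqo | hqp
      · rw [hqo]; exact h₁ o
      · rw [hqp]; exact h₃ o hgo hg
  have hsecond : ρ true * (W (s + 1) * γ q) ≤ ρ true * (E₁ * R * Y + (κ + η)) + κ := by
    rcases hq with hqo | hqp
    · rw [hqo]
      refine le_trans ?_ le_self_add
      gcongr
    by_cases hg : goodp
    · refine le_trans ?_ le_self_add
      gcongr
      refine hgood _ (hγ1 _) ?_ ?_
      · rw [hqp]; exact h₂ o hgo hg
      · rintro (hqo | hg')
        · rw [hqo] at hqp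
          exact absurd hqp (Fin.succAbove_ne p o)
        · rw [hqp]; exact h₄ hg hg'
    · refine le_trans ?_ le_add_self
      calc ρ true * (W (s + 1) * γ q) ≤ κ * 1 := by
            gcongr
            · exact hκ hg
            · exact mul_le_one' (hW1 _) (hγ1 _)
        _ = κ := mul_one κ
  calc ∑ b, ρ b * (W (s + if b then 1 else 0) *
        firstValue γ γ₀ (p.insertNth (α := fun _ => Bool) b u))
      = ρ true * (W (s + 1) * γ q) + ρ false * (W s * γ (p.succAbove o)) := by
        rw [Fintype.sum_bool, hv0, hv1]
        simp
    _ ≤ (ρ true * (E₁ * R * Y + (κ + η)) + κ) + ρ false * (E₁ * R * Y + (κ + η)) := by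
        gcongr
        exact le_trans (by gcongr; exact hWmono (Nat.le_succ s)) hfirst
    _ = (∑ b, ρ b) * (E₁ * R * Y + (κ + η)) + κ := by rw [Fintype.sum_bool]; ring
    _ = E₁ * R * Y + (2 * κ + η) := by rw [hρ]; ring
    _ ≤ _ := add_le_add le_rfl le_self_add

/-- Comparison of two samples that differ in one tuple, at position `p`: the other tuples, if they
are not good, pass with probability at most `τ`; the tuples at position `p`, if they are not good,
pass with probability at most `κ`. -/
theorem boolExpect_outcomeProb_le_of_differ {m : ℕ} (p : Fin (m + 1))
    {ρ ρ' : Fin (m + 1) → Bool → ℝ≥0∞}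
    (hρ : ∀ i, ∑ b, ρ i b = 1) (hρ' : ∀ i, ∑ b, ρ' i b = 1) {F W : ℕ → ℝ≥0∞}
    {φ γ₀ γ₀' : ℝ≥0∞} {γ γ' : Fin (m + 1) → ℝ≥0∞} {E E₁ R η κ ω τ : ℝ≥0∞}
    (hE : ∀ i b, ρ (p.succAbove i) b ≤ E * ρ' (p.succAbove i) b)
    (hFW : ∀ s, F s + W s = 1) (hWmono : Monotone W) (hWE : ∀ s, W (s + 1) ≤ E₁ * W s)
    (hFE : ∀ s, F s ≤ E₁ * F (s + 1)) (hFanti : Antitone F) (hω : W 1 ≤ ω)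
    (hR : 1 ≤ R) (hφ : φ ≤ 1) (hγ1 : ∀ i, γ i ≤ 1) (hγ₀1 : γ₀ ≤ 1)
    {good : Fin m → Prop} {goodp goodp' : Prop}
    (h₁ : ∀ i, γ (p.succAbove i) ≤ R * γ' (p.succAbove i) + η)
    (h₂ : ∀ i, good i → goodp → γ p ≤ R * γ' (p.succAbove i) + η)
    (h₃ : ∀ i, good i → goodp' → γ (p.succAbove i) ≤ R * γ' p + η)
    (h₄ : goodp → goodp' → γ p ≤ R * γ' p + η)
    (hκ : ¬ goodp → ρ p true ≤ κ) (hκ' : ¬ goodp' → ρ' p true ≤ κ)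
    (hτ : ∀ i, ¬ good i → ρ (p.succAbove i) true ≤ τ) :
    boolExpect ρ (outcomeProb F W φ γ γ₀) ≤
      E ^ m * (E₁ * R) * boolExpect ρ' (outcomeProb F W φ γ' γ₀') +
        (2 * κ + η + ω + m * τ) := by
  classical
  rw [boolExpect_insertNth p ρ, boolExpect_insertNth p ρ']
  set I : (Fin m → Bool) → ℝ≥0∞ := fun u =>
    ∑ b, ρ p b * outcomeProb F W φ γ γ₀ (p.insertNth b u)
  set I' : (Fin m → Bool) → ℝ≥0∞ := fun u =>
    ∑ b, ρ' p b * outcomeProb F W φ γ' γ₀' (p.insertNth b u)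
  set bad : (Fin m → Bool) → ℝ≥0∞ := fun u => if ∃ i, ¬ good i ∧ u i = true then 1 else 0
    with hbad
  have hI : ∀ u, I u ≤ (E₁ * R * I' u + (2 * κ + η + ω)) + bad u := by
    intro u
    by_cases hu : ∃ i, ¬ good i ∧ u i = true
    · have h1 : I u ≤ 1 := by
        calc I u ≤ ∑ b, ρ p b * 1 := by
              refine Finset.sum_le_sum fun b _ => ?_
              gcongr
              exact outcomeProb_le_one hFW hφ hγ1 hγ₀1 _
          _ = 1 := by simp only [mul_one]; exact hρ p
      refine h1.trans ?_
      rw [hbad]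
      simp only [if_pos hu]
      exact le_add_self
    · refine le_trans ?_ le_self_add
      push Not at hu
      exact outcomeProb_insertNth_le p (hρ p) (hρ' p) hFW hWmono hWE hFE hFanti hω hR hγ1 hγ₀1
        h₁ h₂ h₃ h₄ hκ hκ' u fun i hi => by
          by_contra hg
          exact (hu i hg) hi
  have hρs : ∀ i, ∑ b, ρ (p.succAbove i) b = 1 := fun i => hρ _
  calc boolExpect (fun i => ρ (p.succAbove i)) I
      ≤ boolExpect (fun i => ρ (p.succAbove i))
          (fun u => (E₁ * R * I' u + (2 * κ + η + ω)) + bad u) := boolExpect_mono _ hI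
    _ = E₁ * R * boolExpect (fun i => ρ (p.succAbove i)) I' + (2 * κ + η + ω) +
          boolExpect (fun i => ρ (p.succAbove i)) bad := by
        rw [boolExpect_add, boolExpect_add, boolExpect_const_mul, boolExpect_const hρs]
    _ ≤ E₁ * R * (E ^ m * boolExpect (fun i => ρ' (p.succAbove i)) I') + (2 * κ + η + ω) +
          m * τ := by
        gcongr
        · exact boolExpect_le_of_le hE _
        · refine le_trans (le_of_eq ?_) (boolExpect_exists_le hρs (fun i => ¬ good i) hτ)
          rw [hbad]
          congr!
    _ = _ := by ring

end PassingVectors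

/-! ### Sampling without replacement -/

section Sampling

variable {m n : ℕ}

open Classical in
/-- Exchanging `j` and `j'` is a bijection from the samples with `j` at position `p` and without
`j'` to those with `j'` at position `p` and without `j`. -/
theorem sum_embedding_swap (j j' : Fin n) (p : Fin m) (h : (Fin m ↪ Fin n) → ℝ≥0∞) :
    ∑ e : Fin m ↪ Fin n, (if e p = j ∧ ∀ i, e i ≠ j' then
        h (e.trans (Equiv.swap j j').toEmbedding) else 0) =
      ∑ e : Fin m ↪ Fin n, (if e p = j' ∧ ∀ i, e i ≠ j then h e else 0) := by
  have hinv : ∀ e : Fin m ↪ Fin n,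
      (e.trans (Equiv.swap j j').toEmbedding).trans (Equiv.swap j j').toEmbedding = e := by
    intro e; ext i; simp
  refine Finset.sum_nbij' (fun e => e.trans (Equiv.swap j j').toEmbedding)
    (fun e => e.trans (Equiv.swap j j').toEmbedding) (by simp) (by simp)
    (fun e _ => hinv e) (fun e _ => hinv e) ?_
  intro e _
  have hcond : (e p = j ∧ ∀ i, e i ≠ j') ↔
      ((e.trans (Equiv.swap j j').toEmbedding) p = j' ∧
        ∀ i, (e.trans (Equiv.swap j j').toEmbedding) i ≠ j) := by
    simp only [Function.Embedding.trans_apply, Equiv.coe_toEmbedding, ne_eq,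
      Equiv.swap_apply_eq_iff, Equiv.swap_apply_right, Equiv.swap_apply_left]
  simp only [hcond]

open Classical in
/-- Amplification by subsampling: the samples that contain `j` are compared with all the samples
in which `j` is replaced by an index `j'` that was not sampled. -/
theorem sum_embedding_le (j : Fin n) {f f' : (Fin m ↪ Fin n) → ℝ≥0∞} {C₀ C a₀ a : ℝ≥0∞}
    (hoff : ∀ e : Fin m ↪ Fin n, (∀ i, e i ≠ j) → f e ≤ C₀ * f' e + a₀)
    (hon : ∀ (e : Fin m ↪ Fin n) (p : Fin m), e p = j → ∀ j', (∀ i, e i ≠ j') →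
      f e ≤ C * f' (e.trans (Equiv.swap j j').toEmbedding) + a) :
    ((n - m : ℕ) : ℝ≥0∞) * ∑ e, f e ≤
      ((n - m : ℕ) * C₀ + m * C) * ∑ e, f' e +
        Fintype.card (Fin m ↪ Fin n) * ((n - m : ℕ) * a₀ + m * a) := by
  set g : (Fin m ↪ Fin n) → ℝ≥0∞ := fun e => C * f' e + a with hg
  have hcard : ∀ e : Fin m ↪ Fin n,
      (∑ j' : Fin n, if ∀ i, e i ≠ j' then (1 : ℝ≥0∞) else 0) = (n - m : ℕ) := by
    intro e
    rw [← Finset.sum_filter, Finset.sum_const, nsmul_eq_mul, mul_one]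
    congr 1
    have : (Finset.univ.filter fun j' : Fin n => ∀ i, e i ≠ j') = (Finset.univ.map e)ᶜ := by
      ext j'; simp
    rw [this, Finset.card_compl]
    simp
  have h1 : ((n - m : ℕ) : ℝ≥0∞) * ∑ e : Fin m ↪ Fin n, (if ∃ p, e p = j then f e else 0) ≤
      m * ∑ e, g e := by
    calc ((n - m : ℕ) : ℝ≥0∞) * ∑ e : Fin m ↪ Fin n, (if ∃ p, e p = j then f e else 0)
        = ∑ e : Fin m ↪ Fin n, ∑ j' : Fin n,
            (if (∃ p, e p = j) ∧ ∀ i, e i ≠ j' then f e else 0) := by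
          rw [Finset.mul_sum]
          refine Finset.sum_congr rfl fun e _ => ?_
          rw [← hcard e, Finset.sum_mul]
          refine Finset.sum_congr rfl fun j' _ => ?_
          by_cases h1 : ∃ p, e p = j <;> by_cases h2 : ∀ i, e i ≠ j' <;> simp [h1, h2]
      _ ≤ ∑ e : Fin m ↪ Fin n, ∑ j' : Fin n, ∑ p : Fin m,
            (if e p = j ∧ ∀ i, e i ≠ j' then
              g (e.trans (Equiv.swap j j').toEmbedding) else 0) := by
          refine Finset.sum_le_sum fun e _ => Finset.sum_le_sum fun j' _ => ?_
          split_ifs with h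
          · obtain ⟨⟨p, hp⟩, hj'⟩ := h
            refine le_trans ?_ (Finset.single_le_sum (fun _ _ => zero_le)
              (Finset.mem_univ p))
            rw [if_pos ⟨hp, hj'⟩]
            exact hon e p hp j' hj'
          · exact zero_le
      _ = ∑ p : Fin m, ∑ j' : Fin n, ∑ e : Fin m ↪ Fin n,
            (if e p = j ∧ ∀ i, e i ≠ j' then
              g (e.trans (Equiv.swap j j').toEmbedding) else 0) := by
          rw [Finset.sum_comm]
          refine Eq.trans (Finset.sum_congr rfl fun j' _ => Finset.sum_comm) Finset.sum_comm
      _ ≤ ∑ p : Fin m, ∑ j' : Fin n, ∑ e : Fin m ↪ Fin n, (if e p = j' then g e else 0) := by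
          refine Finset.sum_le_sum fun p _ => Finset.sum_le_sum fun j' _ => ?_
          rcases eq_or_ne j j' with rfl | -
          · refine Finset.sum_le_sum fun e _ => ?_
            rw [if_neg fun h => h.2 p h.1]
            exact zero_le
          · rw [sum_embedding_swap j j' p g]
            refine Finset.sum_le_sum fun e _ => ?_
            by_cases hep : e p = j' <;> simp only [hep, true_and, false_and, if_true, if_false,
              le_refl]
            split_ifs
            exacts [le_rfl, zero_le]
      _ = m * ∑ e, g e := by
          have : ∀ p : Fin m, ∑ j' : Fin n, ∑ e : Fin m ↪ Fin n, (if e p = j' then g e else 0) =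
              ∑ e, g e := by
            intro p
            rw [Finset.sum_comm]
            simp
          simp [this]
  have h2 : ∑ e : Fin m ↪ Fin n, (if ∃ p, e p = j then 0 else f e) ≤
      ∑ e : Fin m ↪ Fin n, (C₀ * f' e + a₀) := by
    refine Finset.sum_le_sum fun e _ => ?_
    split_ifs with h
    · exact zero_le
    · exact hoff e fun i hi => h ⟨i, hi⟩
  have h3 : ∑ e, f e = ∑ e : Fin m ↪ Fin n, (if ∃ p, e p = j then 0 else f e) +
      ∑ e : Fin m ↪ Fin n, (if ∃ p, e p = j then f e else 0) := by
    rw [← Finset.sum_add_distrib]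
    refine Finset.sum_congr rfl fun e _ => ?_
    split_ifs <;> simp
  have hsum : ∀ c b : ℝ≥0∞, ∑ e, (c * f' e + b) =
      c * ∑ e, f' e + Fintype.card (Fin m ↪ Fin n) * b := by
    intro c b
    rw [Finset.sum_add_distrib, Finset.mul_sum]
    simp
  rw [h3, mul_add]
  calc _ ≤ ((n - m : ℕ) : ℝ≥0∞) * (C₀ * ∑ e, f' e + Fintype.card (Fin m ↪ Fin n) * a₀) +
        m * (C * ∑ e, f' e + Fintype.card (Fin m ↪ Fin n) * a) := by
        rw [← hsum, ← hsum]
        gcongr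
    _ = _ := by ring

end Sampling


/-! ### The law of the private test -/

section TestLaw

/-- The law of the passing bit of a tuple `X` with `ℓ_X = N`, for the noise `Lap(b)` and the
threshold `t`. -/
noncomputable def passLaw (b t : ℝ) (N : ℕ) (v : Bool) : ℝ≥0∞ :=
  laplace b {z | decide ((N : ℝ) + z ≤ t) = v}

/-- The probability of failure if `s` tuples pass, for the noise `Lap(b)` and the threshold `t`. -/
noncomputable def failProb (b t : ℝ) (s : ℕ) : ℝ≥0∞ := laplace b {w | (s : ℝ) + w < t}

/-- The probability of success if `s` tuples pass, for the noise `Lap(b)` and the threshold `t`. -/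
noncomputable def winProb (b t : ℝ) (s : ℕ) : ℝ≥0∞ := laplace b {w | t ≤ (s : ℝ) + w}

theorem measurable_passBit (t : ℝ) (N : ℕ) :
    Measurable fun z : ℝ => decide ((N : ℝ) + z ≤ t) := by
  refine measurable_to_bool ?_
  have : (fun z : ℝ => decide ((N : ℝ) + z ≤ t)) ⁻¹' {true} = {z | (N : ℝ) + z ≤ t} := by
    ext z; simp
  rw [this]
  exact measurableSet_le (by fun_prop) measurable_const

theorem sum_passLaw {b : ℝ} (hb : 0 < b) (t : ℝ) (N : ℕ) : ∑ v, passLaw b t N v = 1 := by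
  have := isProbabilityMeasure_laplace hb
  have hm := measurable_passBit t N (measurableSet_singleton true)
  rw [Fintype.sum_bool, ← prob_add_prob_compl (μ := laplace b) hm]
  refine congrArg₂ (· + ·) rfl (congrArg (laplace b) ?_)
  ext z
  simp

/-- One more or one less row that is not partitioned changes the probabilities of passing by a
factor of at most `exp (1 / b)`. -/
theorem passLaw_le {b : ℝ} (hb : 0 < b) (t : ℝ) {N N' : ℕ} (h : N ≤ N' + 1) (h' : N' ≤ N + 1)
    (v : Bool) : passLaw b t N v ≤ ENNReal.ofReal (Real.exp (1 / b)) * passLaw b t N' v := by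
  have hm : MeasurableSet {z : ℝ | decide ((N' : ℝ) + z ≤ t) = v} :=
    measurable_passBit t N' (measurableSet_singleton v)
  have hs := laplace_preimage_shift_le hb ((N : ℝ) - N') hm
  have heq : {x : ℝ | x + ((N : ℝ) - N') ∈ {z : ℝ | decide ((N' : ℝ) + z ≤ t) = v}} =
      {z : ℝ | decide ((N : ℝ) + z ≤ t) = v} := by
    ext z
    simp only [Set.mem_ofPred_eq]
    rw [show (N' : ℝ) + (z + ((N : ℝ) - N')) = N + z by ring]
  rw [heq] at hs
  refine hs.trans ?_
  unfold passLaw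
  gcongr
  rw [abs_le]
  have h1 : (N : ℝ) ≤ N' + 1 := by exact_mod_cast h
  have h2 : (N' : ℝ) ≤ N + 1 := by exact_mod_cast h'
  constructor <;> linarith

theorem passLaw_true_le {b : ℝ} (hb : 0 < b) (t : ℝ) (N : ℕ) :
    passLaw b t N true ≤ ENNReal.ofReal (Real.exp (-(N - t) / b)) := by
  refine le_trans (le_of_eq ?_) (laplace_Iic_neg_le hb (N - t))
  unfold passLaw
  congr 1
  ext z
  simp only [decide_eq_true_eq, Set.mem_ofPred_eq, Set.mem_Iic]
  constructor <;> intro h <;> linarith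

theorem failProb_add_winProb {b : ℝ} (hb : 0 < b) (t : ℝ) (s : ℕ) :
    failProb b t s + winProb b t s = 1 := by
  have := isProbabilityMeasure_laplace hb
  have hm : MeasurableSet {w : ℝ | (s : ℝ) + w < t} :=
    measurableSet_lt (by fun_prop) measurable_const
  rw [← prob_add_prob_compl (μ := laplace b) hm]
  unfold failProb winProb
  congr 2
  ext w
  simp

theorem winProb_mono (b t : ℝ) : Monotone (winProb b t) := by
  intro s s' h
  refine measure_mono fun w hw => ?_
  have h : (s : ℝ) ≤ s' := by exact_mod_cast h
  simp only [Set.mem_ofPred_eq] at hw ⊢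
  linarith

theorem failProb_anti (b t : ℝ) : Antitone (failProb b t) := by
  intro s s' h
  refine measure_mono fun w hw => ?_
  have h : (s : ℝ) ≤ s' := by exact_mod_cast h
  simp only [Set.mem_ofPred_eq] at hw ⊢
  linarith

theorem winProb_succ_le {b : ℝ} (hb : 0 < b) (t : ℝ) (s : ℕ) :
    winProb b t (s + 1) ≤ ENNReal.ofReal (Real.exp (1 / b)) * winProb b t s := by
  have hm : MeasurableSet {w : ℝ | t ≤ (s : ℝ) + w} :=
    measurableSet_le measurable_const (by fun_prop)
  have hs := laplace_preimage_shift_le hb 1 hm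
  rw [abs_one] at hs
  refine le_trans (le_of_eq ?_) hs
  unfold winProb
  congr 1
  ext w
  simp only [Set.mem_ofPred_eq]
  push_cast
  constructor <;> intro h <;> linarith

theorem failProb_le_succ {b : ℝ} (hb : 0 < b) (t : ℝ) (s : ℕ) :
    failProb b t s ≤ ENNReal.ofReal (Real.exp (1 / b)) * failProb b t (s + 1) := by
  have hm : MeasurableSet {w : ℝ | ((s + 1 : ℕ) : ℝ) + w < t} :=
    measurableSet_lt (by fun_prop) measurable_const
  have hs := laplace_preimage_shift_le hb (-1) hm
  rw [abs_neg, abs_one] at hs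
  refine le_trans (le_of_eq ?_) hs
  unfold failProb
  congr 1
  ext w
  simp only [Set.mem_ofPred_eq]
  push_cast
  constructor <;> intro h <;> linarith

theorem winProb_one_le {b : ℝ} (hb : 0 < b) (t : ℝ) :
    winProb b t 1 ≤ ENNReal.ofReal (Real.exp (-(t - 1) / b)) := by
  refine le_trans (le_of_eq ?_) (laplace_Ici_le hb (t - 1))
  unfold winProb
  congr 1
  ext w
  simp only [Nat.cast_one, Set.mem_ofPred_eq, Set.mem_Ici]
  constructor <;> intro h <;> linarith

variable {d k m n : ℕ}

/-- The outcome of the test in terms of the vector of the passing bits and of the failure bit. -/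
noncomputable def outcomeOf (Δ : ℝ) (T₁ : Fin m → Sym (Pt d) k) (x : (Fin m → Bool) × Bool) :
    TestOutcome d k :=
  if x.2 then ⟨false, emptyBalls d k⟩
  else firstValue (fun i => ⟨true, ballsOf Δ (T₁ i)⟩) ⟨true, emptyBalls d k⟩ x.1

theorem testCloseTuplesRun_eq (T₁ : Fin m → Sym (Pt d) k) (T₂ : Fin n → Sym (Pt d) k)
    (ε₁ ε₂ β Δ : ℝ) (z : Fin m → ℝ) (w : ℝ) :
    testCloseTuplesRun T₁ T₂ ε₁ ε₂ β Δ z w =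
      let v : Fin m → Bool := fun i =>
        decide ((numBad Δ T₂ (T₁ i) : ℝ) + z i ≤ (m / ε₂) * Real.log (m / β))
      outcomeOf Δ T₁ (v, decide ((countTrue v : ℝ) + w < m - (1 / ε₁) * Real.log (1 / β))) := by
  classical
  have hcount : (Finset.univ.filter fun i => Passes m ε₂ β Δ T₂ (T₁ i) (z i)).card =
      countTrue fun i =>
        decide ((numBad Δ T₂ (T₁ i) : ℝ) + z i ≤ (m / ε₂) * Real.log (m / β)) := by
    simp only [countTrue, Passes, decide_eq_true_eq]
    congr!
  simp only [testCloseTuplesRun, outcomeOf]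
  have hcount' : ((Finset.univ.filter fun i => Passes m ε₂ β Δ T₂ (T₁ i) (z i)).card : ℝ) =
      countTrue fun i =>
        decide ((numBad Δ T₂ (T₁ i) : ℝ) + z i ≤ (m / ε₂) * Real.log (m / β)) := by
    exact_mod_cast hcount
  by_cases hfail : ((countTrue fun i =>
        decide ((numBad Δ T₂ (T₁ i) : ℝ) + z i ≤ (m / ε₂) * Real.log (m / β)) : ℕ) : ℝ) + w <
        m - (1 / ε₁) * Real.log (1 / β)
  · rw [if_pos (by convert hfail), if_pos (by simpa using hfail)]
  · rw [if_neg (by convert hfail), if_neg (by simpa using hfail)]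
    unfold firstValue
    by_cases hex : ∃ i, Passes m ε₂ β Δ T₂ (T₁ i) (z i)
    · have hex' : ∃ i, decide ((numBad Δ T₂ (T₁ i) : ℝ) + z i ≤ (m / ε₂) * Real.log (m / β))
          = true := by simpa [Passes] using hex
      rw [dif_pos hex, dif_pos hex']
      congr 3
      rw [Fin.find_eq_iff]
      refine ⟨by simpa [Passes] using Fin.find_spec hex', fun j hj => ?_⟩
      simpa [Passes] using Fin.find_min hex' hj
    · rw [dif_neg hex, dif_neg (by simpa [Passes] using hex)]

/-- Expectations over the outcome of the test, in terms of the independent passing bits. -/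
theorem lintegral_privateTestCloseTuples (T₁ : Fin m → Sym (Pt d) k) (T₂ : Fin n → Sym (Pt d) k)
    {ε₁ ε₂ : ℝ} (hε₁ : 0 < ε₁) (hε₂ : 0 < ε₂) (β Δ : ℝ) (f : TestOutcome d k → ℝ≥0∞) :
    ∫⁻ o, f o ∂privateTestCloseTuples T₁ T₂ ε₁ ε₂ β Δ =
      boolExpect (fun i => passLaw (m / ε₂) ((m / ε₂) * Real.log (m / β)) (numBad Δ T₂ (T₁ i)))
        (outcomeProb (failProb (1 / ε₁) (m - (1 / ε₁) * Real.log (1 / β)))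
          (winProb (1 / ε₁) (m - (1 / ε₁) * Real.log (1 / β)))
          (f ⟨false, emptyBalls d k⟩) (fun i => f ⟨true, ballsOf Δ (T₁ i)⟩)
          (f ⟨true, emptyBalls d k⟩)) := by
  have hb₁ : 0 < 1 / ε₁ := by positivity
  have hP₁ := isProbabilityMeasure_laplace hb₁
  set t₁ := m - (1 / ε₁) * Real.log (1 / β)
  set t := (m / ε₂) * Real.log (m / β)
  set bit : Fin m → ℝ → Bool := fun i z => decide ((numBad Δ T₂ (T₁ i) : ℝ) + z ≤ t) with hbit
  have hbitm : ∀ i, Measurable (bit i) := fun i => measurable_passBit _ _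
  have hvm : Measurable fun z : Fin m → ℝ => fun i => bit i (z i) :=
    measurable_pi_lambda _ fun i => (hbitm i).comp (measurable_pi_apply i)
  have hfailm : Measurable fun ω : (Fin m → ℝ) × ℝ =>
      decide ((countTrue (fun i => bit i (ω.1 i)) : ℝ) + ω.2 < t₁) := by
    refine measurable_to_bool ?_
    have : (fun ω : (Fin m → ℝ) × ℝ =>
        decide ((countTrue (fun i => bit i (ω.1 i)) : ℝ) + ω.2 < t₁)) ⁻¹' {true} =
        {ω | (countTrue (fun i => bit i (ω.1 i)) : ℝ) + ω.2 < t₁} := by ext; simp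
    rw [this]
    refine measurableSet_lt (Measurable.add ?_ measurable_snd) measurable_const
    exact (Measurable.of_discrete (f := fun v : Fin m → Bool => (countTrue v : ℝ))).comp
      (hvm.comp measurable_fst)
  have hrun : (fun ω : (Fin m → ℝ) × ℝ => testCloseTuplesRun T₁ T₂ ε₁ ε₂ β Δ ω.1 ω.2) =
      outcomeOf Δ T₁ ∘ fun ω : (Fin m → ℝ) × ℝ => (fun i => bit i (ω.1 i),
        decide ((countTrue (fun i => bit i (ω.1 i)) : ℝ) + ω.2 < t₁)) := by
    funext ω
    exact testCloseTuplesRun_eq T₁ T₂ ε₁ ε₂ β Δ ω.1 ω.2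
  have hrunm : Measurable fun ω : (Fin m → ℝ) × ℝ =>
      testCloseTuplesRun T₁ T₂ ε₁ ε₂ β Δ ω.1 ω.2 := by
    rw [hrun]
    exact (Measurable.of_discrete).comp ((hvm.comp measurable_fst).prodMk hfailm)
  have hfm : Measurable f := fun s _ => trivial
  have hPi : ∀ _ : Fin m, IsProbabilityMeasure (laplace (m / ε₂)) := fun i => by
    have : 0 < (m : ℝ) := by exact_mod_cast i.pos
    exact isProbabilityMeasure_laplace (by positivity)
  rw [privateTestCloseTuples, lintegral_map hfm hrunm,
    lintegral_prod (fun ω => f (testCloseTuplesRun T₁ T₂ ε₁ ε₂ β Δ ω.1 ω.2))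
      (hfm.comp hrunm).aemeasurable]
  set H := outcomeProb (failProb (1 / ε₁) t₁) (winProb (1 / ε₁) t₁)
          (f ⟨false, emptyBalls d k⟩) (fun i => f ⟨true, ballsOf Δ (T₁ i)⟩)
          (f ⟨true, emptyBalls d k⟩) with hH
  have hinner : ∀ z : Fin m → ℝ, ∫⁻ w, f (testCloseTuplesRun T₁ T₂ ε₁ ε₂ β Δ z w)
      ∂laplace (1 / ε₁) = H fun i => bit i (z i) := by
    intro z
    set v : Fin m → Bool := fun i => bit i (z i)
    have hms : MeasurableSet {w : ℝ | (countTrue v : ℝ) + w < t₁} :=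
      measurableSet_lt (by fun_prop) measurable_const
    have hfv : f (firstValue (fun i => ⟨true, ballsOf Δ (T₁ i)⟩) ⟨true, emptyBalls d k⟩ v) =
        firstValue (fun i => f ⟨true, ballsOf Δ (T₁ i)⟩) (f ⟨true, emptyBalls d k⟩) v := by
      unfold firstValue
      split_ifs <;> rfl
    rw [← lintegral_add_compl _ hms, hH, outcomeProb]
    congr 1
    · rw [setLIntegral_congr_fun (g := fun _ => f ⟨false, emptyBalls d k⟩) hms]
      · rw [setLIntegral_const, mul_comm]
        rfl
      · intro w hw
        have hw : (countTrue v : ℝ) + w < t₁ := hw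
        simp only
        rw [testCloseTuplesRun_eq]
        simp only [outcomeOf]
        rw [if_pos (decide_eq_true hw)]
    · rw [setLIntegral_congr_fun (g := fun _ => firstValue (fun i => f ⟨true, ballsOf Δ (T₁ i)⟩)
        (f ⟨true, emptyBalls d k⟩) v) hms.compl]
      · rw [setLIntegral_const, mul_comm]
        congr 2
        ext w
        simp
      · intro w hw
        have hw : ¬ (countTrue v : ℝ) + w < t₁ := hw
        simp only
        rw [testCloseTuplesRun_eq]
        simp only [outcomeOf]
        rw [if_neg (fun h => hw (of_decide_eq_true h))]
        exact hfv
  simp only [hinner]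
  have hprob : ∀ i, IsProbabilityMeasure ((laplace (m / ε₂)).map (bit i)) := fun i =>
    have := hPi i
    Measure.isProbabilityMeasure_map (hbitm i).aemeasurable
  rw [← lintegral_map (f := H) (g := fun z : Fin m → ℝ => fun i => bit i (z i))
    Measurable.of_discrete hvm, Measure.pi_map_pi fun i => (hbitm i).aemeasurable,
    lintegral_fintype, boolExpect]
  refine Finset.sum_congr rfl fun v _ => ?_
  rw [mul_comm, Measure.pi_singleton]
  congr 1
  refine Finset.prod_congr rfl fun i _ => ?_
  rw [Measure.map_apply (hbitm i) (measurableSet_singleton _)]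
  rfl

theorem measurable_some_tuple : Measurable (some : Sym (Pt d) k → Option (Sym (Pt d) k)) :=
  fun _ hs => hs

/-- The probability of the event `S` after the test, for the sample `e`. -/
noncomputable def sampleProb (A : Multiset (Pt d) → Measure (Pt d)) (T : Fin n → Sym (Pt d) k)
    (ε₁ ε₂ β : ℝ) (S : Set (Option (Sym (Pt d) k))) (e : Fin m ↪ Fin n) : ℝ≥0∞ :=
  boolExpect (fun i => passLaw (m / ε₂) ((m / ε₂) * Real.log (m / β)) (numBad 7 T (T (e i))))
    (outcomeProb (failProb (1 / ε₁) (m - (1 / ε₁) * Real.log (1 / β)))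
      (winProb (1 / ε₁) (m - (1 / ε₁) * Real.log (1 / β)))
      (Measure.dirac (none : Option (Sym (Pt d) k)) S)
      (fun i => averagesLaw A T (enum (T (e i))) (some ⁻¹' S))
      (averagesLaw A T 0 (some ⁻¹' S)))

/-- The output law is an average over the samples of the probabilities `sampleProb`. -/
theorem privatekAverages_apply (avg : Averager d) (Λ rmin ε δ β : ℝ) (T : Fin n → Sym (Pt d) k)
    {m : ℕ} (hm : sampleSize n (ε / 2) (δ / 4) (β / 2) = m) (hε : 0 < ε)
    (hε₁ : 0 < epsOne n (ε / 2) m) {S : Set (Option (Sym (Pt d) k))} (hS : MeasurableSet S) :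
    privatekAverages avg Λ rmin ε δ β T S =
      (Fintype.card (Fin m ↪ Fin n) : ℝ≥0∞)⁻¹ * ∑ e : Fin m ↪ Fin n,
        sampleProb (avg Λ rmin (β / (2 * k))
          (ε / (4 * k * (ell n (ε / 2) (δ / 4) (β / 2) + 1)))
          (δ / (8 * k * Real.exp (ε / 2) * (ell n (ε / 2) (δ / 4) (β / 2) + 1))))
          T (epsOne n (ε / 2) m) (ε / 2 / 2) (β / 2) S e := by
  subst hm
  unfold privatekAverages
  simp only
  rw [Measure.bind_apply hS (Measurable.aemeasurable fun _ _ =>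
    MeasurableSpace.measurableSet_top), privateTestPartition]
  rw [lintegral_smul_measure, lintegral_finsetSum_measure, smul_eq_mul]
  congr 1
  refine Finset.sum_congr rfl fun e _ => ?_
  rw [lintegral_privateTestCloseTuples _ _ hε₁ (by positivity)]
  have hval : ∀ B : Fin k → Ball d, ∀ A : Multiset (Pt d) → Measure (Pt d),
      ((Measure.pi fun i : Fin k => A (cluster T (fun j => (B j).center) i)).map
          fun a => some (toTuple a)) S =
        averagesLaw A T (fun j => (B j).center) (some ⁻¹' S) := by
    intro B A
    rw [averagesLaw, ← Measure.map_apply measurable_some_tuple hS,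
      Measure.map_map measurable_some_tuple measurable_toTuple]
    rfl
  simp only [if_true, Bool.false_eq_true, if_false, hval]
  rfl

end TestLaw


/-! ### Privacy for a fixed sample -/

section FixedSample

variable {d k m n : ℕ} {A : Multiset (Pt d) → Measure (Pt d)} {T T' : Fin n → Sym (Pt d) k}
  {j : Fin n} {ε₁ ε₂ β : ℝ} {S : Set (Option (Sym (Pt d) k))}

theorem numBad_le_of_neighbor (hj : ∀ i, i ≠ j → T i = T' i) (X : Sym (Pt d) k) :
    numBad 7 T X ≤ numBad 7 T' X + 1 :=
  (numBad_le_numBadOff_add_one T j X).trans (by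
    rw [numBadOff_congr hj]
    exact Nat.add_le_add_right (numBadOff_le_numBad T' j X) 1)

theorem passLaw_numBad_le (hj : ∀ i, i ≠ j → T i = T' i) (X : Sym (Pt d) k) {b : ℝ} (hb : 0 < b)
    (t : ℝ) (v : Bool) : passLaw b t (numBad 7 T X) v ≤
      ENNReal.ofReal (Real.exp (1 / b)) * passLaw b t (numBad 7 T' X) v :=
  passLaw_le hb t (numBad_le_of_neighbor hj X)
    (numBad_le_of_neighbor (fun i hi => (hj i hi).symm) X) v

/-- A sample that does not contain the changed row is compared with itself: the `m` noises of scale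
`m / ε₂` hide the changes of the counts at a total cost of `ε₂`, and the centers are the same. -/
theorem sampleProb_le_of_notMem (hm : 0 < m) (hj : ∀ i, i ≠ j → T i = T' i) (hε₁ : 0 < ε₁)
    (hε₂ : 0 < ε₂) {e : Fin m ↪ Fin n} (he : ∀ i, e i ≠ j) {R η : ℝ≥0∞} (hR : 1 ≤ R)
    (hsame : ∀ c : Fin k → Pt d,
      averagesLaw A T c (some ⁻¹' S) ≤ R * averagesLaw A T' c (some ⁻¹' S) + η) :
    sampleProb A T ε₁ ε₂ β S e ≤
      ENNReal.ofReal (Real.exp ε₂) * R * sampleProb A T' ε₁ ε₂ β S e + η := by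
  have hm' : (0 : ℝ) < m := by exact_mod_cast hm
  have hb : 0 < m / ε₂ := by positivity
  have hE : ENNReal.ofReal (Real.exp (1 / (m / ε₂))) ^ m = ENNReal.ofReal (Real.exp ε₂) := by
    rw [← ENNReal.ofReal_pow (Real.exp_pos _).le, ← Real.exp_nat_mul]
    congr 2
    field_simp
  rw [← hE]
  refine boolExpect_outcomeProb_le (fun i => sum_passLaw hb _ _) ?_
    (failProb_add_winProb (by positivity) _) hR ?_ (hsame 0)
  · intro i v
    rw [← hj _ (he i)]
    exact passLaw_numBad_le hj _ hb _ v
  · intro i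
    rw [← hj _ (he i)]
    exact hsame _

/-- A sample that contains the changed row `j` at position `p`, compared with the sample in which
it is replaced by a row `j'` that was not sampled. The tuples at position `p`, if they are good, leave
at most `l` rows that are not partitioned, and the other good tuples at most `3 l / 2`, so that the
sum for two centers to be compared is at most `5 l / 2`. -/
theorem sampleProb_le_of_mem (hj : ∀ i, i ≠ j → T i = T' i) (hε₁ : 0 < ε₁) (hε₂ : 0 < ε₂)
    {e : Fin (m + 1) ↪ Fin n} {p : Fin (m + 1)} (hep : e p = j) {j' : Fin n}
    (hej' : ∀ i, e i ≠ j') {R η κ τ ω : ℝ≥0∞} (hR : 1 ≤ R) {l : ℝ}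
    (hT1 : ∀ c : Fin k → Pt d, averagesLaw A T c (some ⁻¹' S) ≤ 1)
    (hsame : ∀ c : Fin k → Pt d,
      averagesLaw A T c (some ⁻¹' S) ≤ R * averagesLaw A T' c (some ⁻¹' S) + η)
    (hgood : ∀ X X' : Sym (Pt d) k, (numBadOff T j X + numBadOff T j X' : ℝ) ≤ 5 / 2 * l →
      averagesLaw A T (enum X) (some ⁻¹' S) ≤ R * averagesLaw A T' (enum X') (some ⁻¹' S) + η)
    (hl : 0 ≤ l)
    (hκ : ∀ N : ℕ, l < N → passLaw ((m + 1 : ℕ) / ε₂)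
      (((m + 1 : ℕ) / ε₂) * Real.log ((m + 1 : ℕ) / β)) N true ≤ κ)
    (hτ : ∀ N : ℕ, 3 / 2 * l < N → passLaw ((m + 1 : ℕ) / ε₂)
      (((m + 1 : ℕ) / ε₂) * Real.log ((m + 1 : ℕ) / β)) N true ≤ τ)
    (hω : winProb (1 / ε₁) ((m + 1 : ℕ) - (1 / ε₁) * Real.log (1 / β)) 1 ≤ ω) :
    sampleProb A T ε₁ ε₂ β S e ≤
      ENNReal.ofReal (Real.exp ε₂) * (ENNReal.ofReal (Real.exp ε₁) * R) *
        sampleProb A T' ε₁ ε₂ β S (e.trans (Equiv.swap j j').toEmbedding) +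
      (2 * κ + η + ω + (m + 1 : ℕ) * τ) := by
  have hb : 0 < ((m + 1 : ℕ) : ℝ) / ε₂ := by positivity
  have hb₁ : 0 < 1 / ε₁ := by positivity
  have hE : ENNReal.ofReal (Real.exp (1 / ((m + 1 : ℕ) / ε₂))) ^ m ≤
      ENNReal.ofReal (Real.exp ε₂) := by
    rw [← ENNReal.ofReal_pow (Real.exp_pos _).le, ← Real.exp_nat_mul]
    gcongr
    push_cast
    rw [one_div_div, mul_div_assoc', div_le_iff₀ (by positivity)]
    nlinarith
  have hne : ∀ i, e (p.succAbove i) ≠ j := by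
    intro i h
    rw [← hep] at h
    exact Fin.succAbove_ne p i (e.injective h)
  set e' := e.trans (Equiv.swap j j').toEmbedding with he'
  have he'i : ∀ i, e' (p.succAbove i) = e (p.succAbove i) := fun i => by
    rw [he', Function.Embedding.trans_apply, Equiv.coe_toEmbedding,
      Equiv.swap_apply_of_ne_of_ne (hne i) (hej' _)]
  have hrow : ∀ i, T' (e' (p.succAbove i)) = T (e (p.succAbove i)) := fun i => by
    rw [he'i, hj _ (hne i)]
  have hε : 1 / (1 / ε₁) = ε₁ := by simp
  have hle : ∀ {X : Sym (Pt d) k} {y : ℝ}, ¬ (numBadOff T j X : ℝ) ≤ y →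
      y < numBad 7 T X ∧ y < numBad 7 T' X := by
    intro X y h
    have h1 : (numBadOff T j X : ℝ) ≤ numBad 7 T X := by exact_mod_cast numBadOff_le_numBad T j X
    have h2 : (numBadOff T j X : ℝ) ≤ numBad 7 T' X := by
      rw [numBadOff_congr hj]; exact_mod_cast numBadOff_le_numBad T' j X
    constructor <;> linarith
  have hmain := boolExpect_outcomeProb_le_of_differ (m := m) p
    (ρ := fun i => passLaw ((m + 1 : ℕ) / ε₂) (((m + 1 : ℕ) / ε₂) * Real.log ((m + 1 : ℕ) / β))
      (numBad 7 T (T (e i))))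
    (ρ' := fun i => passLaw ((m + 1 : ℕ) / ε₂) (((m + 1 : ℕ) / ε₂) * Real.log ((m + 1 : ℕ) / β))
      (numBad 7 T' (T' (e' i))))
    (F := failProb (1 / ε₁) ((m + 1 : ℕ) - (1 / ε₁) * Real.log (1 / β)))
    (W := winProb (1 / ε₁) ((m + 1 : ℕ) - (1 / ε₁) * Real.log (1 / β)))
    (φ := (Measure.dirac (none : Option (Sym (Pt d) k)) S))
    (γ := fun i => averagesLaw A T (enum (T (e i))) (some ⁻¹' S))
    (γ' := fun i => averagesLaw A T' (enum (T' (e' i))) (some ⁻¹' S))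
    (γ₀ := averagesLaw A T 0 (some ⁻¹' S)) (γ₀' := averagesLaw A T' 0 (some ⁻¹' S))
    (E := ENNReal.ofReal (Real.exp (1 / ((m + 1 : ℕ) / ε₂))))
    (E₁ := ENNReal.ofReal (Real.exp (1 / (1 / ε₁)))) (R := R) (η := η) (κ := κ) (ω := ω) (τ := τ)
    (good := fun i => (numBadOff T j (T (e (p.succAbove i))) : ℝ) ≤ 3 / 2 * l)
    (goodp := (numBadOff T j (T (e p)) : ℝ) ≤ l)
    (goodp' := (numBadOff T j (T' (e' p)) : ℝ) ≤ l)
    (fun i => sum_passLaw hb _ _) (fun i => sum_passLaw hb _ _)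
    (fun i v => by rw [hrow]; exact passLaw_numBad_le hj _ hb _ v)
    (failProb_add_winProb hb₁ _) (winProb_mono _ _) (winProb_succ_le hb₁ _)
    (failProb_le_succ hb₁ _) (failProb_anti _ _) hω hR prob_le_one (fun i => hT1 _) (hT1 _)
    (fun i => by rw [hrow]; exact hsame _)
    (fun i h1 h2 => by rw [hrow]; exact hgood _ _ (by linarith))
    (fun i h1 h2 => hgood _ _ (by linarith))
    (fun h1 h2 => hgood _ _ (by linarith))
    (fun h => hκ _ (hle h).1) (fun h => hκ _ (hle h).2) (fun i h => hτ _ (hle h).1)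
  rw [hε] at hmain
  refine hmain.trans ?_
  gcongr
  · exact le_rfl
  · exact Nat.le_succ m

end FixedSample

/-! ### The parameters -/

/-- A convex function lies below its chord on `[0, 1]`. -/
theorem exp_mul_le_chord {x : ℝ} (hx : 0 ≤ x) (hx1 : x ≤ 1) (c : ℝ) :
    Real.exp (c * x) ≤ 1 + x * (Real.exp c - 1) := by
  have h := convexOn_exp.2 (Set.mem_univ 0) (Set.mem_univ c) (sub_nonneg.2 hx1) hx (by ring)
  simp only [smul_eq_mul, mul_zero, zero_add, Real.exp_zero, mul_one] at h
  rw [mul_comm c x]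
  linarith

/-- The inequality behind `budget_mul`. On the left-hand side the exponentials are replaced by their
chords on `[0, 1]`, and on the right-hand side by a quadratic polynomial. -/
theorem exp_budget {ε : ℝ} (hε : 0 ≤ ε) (hε' : ε ≤ 1) :
    Real.exp (ε / 4) * (Real.exp (ε / 18) + ε / 4 * Real.exp (5 / 4 * ε)) ≤ Real.exp ε := by
  have h1 : Real.exp (5 / 4) ≤ 7 / 2 := by
    have h : Real.exp (5 / 4) ^ 4 ≤ (7 / 2) ^ 4 := by
      rw [← Real.exp_nat_mul, show ((4 : ℕ) : ℝ) * (5 / 4) = (5 : ℕ) * 1 by norm_num,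
        Real.exp_nat_mul]
      calc Real.exp 1 ^ 5 ≤ 2.7182818286 ^ 5 := by
            gcongr; exact Real.exp_one_lt_d9.le
        _ ≤ _ := by norm_num
    exact le_of_pow_le_pow_left₀ (by norm_num) (by norm_num) h
  have h2 : Real.exp (1 / 18) ≤ 1.06 := by
    have := Real.exp_bound_div_one_sub_of_interval (x := 1 / 18) (by norm_num) (by norm_num)
    refine this.trans (by norm_num)
  have h3 := exp_mul_le_chord hε hε' (5 / 4)
  have h4 := exp_mul_le_chord hε hε' (1 / 18)
  have h5 : 1 + 3 / 4 * ε + (3 / 4 * ε) ^ 2 / 2 ≤ Real.exp (3 / 4 * ε) :=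
    Real.quadratic_le_exp_of_nonneg (by positivity)
  have h6 : Real.exp ε = Real.exp (ε / 4) * Real.exp (3 / 4 * ε) := by
    rw [← Real.exp_add]; congr 1; ring
  rw [h6]
  gcongr
  have h7 : Real.exp (ε / 18) ≤ 1 + 0.06 * ε := by
    rw [show ε / 18 = 1 / 18 * ε by ring]
    nlinarith
  have h8 : Real.exp (5 / 4 * ε) ≤ 1 + 5 / 2 * ε := by nlinarith
  nlinarith [mul_le_mul_of_nonneg_left h8 (by positivity : 0 ≤ ε / 4)]


section Parameters

variable {n m : ℕ} {ε δ β : ℝ}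

theorem epsOne_pos (hm : m ∈ AdmissibleSizes n ε δ β) : 0 < epsOne n ε m :=
  Real.log_pos hm.2.1

theorem exp_epsOne (hm : m ∈ AdmissibleSizes n ε δ β) :
    Real.exp (epsOne n ε m) = ε * n / (2 * m) - 3 :=
  Real.exp_log (one_pos.trans hm.2.1)

/-- The smallest admissible size is at most logarithmic in `1 / (δ β)`: half of it is not
admissible, and at this size `ε₁` would be larger than `1`. -/
theorem sampleSize_mul_le (hδ : 0 < δ) (hδ1 : δ ≤ 1 / 4) (hβ : 0 < β)
    (hβ1 : β ≤ 1 / 2) (hne : (AdmissibleSizes n ε δ β).Nonempty) :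
    (sampleSize n ε δ β : ℝ) * (β * δ) ≤ 9 / 4 := by
  set m := sampleSize n ε δ β with hm
  have hmem : m ∈ AdmissibleSizes n ε δ β := Nat.sInf_mem hne
  have hm0 : 0 < m := hmem.1
  have hx8 : β * δ ≤ 1 / 8 := by nlinarith
  have hx0 : 0 < β * δ := by positivity
  rcases Nat.lt_or_ge m 2 with h2 | h2
  · have : m = 1 := by omega
    rw [this]
    norm_num
    linarith
  set m' := (m + 1) / 2 with hm'
  have hlt : m' < m := by omega
  have hm'0 : 0 < m' := by omega
  have hnot : m' ∉ AdmissibleSizes n ε δ β := Nat.notMem_of_lt_sInf hlt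
  have hmR : (0 : ℝ) < m := by exact_mod_cast hm0
  have hm'R : (0 : ℝ) < m' := by exact_mod_cast hm'0
  have h32 : (3 : ℝ) * m' ≤ 2 * m := by
    have : 3 * m' ≤ 2 * m := by omega
    exact_mod_cast this
  have hmm : (m : ℝ) ≤ 2 * m' := by
    have : m ≤ 2 * m' := by omega
    exact_mod_cast this
  have hbig : 6 < ε * n / (2 * m') := by
    have h1 : 4 < ε * n / (2 * m) := by linarith [hmem.2.1]
    rw [lt_div_iff₀ (by positivity)] at h1 ⊢
    linarith
  have he1 : 1 ≤ epsOne n ε m' := by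
    unfold epsOne
    rw [Real.le_log_iff_exp_le (by linarith)]
    linarith [Real.exp_one_lt_d9]
  have hK : (m' : ℝ) ≤ 2 * Real.log (1 / δ) + Real.log (1 / β) := by
    have h1 : (m' : ℝ) ≤ (1 / epsOne n ε m') * (2 * Real.log (1 / δ) + Real.log (1 / β)) := by
      by_contra h
      exact hnot ⟨hm'0, by linarith, not_le.1 h⟩
    have h3 : 0 ≤ 2 * Real.log (1 / δ) + Real.log (1 / β) := by
      have := Real.log_nonneg (x := 1 / δ) (by rw [le_div_iff₀ hδ]; linarith)
      have := Real.log_nonneg (x := 1 / β) (by rw [le_div_iff₀ hβ]; linarith)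
      linarith
    refine h1.trans (mul_le_of_le_one_left h3 ?_)
    rw [div_le_one (by linarith)]
    exact he1
  have hL : (m : ℝ) ≤ 4 * Real.log (1 / (β * δ)) := by
    have h4 : Real.log (1 / (β * δ)) = Real.log (1 / δ) + Real.log (1 / β) := by
      rw [← Real.log_mul (by positivity) (by positivity)]
      congr 1
      field_simp
    have := Real.log_nonneg (x := 1 / β) (by rw [le_div_iff₀ hβ]; linarith)
    linarith
  have hlog : Real.log (1 / (β * δ)) * (β * δ) ≤ 9 / 16 := by
    have h5 := Real.log_le_sub_one_of_pos (x := 1 / (2 * (β * δ))) (by positivity)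
    have h6 : Real.log (1 / (β * δ)) = Real.log 2 + Real.log (1 / (2 * (β * δ))) := by
      rw [← Real.log_mul (by norm_num) (by positivity)]
      congr 1
      field_simp
    have h7 := Real.log_two_lt_d9
    have h8 : Real.log (1 / (β * δ)) ≤ 1 / (2 * (β * δ)) := by linarith
    calc Real.log (1 / (β * δ)) * (β * δ) ≤ 1 / (2 * (β * δ)) * (β * δ) := by gcongr
      _ = 1 / 2 := by field_simp
      _ ≤ _ := by norm_num
  calc (m : ℝ) * (β * δ) ≤ 4 * Real.log (1 / (β * δ)) * (β * δ) := by gcongr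
    _ ≤ 9 / 4 := by linarith

end Parameters

/-- The multiplicative budget: a sample that avoids the changed row costs `ε / 4` for the passing
bits and `2 k` changes of points; a sample that contains it, which happens at a rate of at most
`ε / (4 x)`, costs a factor `x` for the status, and the changes caused by different centers. -/
theorem budget_mul {ε k l m n x : ℝ} (hε : 0 < ε) (hε' : ε ≤ 1) (hk : 1 ≤ k) (hl : 8 ≤ l)
    (hm : 0 < m) (hx : 1 ≤ x) (hrate : 4 * m * x ≤ ε * (n - m)) :
    (n - m) * (Real.exp (ε / 2 / 2) * Real.exp (2 * k * (ε / (4 * k * (l + 1))))) +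
      m * (Real.exp (ε / 2 / 2) *
        (x * Real.exp (2 * k * (5 / 2 * l + 1) * (ε / (4 * k * (l + 1)))))) ≤
      (n - m) * Real.exp ε := by
  have hnm : 0 ≤ n - m := by
    have : 0 < 4 * m * x := by positivity
    by_contra h
    nlinarith
  have e1 : 2 * k * (ε / (4 * k * (l + 1))) ≤ ε / 18 := by
    rw [show 2 * k * (ε / (4 * k * (l + 1))) = ε / (2 * (l + 1)) by field_simp; ring]
    exact div_le_div_of_nonneg_left hε.le (by norm_num) (by linarith)
  have e2 : 2 * k * (5 / 2 * l + 1) * (ε / (4 * k * (l + 1))) ≤ 5 / 4 * ε := by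
    rw [show 2 * k * (5 / 2 * l + 1) * (ε / (4 * k * (l + 1))) =
      (5 / 2 * l + 1) * ε / (2 * (l + 1)) by field_simp; ring, div_le_iff₀ (by positivity)]
    nlinarith
  have h := exp_budget hε.le hε'
  calc (n - m) * (Real.exp (ε / 2 / 2) * Real.exp (2 * k * (ε / (4 * k * (l + 1))))) +
      m * (Real.exp (ε / 2 / 2) *
        (x * Real.exp (2 * k * (5 / 2 * l + 1) * (ε / (4 * k * (l + 1))))))
      ≤ (n - m) * (Real.exp (ε / 2 / 2) * Real.exp (ε / 18)) +
      m * (Real.exp (ε / 2 / 2) * (x * Real.exp (5 / 4 * ε))) := by gcongr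
    _ = Real.exp (ε / 2 / 2) * ((n - m) * Real.exp (ε / 18) + (m * x) * Real.exp (5 / 4 * ε)) := by
        ring
    _ ≤ Real.exp (ε / 2 / 2) * ((n - m) * Real.exp (ε / 18) +
          (ε / 4 * (n - m)) * Real.exp (5 / 4 * ε)) :=
        mul_le_mul_of_nonneg_left (add_le_add_right (mul_le_mul_of_nonneg_right
          (by linarith) (Real.exp_pos _).le) _) (Real.exp_pos _).le
    _ = (n - m) * (Real.exp (ε / 4) * (Real.exp (ε / 18) + ε / 4 * Real.exp (5 / 4 * ε))) := by
        rw [show ε / 2 / 2 = ε / 4 by ring]; ring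
    _ ≤ _ := by gcongr

/-- The additive budget: the errors of the averages are `δ / 36` and `15 δ / 8`; the changed rows and
the other tuples that pass by exceptional noise contribute `2 (δ / 4)` and `m τ`, and success with
a single passing tuple contributes `x (δ / 4) ^ 2`. All but the first of these errors come with the
rate `m / (n - m)`, which is at most `ε / (4 x)`. -/
theorem budget_add {ε δ k l m n x τ : ℝ} (hε : 0 < ε) (hε' : ε ≤ 1) (hδ : 0 < δ) (hδ' : δ ≤ 1)
    (hk : 1 ≤ k) (hl : 8 ≤ l) (hm : 0 < m) (hx : 1 ≤ x) (hrate : 4 * m * x ≤ ε * (n - m))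
    (hτ : m * τ ≤ 3 / 2 * (δ / 4)) :
    (n - m) * (2 * k * Real.exp (2 * k * (ε / (4 * k * (l + 1)))) *
        (δ / (8 * k * Real.exp (ε / 2) * (l + 1)))) +
      m * (2 * (δ / 4) + 2 * k * (5 / 2 * l + 1) *
        Real.exp (2 * k * (5 / 2 * l + 1) * (ε / (4 * k * (l + 1)))) *
        (δ / (8 * k * Real.exp (ε / 2) * (l + 1))) + x * (δ / 4) ^ 2 + m * τ) ≤ (n - m) * δ := by
  have hnm : 0 ≤ n - m := by
    have : 0 < 4 * m * x := by positivity
    by_contra h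
    nlinarith
  have hE := Real.exp_pos (ε / 2)
  have e1 : 2 * k * (ε / (4 * k * (l + 1))) ≤ ε / 2 := by
    rw [show 2 * k * (ε / (4 * k * (l + 1))) = ε / (2 * (l + 1)) by field_simp; ring]
    exact div_le_div_of_nonneg_left hε.le (by norm_num) (by linarith)
  have e2 : 2 * k * (5 / 2 * l + 1) * (ε / (4 * k * (l + 1))) ≤ 1 + ε / 2 := by
    rw [show 2 * k * (5 / 2 * l + 1) * (ε / (4 * k * (l + 1))) =
      (5 / 2 * l + 1) * ε / (2 * (l + 1)) by field_simp; ring, div_le_iff₀ (by positivity)]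
    nlinarith
  have a1 : 2 * k * Real.exp (2 * k * (ε / (4 * k * (l + 1)))) *
        (δ / (8 * k * Real.exp (ε / 2) * (l + 1))) ≤ 1 / 36 * δ := by
    calc _ ≤ 2 * k * Real.exp (ε / 2) * (δ / (8 * k * Real.exp (ε / 2) * (l + 1))) := by gcongr
      _ = δ / (4 * (l + 1)) := by field_simp; ring
      _ ≤ δ / 36 := div_le_div_of_nonneg_left hδ.le (by norm_num) (by linarith)
      _ = _ := by ring
  have a2 : 2 * k * (5 / 2 * l + 1) *
        Real.exp (2 * k * (5 / 2 * l + 1) * (ε / (4 * k * (l + 1)))) *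
        (δ / (8 * k * Real.exp (ε / 2) * (l + 1))) ≤ 15 / 8 * δ := by
    calc _ ≤ 2 * k * (5 / 2 * l + 1) * Real.exp (1 + ε / 2) *
          (δ / (8 * k * Real.exp (ε / 2) * (l + 1))) := by gcongr
      _ = (5 / 2 * l + 1) / (4 * (l + 1)) * Real.exp 1 * δ := by
          rw [Real.exp_add]; field_simp; ring
      _ ≤ 5 / 8 * 3 * δ := by
          have h1 : (5 / 2 * l + 1) / (4 * (l + 1)) ≤ 5 / 8 := by
            rw [div_le_iff₀ (by positivity)]; linarith
          have h2 : Real.exp 1 ≤ 3 := by linarith [Real.exp_one_lt_d9]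
          exact mul_le_mul_of_nonneg_right
            (mul_le_mul h1 h2 (Real.exp_pos _).le (by norm_num)) hδ.le
      _ = _ := by ring
  have hδ2 : (δ / 4) ^ 2 ≤ 1 / 16 * δ := by nlinarith
  calc _ ≤ (n - m) * (1 / 36 * δ) + m * (2 * (δ / 4) + 15 / 8 * δ + x * (1 / 16 * δ) +
        3 / 2 * (δ / 4)) := by gcongr
    _ ≤ (n - m) * (1 / 36 * δ) + (m * x) * (3 * δ) := by
        have h1 : m * δ ≤ m * x * δ := by nlinarith [mul_pos hm hδ]
        nlinarith
    _ ≤ (n - m) * (1 / 36 * δ) + (1 / 4 * (n - m)) * (3 * δ) :=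
        add_le_add_right (mul_le_mul_of_nonneg_right (by nlinarith) (by positivity)) _
    _ ≤ (n - m) * δ := by nlinarith [mul_nonneg hnm hδ.le]

/-- The tails of the noises: a tuple for which more than `l`, resp. `3 l / 2`, rows are not
partitioned passes with probability at most `κ`, resp. `τ`, and a single passing tuple does not
suffice for success, up to a probability of at most `exp ε₁ * κ ^ 2`. -/
theorem noise_tails {m : ℕ} {ε₁ ε₂ κ β l : ℝ} (hm : 0 < m) (hε₁ : 0 < ε₁) (hε₂ : 0 < ε₂)
    (hκ : 0 < κ) (hβ : 0 < β) (hl : l = m / ε₂ * Real.log (m / (β * κ)))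
    (hmlog : 1 / ε₁ * (2 * Real.log (1 / κ) + Real.log (1 / β)) < m)
    (hsize : (m : ℝ) * (β * κ) ≤ 9 / 4) :
    ∃ τ : ℝ, 0 < τ ∧ m * τ ≤ 3 / 2 * κ ∧
      (∀ N : ℕ, l < N → passLaw (m / ε₂) (m / ε₂ * Real.log (m / β)) N true ≤
        ENNReal.ofReal κ) ∧
      (∀ N : ℕ, 3 / 2 * l < N → passLaw (m / ε₂) (m / ε₂ * Real.log (m / β)) N true ≤
        ENNReal.ofReal τ) ∧
      winProb (1 / ε₁) (m - 1 / ε₁ * Real.log (1 / β)) 1 ≤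
        ENNReal.ofReal (Real.exp ε₁ * κ ^ 2) := by
  have hm0 : (0 : ℝ) < m := by exact_mod_cast hm
  set b : ℝ := m / ε₂ with hb
  have hb0 : 0 < b := by positivity
  set L := Real.log (m / (β * κ)) with hL
  have hlogβ : L = Real.log (m / β) + Real.log (1 / κ) := by
    rw [hL, ← Real.log_mul (by positivity) (by positivity)]
    congr 1
    field_simp
  have hexplog : Real.exp (-Real.log (1 / κ)) = κ := by
    rw [one_div, Real.log_inv, neg_neg, Real.exp_log (by positivity)]
  have hpass : ∀ (y : ℝ) (M : ℕ), y * l < M → passLaw b (b * Real.log (m / β)) M true ≤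
        ENNReal.ofReal (Real.exp (-((y - 1) * L)) * κ) := by
    intro y M hM
    refine (passLaw_true_le hb0 _ M).trans ?_
    have hfac : Real.exp (-((y - 1) * L)) * κ =
        Real.exp (-((y - 1) * L) + -Real.log (1 / κ)) := by rw [Real.exp_add, hexplog]
    rw [hfac]
    gcongr
    rw [div_le_iff₀ hb0]
    have h1 : y * (b * L) < M := hl ▸ hM
    have h2 : b * L = b * Real.log (m / β) + b * Real.log (1 / κ) := by
      rw [hlogβ]; ring
    linarith
  refine ⟨Real.exp (-(L / 2)) * κ, by positivity, ?_, ?_, ?_, ?_⟩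
  · have h1 : (m * Real.exp (-(L / 2))) ^ 2 ≤ (3 / 2) ^ 2 := by
      rw [mul_pow, ← Real.exp_nat_mul, show ((2 : ℕ) : ℝ) * -(L / 2) = -L by push_cast; ring,
        Real.exp_neg, hL, Real.exp_log (by positivity)]
      calc (m : ℝ) ^ 2 * (m / (β * κ))⁻¹ = m * (β * κ) := by field_simp
        _ ≤ 9 / 4 := hsize
        _ = _ := by norm_num
    have h2 := le_of_sq_le_sq h1 (by norm_num)
    rw [← mul_assoc]
    gcongr
  · intro M hM
    have := hpass 1 M (by linarith)
    simpa using this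
  · intro M hM
    have := hpass (3 / 2) M hM
    rwa [show ((3 : ℝ) / 2 - 1) * L = L / 2 by ring] at this
  · refine (winProb_one_le (by positivity) _).trans ?_
    apply ENNReal.ofReal_le_ofReal
    have hfac : Real.exp ε₁ * κ ^ 2 = Real.exp (ε₁ + (2 : ℕ) * -Real.log (1 / κ)) := by
      rw [Real.exp_add, Real.exp_nat_mul, hexplog]
    rw [hfac]
    apply Real.exp_le_exp.2
    have h1 : 2 * Real.log (1 / κ) + Real.log (1 / β) < m * ε₁ := by
      rwa [one_div_mul_eq_div, div_lt_iff₀ hε₁] at hmlog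
    have h2 : -(m - 1 / ε₁ * Real.log (1 / β) - 1) / (1 / ε₁) =
        -(m * ε₁) + Real.log (1 / β) + ε₁ := by field_simp; ring
    rw [h2]
    push_cast
    linarith

/-- From the comparison of weighted sums over samples to the comparison of averages. -/
theorem average_le_of_weighted {m n : ℕ} (hmn : m < n) {s s' : ℝ≥0∞} {M : ℕ} (hM : M ≠ 0)
    {c₀ c a₀ a C D : ℝ} (hc₀ : 0 ≤ c₀) (hc : 0 ≤ c) (ha₀ : 0 ≤ a₀) (ha : 0 ≤ a)
    (hsum : ((n - m : ℕ) : ℝ≥0∞) * s ≤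
      ((n - m : ℕ) * ENNReal.ofReal c₀ + m * ENNReal.ofReal c) * s' +
        M * ((n - m : ℕ) * ENNReal.ofReal a₀ + m * ENNReal.ofReal a))
    (h₁ : (n - m : ℝ) * c₀ + m * c ≤ (n - m) * C) (h₂ : (n - m : ℝ) * a₀ + m * a ≤ (n - m) * D) :
    (M : ℝ≥0∞)⁻¹ * s ≤ ENNReal.ofReal C * ((M : ℝ≥0∞)⁻¹ * s') + ENNReal.ofReal D := by
  have hnm : ((n - m : ℕ) : ℝ) = n - m := by push_cast [hmn.le]; ring
  have hconv : ∀ {u v w : ℝ}, 0 ≤ u → 0 ≤ v → (n - m : ℝ) * u + m * v ≤ (n - m) * w →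
      ((n - m : ℕ) : ℝ≥0∞) * ENNReal.ofReal u + m * ENNReal.ofReal v ≤
        ((n - m : ℕ) : ℝ≥0∞) * ENNReal.ofReal w := by
    intro u v w hu hv h
    rw [← hnm] at h
    rw [← ENNReal.ofReal_natCast, ← ENNReal.ofReal_natCast, ← ENNReal.ofReal_mul (by positivity),
      ← ENNReal.ofReal_mul (by positivity), ← ENNReal.ofReal_mul (by positivity),
      ← ENNReal.ofReal_add (by positivity) (by positivity)]
    exact ENNReal.ofReal_le_ofReal h
  have hne : ((n - m : ℕ) : ℝ≥0∞) ≠ 0 := by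
    rw [Nat.cast_ne_zero]; omega
  have hs : s ≤ ENNReal.ofReal C * s' + M * ENNReal.ofReal D := by
    rw [← ENNReal.mul_le_mul_iff_right hne (ENNReal.natCast_ne_top _)]
    calc ((n - m : ℕ) : ℝ≥0∞) * s ≤ _ := hsum
      _ ≤ ((n - m : ℕ) * ENNReal.ofReal C) * s' + M * ((n - m : ℕ) * ENNReal.ofReal D) := by
          gcongr
          · exact hconv hc₀ hc h₁
          · exact hconv ha₀ ha h₂
      _ = _ := by ring
  calc (M : ℝ≥0∞)⁻¹ * s ≤ (M : ℝ≥0∞)⁻¹ * (ENNReal.ofReal C * s' + M * ENNReal.ofReal D) := by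
        gcongr
    _ = ENNReal.ofReal C * ((M : ℝ≥0∞)⁻¹ * s') + ((M : ℝ≥0∞)⁻¹ * M) * ENNReal.ofReal D := by ring
    _ = _ := by
        rw [ENNReal.inv_mul_cancel (by exact_mod_cast hM) (ENNReal.natCast_ne_top _), one_mul]

/-! ### Privacy of `PrivatekAverages` for a private averaging subroutine -/

section Main

variable {d k n : ℕ} {Λ rmin ε δ β : ℝ}

theorem privatekAverages_isProbabilityMeasure (hk : 0 < k) (hε : 0 < ε)
    (hm : (AdmissibleSizes n (ε / 2) (δ / 4) (β / 2)).Nonempty) {avg : Averager d}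
    (hmn : sampleSize n (ε / 2) (δ / 4) (β / 2) ≤ n) {ε' δ' : ℝ}
    (hA : PrivateOnBall Λ ε' δ' (avg Λ rmin (β / (2 * k))
          (ε / (4 * k * (ell n (ε / 2) (δ / 4) (β / 2) + 1)))
          (δ / (8 * k * Real.exp (ε / 2) * (ell n (ε / 2) (δ / 4) (β / 2) + 1)))))
    {T : Fin n → Sym (Pt d) k} (hT : ∀ i, ∀ x ∈ T i, ‖x‖ ≤ Λ) :
    IsProbabilityMeasure (privatekAverages avg Λ rmin ε δ β T) := by
  have hadm : sampleSize n (ε / 2) (δ / 4) (β / 2) ∈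
    AdmissibleSizes n (ε / 2) (δ / 4) (β / 2) := Nat.sInf_mem hm
  generalize hmdef : sampleSize n (ε / 2) (δ / 4) (β / 2) = m at *
  have hm0 : (0 : ℝ) < m := by exact_mod_cast hadm.1
  have hε₁ := epsOne_pos hadm
  constructor
  rw [privatekAverages_apply avg Λ rmin ε δ β T hmdef hε hε₁ MeasurableSet.univ]
  have hone : ∀ e : Fin m ↪ Fin n, sampleProb (avg Λ rmin (β / (2 * k))
          (ε / (4 * k * (ell n (ε / 2) (δ / 4) (β / 2) + 1)))
          (δ / (8 * k * Real.exp (ε / 2) * (ell n (ε / 2) (δ / 4) (β / 2) + 1))))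
          T (epsOne n (ε / 2) m) (ε / 2 / 2) (β / 2) Set.univ e = 1 := by
    intro e
    have h1 : ∀ c, averagesLaw (avg Λ rmin (β / (2 * k))
          (ε / (4 * k * (ell n (ε / 2) (δ / 4) (β / 2) + 1)))
          (δ / (8 * k * Real.exp (ε / 2) * (ell n (ε / 2) (δ / 4) (β / 2) + 1)))) T c
          Set.univ = 1 := fun c =>
      have := isProbabilityMeasure_averagesLaw hk hA hT c
      measure_univ
    unfold sampleProb
    simp only [Set.preimage_univ, h1, measure_univ]
    have h2 : ∀ v : Fin m → Bool, outcomeProb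
        (failProb (1 / epsOne n (ε / 2) m) (m - (1 / epsOne n (ε / 2) m) * Real.log (1 / (β / 2))))
        (winProb (1 / epsOne n (ε / 2) m) (m - (1 / epsOne n (ε / 2) m) * Real.log (1 / (β / 2))))
        1 (fun _ => 1) 1 v = 1 := by
      intro v
      have : firstValue (fun _ : Fin m => (1 : ℝ≥0∞)) 1 v = 1 :=
        firstValue_mem (P := (· = 1)) (fun _ => rfl) rfl v
      rw [outcomeProb, this, mul_one, mul_one, failProb_add_winProb (by positivity)]
    rw [show outcomeProb _ _ (1 : ℝ≥0∞) (fun _ : Fin m => 1) 1 = fun _ => 1 from funext h2]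
    exact boolExpect_const (fun i => sum_passLaw (by positivity) _ _) 1
  simp only [hone]
  rw [Finset.sum_const, Finset.card_univ, nsmul_eq_mul, mul_one]
  refine ENNReal.inv_mul_cancel ?_ (ENNReal.natCast_ne_top _)
  have : Nonempty (Fin m ↪ Fin n) := ⟨Fin.castLEEmb hmn⟩
  exact_mod_cast Fintype.card_ne_zero

/-- Privacy of the averages over all samples, for two databases that differ in row `j`. -/
theorem average_sampleProb_le {m : ℕ} {A : Multiset (Pt d) → Measure (Pt d)} {l ε₁ x : ℝ}
    (hk : 0 < k) (hε : 0 < ε) (hε' : ε ≤ 1) (hδ : 0 < δ) (hδ' : δ ≤ 1) (hβ : 0 < β)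
    (hm : 0 < m) (hmn : m < n) (hε₁ : 0 < ε₁) (hx : x = Real.exp ε₁)
    (hrate : 4 * m * x ≤ ε * (n - m))
    (hl8 : 8 ≤ l) (hl : l = m / (ε / 2 / 2) * Real.log (m / (β * (δ / 4))))
    (hmlog : 1 / ε₁ * (2 * Real.log (1 / (δ / 4)) + Real.log (1 / β)) < m)
    (hsize : (m : ℝ) * (β * (δ / 4)) ≤ 9 / 4)
    (hA : PrivateOnBall Λ (ε / (4 * k * (l + 1))) (δ / (8 * k * Real.exp (ε / 2) * (l + 1))) A)
    {T T' : Fin n → Sym (Pt d) k} (hT : ∀ i, ∀ x ∈ T i, ‖x‖ ≤ Λ) (hT' : ∀ i, ∀ x ∈ T' i, ‖x‖ ≤ Λ)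
    {j : Fin n} (hj : ∀ i, i ≠ j → T i = T' i)
    {S : Set (Option (Sym (Pt d) k))} (hS : MeasurableSet S) :
    (Fintype.card (Fin m ↪ Fin n) : ℝ≥0∞)⁻¹ *
        ∑ e : Fin m ↪ Fin n, sampleProb A T ε₁ (ε / 2 / 2) β S e ≤
      ENNReal.ofReal (Real.exp ε) * ((Fintype.card (Fin m ↪ Fin n) : ℝ≥0∞)⁻¹ *
        ∑ e : Fin m ↪ Fin n, sampleProb A T' ε₁ (ε / 2 / 2) β S e) + ENNReal.ofReal δ := by
  have hkR : (1 : ℝ) ≤ k := by exact_mod_cast hk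
  have hmR : (0 : ℝ) < m := by exact_mod_cast hm
  have hx1 : 1 ≤ x := hx ▸ Real.one_le_exp hε₁.le
  have hbudget₁ := budget_mul hε hε' hkR hl8 hmR hx1 hrate
  obtain ⟨τ, hτ0, hmτ, hκ, hτ, hω⟩ := noise_tails hm hε₁ (by positivity : 0 < ε / 2 / 2)
    (by positivity) hβ hl hmlog hsize
  have hbudget₂ := budget_add hε hε' hδ hδ' hkR hl8 hmR hx1 hrate hmτ
  have hε'0 : 0 < ε / (4 * k * (l + 1)) := by positivity
  have hδ₁0 : 0 < δ / (8 * k * Real.exp (ε / 2) * (l + 1)) := by positivity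
  generalize ε / (4 * k * (l + 1)) = ε' at *
  generalize δ / (8 * k * Real.exp (ε / 2) * (l + 1)) = δ₁ at *
  have hS₀ : MeasurableSet (some ⁻¹' S : Set (Sym (Pt d) k)) := measurable_some_tuple hS
  -- the costs of comparing the averages for equal centers, and for different good centers
  have h2kN : 2 * (k : ℝ) ≤ 2 * k * (5 / 2 * l + 1) := by nlinarith
  have hr₀1 : 1 ≤ Real.exp (2 * k * ε') := Real.one_le_exp (by positivity)
  have hr₀r : Real.exp (2 * k * ε') ≤ Real.exp (2 * k * (5 / 2 * l + 1) * ε') := by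
    apply Real.exp_le_exp.2
    gcongr
  have hsame : ∀ c : Fin k → Pt d, averagesLaw A T c (some ⁻¹' S) ≤
      ENNReal.ofReal (Real.exp (2 * k * ε')) * averagesLaw A T' c (some ⁻¹' S) +
        ENNReal.ofReal (2 * k * Real.exp (2 * k * ε') * δ₁) := fun c =>
    averagesLaw_indistinguishable_same hk hA hε'0.le hδ₁0.le hT hT' hj c _ hS₀
  have hgood : ∀ X X' : Sym (Pt d) k,
      (numBadOff T j X + numBadOff T j X' : ℝ) ≤ 5 / 2 * l →
      averagesLaw A T (enum X) (some ⁻¹' S) ≤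
        ENNReal.ofReal (Real.exp (2 * k * (5 / 2 * l + 1) * ε')) *
          averagesLaw A T' (enum X') (some ⁻¹' S) + ENNReal.ofReal
            (2 * k * (5 / 2 * l + 1) * Real.exp (2 * k * (5 / 2 * l + 1) * ε') * δ₁) := by
    intro X X' h
    refine averagesLaw_indistinguishable_of_numBadOff hk hA hε'0.le hδ₁0.le hT hT' hj X X'
      ?_ _ hS₀
    gcongr
  generalize 2 * (k : ℝ) * (5 / 2 * l + 1) = N at *
  have hN0 : 0 < N := lt_of_lt_of_le (by positivity) h2kN
  have hη₀η : 2 * k * Real.exp (2 * k * ε') * δ₁ ≤ N * Real.exp (N * ε') * δ₁ := by gcongr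
  have hη₀0 : 0 ≤ 2 * k * Real.exp (2 * k * ε') * δ₁ := by positivity
  have hη0 : 0 ≤ N * Real.exp (N * ε') * δ₁ := by positivity
  generalize 2 * k * Real.exp (2 * k * ε') * δ₁ = η₀ at *
  generalize N * Real.exp (N * ε') * δ₁ = η at *
  generalize Real.exp (2 * k * ε') = r₀ at *
  generalize Real.exp (N * ε') = r at *
  have hsame' : ∀ c : Fin k → Pt d, averagesLaw A T c (some ⁻¹' S) ≤
      ENNReal.ofReal r * averagesLaw A T' c (some ⁻¹' S) + ENNReal.ofReal η := fun c =>
    (hsame c).trans (by gcongr)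
  have hsum := sum_embedding_le (m := m) j
    (f := sampleProb A T ε₁ (ε / 2 / 2) β S)
    (f' := sampleProb A T' ε₁ (ε / 2 / 2) β S)
    (C₀ := ENNReal.ofReal (Real.exp (ε / 2 / 2) * r₀))
    (C := ENNReal.ofReal (Real.exp (ε / 2 / 2) * (x * r))) (a₀ := ENNReal.ofReal η₀)
    (a := ENNReal.ofReal (2 * (δ / 4) + η + x * (δ / 4) ^ 2 + m * τ))
    (fun e he => by
      refine (sampleProb_le_of_notMem hm hj hε₁ (by positivity) he
        (ENNReal.one_le_ofReal.2 hr₀1) hsame).trans (le_of_eq ?_)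
      rw [ENNReal.ofReal_mul (Real.exp_pos _).le])
    (fun e p hep j' hej' => by
      obtain ⟨m', rfl⟩ : ∃ m', m = m' + 1 := ⟨m - 1, by omega⟩
      have hT1 : ∀ c : Fin k → Pt d, averagesLaw A T c (some ⁻¹' S) ≤ 1 := fun c =>
        have := isProbabilityMeasure_averagesLaw hk hA hT c
        prob_le_one
      refine (sampleProb_le_of_mem hj hε₁ (by positivity) hep hej'
        (ENNReal.one_le_ofReal.2 (hr₀1.trans hr₀r)) hT1 hsame' hgood (by linarith) hκ hτ
        hω).trans (le_of_eq ?_)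
      rw [hx, ENNReal.ofReal_mul (Real.exp_pos _).le, ENNReal.ofReal_mul (by positivity),
        ENNReal.ofReal_add (by positivity) (by positivity),
        ENNReal.ofReal_add (by positivity) (by positivity),
        ENNReal.ofReal_add (by positivity) (by positivity),
        ENNReal.ofReal_mul (p := 2) (by positivity),
        ENNReal.ofReal_mul (p := ((m' + 1 : ℕ) : ℝ)) (by positivity),
        ENNReal.ofReal_natCast, ENNReal.ofReal_ofNat,
        ENNReal.ofReal_mul (p := Real.exp ε₁) (q := r) (Real.exp_pos _).le,
        ENNReal.ofReal_mul (p := Real.exp ε₁) (q := (δ / 4) ^ 2) (Real.exp_pos _).le])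
  have hcard : Fintype.card (Fin m ↪ Fin n) ≠ 0 := by
    have : Nonempty (Fin m ↪ Fin n) := ⟨Fin.castLEEmb hmn.le⟩
    exact Fintype.card_ne_zero
  have hr0 : 0 ≤ r := zero_le_one.trans (hr₀1.trans hr₀r)
  exact average_le_of_weighted hmn hcard (by positivity) (by positivity) hη₀0 (by positivity)
    hsum hbudget₁ hbudget₂

/-- The definition of `ε₁` fixes the rate of sampling, `n ε = 4 m (exp ε₁ + 3)`, and `8 ≤ ℓ` makes
the parameters of the averages small enough for `average_sampleProb_le`. -/
theorem privatekAverages_private (hk : 0 < k) (hε : 0 < ε) (hε' : ε ≤ 1) (hδ : 0 < δ)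
    (hδ' : δ ≤ 1) (hβ : 0 < β) (hβ' : β ≤ 1)
    (hm : (AdmissibleSizes n (ε / 2) (δ / 4) (β / 2)).Nonempty) {avg : Averager d}
    (havg : PrivateAverager Λ rmin avg) :
    DifferentiallyPrivateOn {X : Sym (Pt d) k | ∀ x ∈ X, ‖x‖ ≤ Λ} ε δ
      (privatekAverages (n := n) avg Λ rmin ε δ β) := by
  have hadm : sampleSize n (ε / 2) (δ / 4) (β / 2) ∈
    AdmissibleSizes n (ε / 2) (δ / 4) (β / 2) := Nat.sInf_mem hm
  have hsize : (sampleSize n (ε / 2) (δ / 4) (β / 2) : ℝ) * (β / 2 * (δ / 4)) ≤ 9 / 4 :=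
    sampleSize_mul_le (by positivity) (by linarith) (by positivity) (by linarith) hm
  have hkR : (1 : ℝ) ≤ k := by exact_mod_cast hk
  have hell : ell n (ε / 2) (δ / 4) (β / 2) =
    (2 * sampleSize n (ε / 2) (δ / 4) (β / 2) / (ε / 2)) *
      Real.log (sampleSize n (ε / 2) (δ / 4) (β / 2) / (β / 2 * (δ / 4))) := rfl
  have happly := fun T S hS => privatekAverages_apply (k := k) avg Λ rmin ε δ β T
    (m := sampleSize n (ε / 2) (δ / 4) (β / 2)) rfl hε (epsOne_pos hadm) (S := S) hS
  have hprob := fun {ε' δ' : ℝ} hmn hA (T : Fin n → Sym (Pt d) k) hT =>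
    privatekAverages_isProbabilityMeasure (Λ := Λ) (rmin := rmin) (ε' := ε') (δ' := δ')
      hk hε hm (avg := avg) hmn hA (T := T) hT
  generalize sampleSize n (ε / 2) (δ / 4) (β / 2) = m at *
  generalize ell n (ε / 2) (δ / 4) (β / 2) = l at *
  have hε₁ := epsOne_pos hadm
  have hexp₁ := exp_epsOne hadm
  obtain ⟨hm0, hgt, hmlog⟩ := hadm
  have hx1 : 1 < Real.exp (epsOne n (ε / 2) m) := Real.one_lt_exp_iff.2 hε₁
  have hmR : (1 : ℝ) ≤ m := by exact_mod_cast hm0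
  -- the sampling rate
  have hn : (n : ℝ) * ε = 4 * m * (Real.exp (epsOne n (ε / 2) m) + 3) := by
    rw [hexp₁]
    field_simp
    ring
  have hrate : 4 * m * Real.exp (epsOne n (ε / 2) m) ≤ ε * (n - m) := by nlinarith
  have hmn : m < n := by
    have : (0 : ℝ) < n - m := by
      have h4 : 0 < 4 * m * Real.exp (epsOne n (ε / 2) m) := by positivity
      by_contra h
      nlinarith
    have : (m : ℝ) < n := by linarith
    exact_mod_cast this
  -- the bound on the number of rows that are not partitioned
  have hL2 : 2 ≤ Real.log (m / (β / 2 * (δ / 4))) := by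
    have h8 : (8 : ℝ) ≤ m / (β / 2 * (δ / 4)) := by
      rw [le_div_iff₀ (by positivity)]
      nlinarith [mul_le_one₀ hβ' hδ.le hδ']
    have h2 : Real.log 8 = 3 * Real.log 2 := by
      rw [show (8 : ℝ) = 2 ^ 3 by norm_num, Real.log_pow]; norm_num
    have h3 := Real.log_two_gt_d9
    have h4 := Real.log_le_log (by norm_num) h8
    linarith
  have hl : l = m / (ε / 2 / 2) * Real.log (m / (β / 2 * (δ / 4))) := by
    rw [hell]; field_simp
  have hl8 : 8 ≤ l := by
    rw [hl]
    have : 4 ≤ m / (ε / 2 / 2) := by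
      rw [le_div_iff₀ (by positivity)]
      linarith
    nlinarith
  have hkl : 9 ≤ k * (l + 1) := by nlinarith
  have hA : PrivateOnBall Λ (ε / (4 * k * (l + 1))) (δ / (8 * k * Real.exp (ε / 2) * (l + 1)))
      (avg Λ rmin (β / (2 * k)) (ε / (4 * k * (l + 1)))
        (δ / (8 * k * Real.exp (ε / 2) * (l + 1)))) := by
    intro S hS
    refine havg _ _ _ (by positivity) ?_ (by positivity) ?_ (by positivity) ?_ S hS
    · rw [div_lt_one (by positivity)]
      linarith
    · rw [div_lt_one (by positivity)]
      nlinarith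
    · rw [div_lt_one (by positivity)]
      have := Real.one_le_exp (x := ε / 2) (by positivity)
      nlinarith
  refine ⟨fun T hT => hprob hmn.le hA T hT, ?_⟩
  intro T T' hT hT' hnb S hS
  obtain ⟨j, -, hj⟩ := hnb
  have hj : ∀ i, i ≠ j → T i = T' i := fun i hi => by
    by_contra h
    exact hi (hj i h)
  rw [happly T S hS, happly T' S hS]
  exact average_sampleProb_le hk hε hε' hδ hδ' (by positivity) hm0 hmn hε₁ rfl hrate hl8 hl
    hmlog hsize hA hT hT' hj hS

end Main


/-! ### Pure privacy and composition -/

section Pure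

variable {Ω Ω' : Type*} [MeasurableSpace Ω] [MeasurableSpace Ω']

theorem Indistinguishable.le_smul {ε : ℝ} {μ ν : Measure Ω} (h : Indistinguishable ε 0 μ ν) :
    μ ≤ ENNReal.ofReal (Real.exp ε) • ν := by
  rw [Measure.le_iff]
  intro S hS
  simpa using h S hS

theorem Indistinguishable.prod_pure {ε₁ ε₂ : ℝ} {μ μ' : Measure Ω} {ν ν' : Measure Ω'}
    [SFinite μ'] [SFinite ν] [SFinite ν'] (h₁ : Indistinguishable ε₁ 0 μ μ')
    (h₂ : Indistinguishable ε₂ 0 ν ν') :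
    Indistinguishable (ε₁ + ε₂) 0 (μ.prod ν) (μ'.prod ν') := by
  intro S hS
  rw [Measure.prod_apply hS, Measure.prod_apply hS]
  calc ∫⁻ x, ν (Prod.mk x ⁻¹' S) ∂μ
      ≤ ∫⁻ x, ENNReal.ofReal (Real.exp ε₂) * ν' (Prod.mk x ⁻¹' S)
          ∂(ENNReal.ofReal (Real.exp ε₁) • μ') :=
        lintegral_mono' h₁.le_smul fun x => by
          simpa using h₂ _ (measurable_prodMk_left hS)
    _ = _ := by
        rw [lintegral_smul_measure, lintegral_const_mul' _ _ ENNReal.ofReal_ne_top,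
          Real.exp_add, ENNReal.ofReal_mul (Real.exp_pos _).le, smul_eq_mul]
        simp [mul_assoc]

/-- A purely private choice followed by a private computation. -/
theorem Indistinguishable.bind {ε₁ ε₂ δ : ℝ} {μ ν : Measure Ω} [IsProbabilityMeasure μ]
    {κ κ' : Ω → Measure Ω'} (h : Indistinguishable ε₁ 0 μ ν) (hκ : AEMeasurable κ μ)
    (hκ' : AEMeasurable κ' ν) (hκκ' : ∀ x, Indistinguishable ε₂ δ (κ x) (κ' x)) :
    Indistinguishable (ε₁ + ε₂) δ (μ.bind κ) (ν.bind κ') := by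
  intro S hS
  rw [Measure.bind_apply hS hκ, Measure.bind_apply hS hκ']
  calc ∫⁻ x, κ x S ∂μ
      ≤ ∫⁻ x, (ENNReal.ofReal (Real.exp ε₂) * κ' x S + ENNReal.ofReal δ) ∂μ :=
        lintegral_mono fun x => hκκ' x S hS
    _ = ENNReal.ofReal (Real.exp ε₂) * ∫⁻ x, κ' x S ∂μ + ENNReal.ofReal δ := by
        rw [lintegral_add_right _ measurable_const,
          lintegral_const_mul' _ _ ENNReal.ofReal_ne_top]
        simp
    _ ≤ ENNReal.ofReal (Real.exp ε₂) * ∫⁻ x, κ' x S ∂(ENNReal.ofReal (Real.exp ε₁) • ν) +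
          ENNReal.ofReal δ := by
        gcongr
        exact h.le_smul
    _ = _ := by
        rw [lintegral_smul_measure, add_comm ε₁, Real.exp_add,
          ENNReal.ofReal_mul (Real.exp_pos _).le, smul_eq_mul, mul_assoc]

/-- Every function is almost everywhere measurable for a measure with countable support. -/
theorem aemeasurable_of_countable_support [MeasurableSingletonClass Ω] {μ : Measure Ω} {F : Set Ω}
    (hF : F.Countable) (hμ : μ Fᶜ = 0) (f : Ω → Ω') : AEMeasurable f μ := by
  have : μ.restrict F = μ := Measure.restrict_eq_self_of_ae_mem hμ
  rw [← this, ← Set.biUnion_of_singleton F]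
  have := hF.to_subtype
  rw [Set.biUnion_eq_iUnion, aemeasurable_iUnion_iff]
  intro a
  rw [Measure.restrict_singleton]
  exact (aemeasurable_dirac).smul_measure _

end Pure

/-! ### The interior point mechanism -/

section InteriorPoint

/-- Two multisets have close counts if no property is counted more than once more often in one of
them than in the other; exchanging, adding or deleting one point has this effect. -/
def CountClose (A B : Multiset ℝ) : Prop :=
  ∀ (p : ℝ → Prop) [DecidablePred p], A.countP p ≤ B.countP p + 1 ∧ B.countP p ≤ A.countP p + 1

theorem CountClose.symm {A B : Multiset ℝ} (h : CountClose A B) : CountClose B A :=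
  fun p _ => (h p).symm

theorem countP_take_succ_le (p : ℝ → Bool) (l : List ℝ) (t : ℕ) :
    (l.take (t + 1)).countP p ≤ (l.take t).countP p + 1 := by
  induction l generalizing t with
  | nil => simp
  | cons a l ih =>
    cases t with
    | zero => simp [List.countP_cons]; split_ifs <;> simp
    | succ t =>
      rw [List.take_succ_cons, List.take_succ_cons, List.countP_cons, List.countP_cons]
      have := ih t
      omega

theorem countP_take_le_succ (p : ℝ → Bool) (l : List ℝ) (t : ℕ) :
    (l.take t).countP p ≤ (l.take (t + 1)).countP p :=
  (List.take_sublist_take_left (by omega)).countP_le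

theorem countP_take_orderedInsert (r : ℝ → ℝ → Prop) [DecidableRel r] (p : ℝ → Bool) (x : ℝ)
    (l : List ℝ) (t : ℕ) :
    ((l.orderedInsert r x).take t).countP p ≤ (l.take t).countP p + 1 ∧
      (l.take t).countP p ≤ ((l.orderedInsert r x).take t).countP p + 1 := by
  induction l generalizing t with
  | nil =>
    cases t with
    | zero => simp
    | succ t => simp [List.countP_cons]; split_ifs <;> simp
  | cons y l ih =>
    cases t with
    | zero => simp
    | succ t =>
      rw [List.orderedInsert_cons]
      split_ifs with h
      · rw [List.take_succ_cons, List.countP_cons]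
        have h1 := countP_take_succ_le p (y :: l) t
        have h2 := countP_take_le_succ p (y :: l) t
        have h3 : (if p x = true then 1 else 0) ≤ 1 := by split_ifs <;> simp
        omega
      · rw [List.take_succ_cons, List.take_succ_cons, List.countP_cons, List.countP_cons]
        have := ih t
        omega

/-- Adding a point changes the multiset of the `t` smallest points by an exchange at most. -/
theorem countClose_take_sort (r : ℝ → ℝ → Prop) [DecidableRel r] [IsTrans ℝ r] [Std.Antisymm r]
    [Std.Total r] (t : ℕ) (x : ℝ) (S : Multiset ℝ) :
    CountClose (((x ::ₘ S).sort r).take t : List ℝ) ((S.sort r).take t : List ℝ) := by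
  have h : (x ::ₘ S).sort r = (S.sort r).orderedInsert r x := by
    refine List.Perm.eq_of_pairwise' (r := r) (Multiset.pairwise_sort _ _)
      ((Multiset.pairwise_sort S r).orderedInsert _ _) ?_
    refine List.Perm.trans ?_ (List.perm_orderedInsert r x _).symm
    rw [← Multiset.coe_eq_coe, Multiset.sort_eq, ← Multiset.cons_coe, Multiset.sort_eq]
  intro p _
  rw [h, Multiset.coe_countP, Multiset.coe_countP]
  exact countP_take_orderedInsert r _ x _ t

theorem quality_le {Λ g : ℝ} {A B : Multiset ℝ} (h : CountClose A B) (y : ℝ) :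
    quality Λ g A y ≤ quality Λ g B y + 1 := by
  classical
  unfold quality
  have h1 := (h fun x => gridLeft Λ g x ≤ y).1
  have h2 := (h fun x => y ≤ gridRight Λ g x).1
  have e : ∀ a b c d : ℕ, a ≤ c + 1 → b ≤ d + 1 → min a b ≤ min c d + 1 := by
    intro a b c d; omega
  exact e _ _ _ _ h1 h2

theorem interiorPoint_apply (Λ g ε : ℝ) (S : Multiset ℝ) {E : Set ℝ} (hE : MeasurableSet E) :
    interiorPoint Λ g ε S E = ∑ j ∈ Finset.range (gridTop Λ g + 1),
      ENNReal.ofReal (Real.exp (ε * quality Λ g S (-Λ + j * g) / 2) /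
        ∑ j ∈ Finset.range (gridTop Λ g + 1),
          Real.exp (ε * quality Λ g S (-Λ + j * g) / 2)) *
        E.indicator 1 (-Λ + j * g) := by
  simp [interiorPoint, Measure.finsetSum_apply, Measure.dirac_apply' _ hE]

theorem isProbabilityMeasure_interiorPoint (Λ g ε : ℝ) (S : Multiset ℝ) :
    IsProbabilityMeasure (interiorPoint Λ g ε S) := by
  constructor
  rw [interiorPoint_apply _ _ _ _ MeasurableSet.univ]
  simp only [Set.indicator_univ, Pi.one_apply, mul_one]
  have hZ : 0 < ∑ j ∈ Finset.range (gridTop Λ g + 1),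
      Real.exp (ε * quality Λ g S (-Λ + j * g) / 2) :=
    Finset.sum_pos (fun _ _ => Real.exp_pos _) (by simp)
  rw [← ENNReal.ofReal_sum_of_nonneg (fun _ _ => by positivity), ← Finset.sum_div,
    div_self hZ.ne', ENNReal.ofReal_one]

/-- The weights and their sum change by factors of at most `exp (ε / 2)` each. -/
theorem interiorPoint_private {Λ g ε : ℝ} (hε : 0 ≤ ε) {A B : Multiset ℝ} (h : CountClose A B) :
    Indistinguishable ε 0 (interiorPoint Λ g ε A) (interiorPoint Λ g ε B) := by
  intro E hE
  rw [interiorPoint_apply _ _ _ _ hE, interiorPoint_apply _ _ _ _ hE, ENNReal.ofReal_zero,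
    add_zero, Finset.mul_sum]
  refine Finset.sum_le_sum fun j _ => ?_
  rw [← mul_assoc, ← ENNReal.ofReal_mul (Real.exp_pos _).le]
  gcongr
  have hw : ∀ {A B : Multiset ℝ} (_ : CountClose A B) (y : ℝ),
      Real.exp (ε * quality Λ g A y / 2) ≤
        Real.exp (ε / 2) * Real.exp (ε * quality Λ g B y / 2) := by
    intro A B h y
    rw [← Real.exp_add]
    gcongr
    have : (quality Λ g A y : ℝ) ≤ quality Λ g B y + 1 := by exact_mod_cast quality_le h y
    nlinarith
  have hZ : ∀ A : Multiset ℝ, 0 < ∑ j ∈ Finset.range (gridTop Λ g + 1),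
      Real.exp (ε * quality Λ g A (-Λ + j * g) / 2) := fun A =>
    Finset.sum_pos (fun _ _ => Real.exp_pos _) (by simp)
  have hZle : ∑ j ∈ Finset.range (gridTop Λ g + 1),
      Real.exp (ε * quality Λ g B (-Λ + j * g) / 2) ≤ Real.exp (ε / 2) *
        ∑ j ∈ Finset.range (gridTop Λ g + 1),
          Real.exp (ε * quality Λ g A (-Λ + j * g) / 2) := by
    rw [Finset.mul_sum]
    exact Finset.sum_le_sum fun j _ => hw h.symm _
  rw [← mul_div_assoc, div_le_div_iff₀ (hZ A) (hZ B)]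
  calc _ ≤ (Real.exp (ε / 2) * Real.exp (ε * quality Λ g B (-Λ + j * g) / 2)) *
      (Real.exp (ε / 2) * ∑ j ∈ Finset.range (gridTop Λ g + 1),
          Real.exp (ε * quality Λ g A (-Λ + j * g) / 2)) :=
        mul_le_mul (hw h _) hZle (hZ B).le (by positivity)
    _ = _ := by
        rw [show Real.exp ε = Real.exp (ε / 2) * Real.exp (ε / 2) by
          rw [← Real.exp_add, add_halves]]
        ring

theorem interiorPoint_grid_compl (Λ g ε : ℝ) (S : Multiset ℝ) :
    interiorPoint Λ g ε S
      (((Finset.range (gridTop Λ g + 1)).image fun j : ℕ => -Λ + j * g : Finset ℝ) : Set ℝ)ᶜ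
      = 0 := by
  rw [interiorPoint_apply _ _ _ _ (Finset.measurableSet _).compl]
  refine Finset.sum_eq_zero fun j hj => ?_
  rw [Set.indicator_of_notMem, mul_zero]
  simp only [Set.mem_compl_iff, not_not, Finset.mem_coe]
  exact Finset.mem_image_of_mem (fun j : ℕ => -Λ + (j : ℝ) * g) hj

theorem measurable_segment (g : ℝ) : Measurable fun z : ℝ × ℝ => (z.1 - g, z.2 + g) := by
  fun_prop

theorem isProbabilityMeasure_boundingSegment (Λ g β ε : ℝ) (S : Multiset ℝ) :
    IsProbabilityMeasure (boundingSegment Λ g β ε S) := by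
  have := isProbabilityMeasure_interiorPoint Λ g
  exact Measure.isProbabilityMeasure_map (measurable_segment g).aemeasurable

theorem boundingSegment_private_cons {Λ g β ε : ℝ} (hε : 0 ≤ ε) (x : ℝ) (S : Multiset ℝ) :
    Indistinguishable ε 0 (boundingSegment Λ g β ε (x ::ₘ S)) (boundingSegment Λ g β ε S) ∧
      Indistinguishable ε 0 (boundingSegment Λ g β ε S) (boundingSegment Λ g β ε (x ::ₘ S)) := by
  have := isProbabilityMeasure_interiorPoint Λ g
  have h₀ := countClose_take_sort (· ≤ ·) (⌈8 / ε * Real.log (4 * Λ / (g * β))⌉₊ + 1) x S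
  have h₁ := countClose_take_sort (· ≥ ·) (⌈8 / ε * Real.log (4 * Λ / (g * β))⌉₊ + 1) x S
  have hε2 : 0 ≤ ε / 2 := by positivity
  constructor
  · have h := ((interiorPoint_private (Λ := Λ) (g := g) hε2 h₀).prod_pure
      (interiorPoint_private (Λ := Λ) (g := g) hε2 h₁)).map (measurable_segment g)
    rwa [add_halves] at h
  · have h := ((interiorPoint_private (Λ := Λ) (g := g) hε2 h₀.symm).prod_pure
      (interiorPoint_private (Λ := Λ) (g := g) hε2 h₁.symm)).map (measurable_segment g)
    rwa [add_halves] at h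

theorem aemeasurable_boundingSegment {Ω : Type*} [MeasurableSpace Ω] (Λ g β ε : ℝ)
    (S : Multiset ℝ) (f : ℝ × ℝ → Ω) : AEMeasurable f (boundingSegment Λ g β ε S) := by
  have := isProbabilityMeasure_interiorPoint Λ g
  set G : Finset ℝ := (Finset.range (gridTop Λ g + 1)).image fun j : ℕ => -Λ + j * g with hG
  have hGc : ((fun z : ℝ × ℝ => (z.1 - g, z.2 + g)) ''
      ((G ×ˢ G : Finset (ℝ × ℝ)) : Set (ℝ × ℝ))).Countable := (Finset.countable_toSet _).image _
  refine aemeasurable_of_countable_support hGc ?_ f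
  rw [boundingSegment, Measure.map_apply (measurable_segment g) hGc.measurableSet.compl]
  refine measure_mono_null (t := (Prod.fst ⁻¹' (G : Set ℝ)ᶜ) ∪ (Prod.snd ⁻¹' (G : Set ℝ)ᶜ)) ?_
    (measure_union_null ?_ ?_)
  · intro z hz
    by_contra h
    simp only [Set.mem_union, Set.mem_preimage, Set.mem_compl_iff, not_or, not_not,
      Finset.mem_coe] at h
    exact hz ⟨z, by simpa using h, rfl⟩
  · exact Measure.quasiMeasurePreserving_fst.preimage_null (interiorPoint_grid_compl _ _ _ _)
  · exact Measure.quasiMeasurePreserving_snd.preimage_null (interiorPoint_grid_compl _ _ _ _)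

end InteriorPoint


/-! ### The Gaussian mechanism with a noisy count -/

section Gaussian

theorem hasSubgaussianMGF_gaussianReal : HasSubgaussianMGF id 1 (gaussianReal 0 1) where
  integrable_exp_mul := integrable_exp_mul_gaussianReal
  mgf_le t := by simp [mgf_id_gaussianReal]

/-- Chernoff bound for the event that the privacy loss of the Gaussian mechanism exceeds `η`. -/
theorem gaussianReal_loss_le {η c r : ℝ} (hη : 0 ≤ η) (hc : 0 < c) (hη2 : η ≤ 2 * c ^ 2)
    (hrc : c * |r| ≤ η) :
    gaussianReal 0 1 {x | η < r * x + r ^ 2 / 2} ≤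
      ENNReal.ofReal (Real.exp (-(c ^ 2 / 2) + η / 2)) := by
  rcases eq_or_ne r 0 with rfl | hr
  · simp [hη.not_gt]
  have hr2 : 0 < r ^ 2 := by positivity
  have hsq : c ^ 2 * r ^ 2 ≤ η ^ 2 := by
    rw [← sq_abs r, ← mul_pow]
    exact pow_le_pow_left₀ (by positivity) hrc 2
  have hs : 0 ≤ η - r ^ 2 / 2 := by
    by_contra h
    push Not at h
    have h1 : 0 < c ^ 2 := by positivity
    nlinarith
  have h := (hasSubgaussianMGF_gaussianReal.const_mul r).measure_ge_le hs
  rw [← ofReal_measureReal]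
  refine ENNReal.ofReal_le_ofReal ((measureReal_mono ?_).trans (h.trans ?_))
  · intro x hx
    simp only [Set.mem_ofPred_eq, id] at hx ⊢
    linarith
  · apply Real.exp_le_exp.2
    change -(η - r ^ 2 / 2) ^ 2 / (2 * (r ^ 2 * 1)) ≤ _
    rw [mul_one, neg_div, neg_le, neg_add, neg_neg, ← sub_eq_add_neg, le_div_iff₀ (by positivity)]
    nlinarith [sq_nonneg (r ^ 2)]

/-- Privacy of adding standard Gaussian noise to two numbers at distance `|r| ≤ η / c`. -/
theorem gaussianReal_shift_le {η c r : ℝ} (hη : 0 ≤ η) (hc : 0 < c) (hη2 : η ≤ 2 * c ^ 2)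
    (hrc : c * |r| ≤ η) {A : Set ℝ} (hA : MeasurableSet A) :
    gaussianReal 0 1 {x | x + r ∈ A} ≤ ENNReal.ofReal (Real.exp η) * gaussianReal 0 1 A +
      ENNReal.ofReal (Real.exp (-(c ^ 2 / 2) + η / 2)) := by
  have hgood : gaussianReal 0 1 {x | x + r ∈ A ∧ r * x + r ^ 2 / 2 ≤ η} ≤
      ENNReal.ofReal (Real.exp η) * gaussianReal 0 1 A := by
    have hm : MeasurableSet {x | x + r ∈ A ∧ r * x + r ^ 2 / 2 ≤ η} :=
      ((measurable_id.add_const r) hA).inter (measurableSet_le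
        (show Measurable fun x : ℝ => r * x + r ^ 2 / 2 by fun_prop) measurable_const)
    have hA' : MeasurableSet {x | x + r ∈ A} := (measurable_id.add_const r) hA
    rw [gaussianReal_apply _ one_ne_zero, gaussianReal_apply _ one_ne_zero,
      ← lintegral_const_mul _ (measurable_gaussianPDF 0 1), ← lintegral_indicator hm,
      ← lintegral_indicator hA, ← lintegral_add_right_eq_self (μ := volume) (fun x =>
        A.indicator (fun x => ENNReal.ofReal (Real.exp η) * gaussianPDF 0 1 x) x) r]
    refine lintegral_mono fun x => ?_
    by_cases hx : x + r ∈ A ∧ r * x + r ^ 2 / 2 ≤ η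
    · rw [Set.indicator_of_mem (by exact hx), Set.indicator_of_mem hx.1, gaussianPDF,
        gaussianPDF, ← ENNReal.ofReal_mul (Real.exp_pos _).le]
      apply ENNReal.ofReal_le_ofReal
      simp only [gaussianPDFReal, NNReal.coe_one, mul_one, sub_zero]
      rw [mul_left_comm, ← Real.exp_add]
      gcongr
      linarith [hx.2]
    · rw [Set.indicator_of_notMem (by exact hx)]
      exact zero_le
  calc gaussianReal 0 1 {x | x + r ∈ A}
      ≤ gaussianReal 0 1 ({x | x + r ∈ A ∧ r * x + r ^ 2 / 2 ≤ η} ∪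
          {x | η < r * x + r ^ 2 / 2}) := measure_mono fun x hx => by
        rcases le_or_gt (r * x + r ^ 2 / 2) η with h | h
        · exact Or.inl ⟨hx, h⟩
        · exact Or.inr h
    _ ≤ _ := (measure_union_le _ _).trans
        (add_le_add hgood (gaussianReal_loss_le hη hc hη2 hrc))

/-- The Gaussian mechanism with noise of scale `σ`. -/
theorem gaussianReal_affine_le {η c a a' σ : ℝ} (hη : 0 ≤ η) (hc : 0 < c) (hη2 : η ≤ 2 * c ^ 2)
    (hσ : 0 ≤ σ) (haσ : c * |a - a'| ≤ η * σ) {E : Set ℝ} (hE : MeasurableSet E) :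
    gaussianReal 0 1 {x | a + σ * x ∈ E} ≤
      ENNReal.ofReal (Real.exp η) * gaussianReal 0 1 {x | a' + σ * x ∈ E} +
        ENNReal.ofReal (Real.exp (-(c ^ 2 / 2) + η / 2)) := by
  have hA : MeasurableSet {x | a' + σ * x ∈ E} :=
    (show Measurable fun x : ℝ => a' + σ * x by fun_prop) hE
  rcases hσ.eq_or_lt with rfl | hσ
  · have haa : a = a' := by
      have : |a - a'| ≤ 0 := by
        by_contra h
        push Not at h
        nlinarith [mul_pos hc h]
      exact sub_eq_zero.1 (abs_nonpos_iff.1 this)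
    subst haa
    have := gaussianReal_shift_le (r := 0) hη hc hη2 (by simpa using hη) hA
    simpa using this
  · have h := gaussianReal_shift_le (r := (a - a') / σ) hη hc hη2 (by
      rw [abs_div, abs_of_pos hσ, ← mul_div_assoc, div_le_iff₀ hσ]; exact haσ) hA
    have hset : {x | x + (a - a') / σ ∈ {x | a' + σ * x ∈ E}} = {x | a + σ * x ∈ E} := by
      ext x
      change a' + σ * (x + (a - a') / σ) ∈ E ↔ a + σ * x ∈ E
      rw [show a' + σ * (x + (a - a') / σ) = a + σ * x by field_simp; ring]
    rwa [hset] at h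

end Gaussian

section NoisyCount

/-- The Gaussian mechanism at the center `a`, with noise calibrated to a segment of length `w` with
midpoint `mid` and to the noisy count `N + z - κ`, where `z` is Laplace noise. -/
noncomputable def noisyCountLaw (ε c κ mid w N a : ℝ) : Measure ℝ :=
  ((laplace (2 / ε)).prod (gaussianReal 0 1)).map fun ω =>
    if N + ω.1 - κ ≤ 0 then mid else a + 2 * w / (ε * (N + ω.1 - κ)) * c * ω.2

theorem measurable_noisyCount (ε c κ mid w N a : ℝ) : Measurable fun ω : ℝ × ℝ =>
    if N + ω.1 - κ ≤ 0 then mid else a + 2 * w / (ε * (N + ω.1 - κ)) * c * ω.2 :=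
  Measurable.ite (measurableSet_le (by fun_prop) (by fun_prop)) (by fun_prop) (by fun_prop)

theorem isProbabilityMeasure_noisyCountLaw {ε : ℝ} (hε : 0 < ε) (c κ mid w N a : ℝ) :
    IsProbabilityMeasure (noisyCountLaw ε c κ mid w N a) := by
  have := isProbabilityMeasure_laplace (b := 2 / ε) (by positivity)
  exact Measure.isProbabilityMeasure_map (measurable_noisyCount ..).aemeasurable

/-- Changing the count by one is hidden by the Laplace noise; unless this noise exceeds `κ`, the
noisy count is at most `R`, and the Gaussian noise hides a change of the center by `w / R`. -/
theorem noisyCountLaw_indistinguishable {ε c κ mid w N N' R a a' : ℝ} (hε : 0 < ε) (hc : 0 < c)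
    (hεc : ε / 2 ≤ 2 * c ^ 2) (hw : 0 ≤ w) (hNN' : |N - N'| ≤ 1) (hR : N' ≤ R)
    (haa' : |a - a'| * R ≤ w) {δ : ℝ}
    (hδ : Real.exp (ε / 2) * (Real.exp (-(c ^ 2 / 2) + ε / 2 / 2) + Real.exp (-(κ * ε / 2))) ≤ δ) :
    Indistinguishable ε δ (noisyCountLaw ε c κ mid w N a) (noisyCountLaw ε c κ mid w N' a') := by
  intro E hE
  have hb : 0 < 2 / ε := by positivity
  have := isProbabilityMeasure_laplace hb
  have hm := measurable_noisyCount ε c κ mid w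
  rw [noisyCountLaw, noisyCountLaw, Measure.map_apply (hm N a) hE, Measure.map_apply (hm N' a') hE,
    Measure.prod_apply ((hm N a) hE), Measure.prod_apply ((hm N' a') hE)]
  set f : ℝ → ℝ → ℝ → ℝ≥0∞ := fun N a z => gaussianReal 0 1 (Prod.mk z ⁻¹'
    ((fun ω : ℝ × ℝ => if N + ω.1 - κ ≤ 0 then mid else
      a + 2 * w / (ε * (N + ω.1 - κ)) * c * ω.2) ⁻¹' E)) with hf
  have hfm : ∀ N a, Measurable (f N a) := fun N a => measurable_measure_prodMk_left ((hm N a) hE)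
  have hshift : ∀ z, f N a z = f N' a (z + (N - N')) := by
    intro z
    simp only [hf, Set.preimage_preimage]
    rw [show N' + (z + (N - N')) = N + z by ring]
  set δg := ENNReal.ofReal (Real.exp (-(c ^ 2 / 2) + ε / 2 / 2)) with hδg
  have hpoint : ∀ z, f N' a z ≤ ENNReal.ofReal (Real.exp (ε / 2)) * f N' a' z + δg +
      (Set.Ici κ).indicator 1 z := by
    intro z
    rcases le_or_gt κ z with hz | hz
    · rw [Set.indicator_of_mem (by exact hz)]
      exact prob_le_one.trans (le_add_left le_rfl)
    rw [Set.indicator_of_notMem (by simpa using hz), add_zero]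
    simp only [hf, Set.preimage_preimage]
    split_ifs with h
    · have h1 : (1 : ℝ≥0∞) ≤ ENNReal.ofReal (Real.exp (ε / 2)) :=
        ENNReal.one_le_ofReal.2 (Real.one_le_exp (by positivity))
      exact le_add_right (le_mul_of_one_le_left zero_le h1)
    · push Not at h
      set M := N' + z - κ with hM
      have hMR : M ≤ R := by linarith
      refine gaussianReal_affine_le (by positivity) hc hεc (by positivity) ?_ hE
      have h1 : |a - a'| * M ≤ w := le_trans (by gcongr) haa'
      rw [show ε / 2 * (2 * w / (ε * M) * c) = c * (w / M) by field_simp]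
      gcongr
      rwa [le_div_iff₀ h]
  have hbad : laplace (2 / ε) (Set.Ici κ) ≤ ENNReal.ofReal (Real.exp (-(κ * ε / 2))) := by
    refine (laplace_Ici_le hb κ).trans (le_of_eq ?_)
    congr 2
    field_simp
  have hexp1 : ENNReal.ofReal (Real.exp (|N - N'| / (2 / ε))) ≤
      ENNReal.ofReal (Real.exp (ε / 2)) := by
    apply ENNReal.ofReal_le_ofReal
    apply Real.exp_le_exp.2
    rw [div_le_iff₀ hb, div_mul_div_comm, mul_comm ε, div_self (by positivity)]
    exact hNN'
  calc ∫⁻ z, f N a z ∂laplace (2 / ε)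
      = ∫⁻ z, f N' a (z + (N - N')) ∂laplace (2 / ε) := lintegral_congr hshift
    _ ≤ ENNReal.ofReal (Real.exp (ε / 2)) * ∫⁻ z, f N' a z ∂laplace (2 / ε) :=
        (lintegral_laplace_shift_le hb _ (hfm N' a)).trans (by gcongr)
    _ ≤ ENNReal.ofReal (Real.exp (ε / 2)) * ∫⁻ z, (ENNReal.ofReal (Real.exp (ε / 2)) * f N' a' z +
          δg + (Set.Ici κ).indicator 1 z) ∂laplace (2 / ε) := by
        gcongr with z
        exact hpoint z
    _ = ENNReal.ofReal (Real.exp (ε / 2)) * (ENNReal.ofReal (Real.exp (ε / 2)) *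
          ∫⁻ z, f N' a' z ∂laplace (2 / ε) + δg + laplace (2 / ε) (Set.Ici κ)) := by
        rw [lintegral_add_right _ (measurable_one.indicator measurableSet_Ici),
          lintegral_add_right _ measurable_const, lintegral_const_mul _ (hfm N' a'),
          lintegral_indicator_one measurableSet_Ici]
        simp
    _ ≤ ENNReal.ofReal (Real.exp (ε / 2)) * (ENNReal.ofReal (Real.exp (ε / 2)) *
          ∫⁻ z, f N' a' z ∂laplace (2 / ε) + δg + ENNReal.ofReal (Real.exp (-(κ * ε / 2)))) := by
        gcongr
    _ = ENNReal.ofReal (Real.exp ε) * ∫⁻ z, f N' a' z ∂laplace (2 / ε) + ENNReal.ofReal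
          (Real.exp (ε / 2) * (Real.exp (-(c ^ 2 / 2) + ε / 2 / 2) + Real.exp (-(κ * ε / 2)))) := by
        rw [show Real.exp ε = Real.exp (ε / 2) * Real.exp (ε / 2) by
          rw [← Real.exp_add, add_halves], ENNReal.ofReal_mul (Real.exp_pos _).le,
          ENNReal.ofReal_mul (Real.exp_pos _).le,
          ENNReal.ofReal_add (Real.exp_pos _).le (Real.exp_pos _).le]
        ring
    _ ≤ _ := by gcongr

/-- In a segment of length `w`, adding a point to `N` points moves the average by at most
`w / (N + 1)`; for `N = 0` the average is replaced by the midpoint. -/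
theorem abs_average_sub_average_cons_le {u v x : ℝ} {S : Multiset ℝ} (hx : u ≤ x ∧ x ≤ v)
    (hS : ∀ y ∈ S, u ≤ y ∧ y ≤ v) [Decidable (S = 0)] :
    |(if S = 0 then (u + v) / 2 else S.sum / Multiset.card S) -
      (x ::ₘ S).sum / Multiset.card (x ::ₘ S)| * (Multiset.card S + 1) ≤ v - u := by
  have huv : u ≤ v := hx.1.trans hx.2
  split_ifs with h0
  · subst h0
    simp only [Multiset.sum_cons, Multiset.sum_zero, add_zero, Multiset.card_cons,
      Multiset.card_zero, zero_add, Nat.cast_one, div_one, Nat.cast_zero, mul_one]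
    rw [abs_le]
    constructor <;> linarith [hx.1, hx.2]
  · have hN : (0 : ℝ) < Multiset.card S := by
      exact_mod_cast Multiset.card_pos.2 h0
    have h1 : Multiset.card S • u ≤ S.sum := Multiset.card_nsmul_le_sum fun y hy => (hS y hy).1
    have h2 : S.sum ≤ Multiset.card S • v := Multiset.sum_le_card_nsmul _ _ fun y hy => (hS y hy).2
    rw [nsmul_eq_mul] at h1 h2
    have h3 : S.sum / Multiset.card S - (x ::ₘ S).sum / Multiset.card (x ::ₘ S) =
        (S.sum / Multiset.card S - x) / (Multiset.card S + 1) := by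
      rw [Multiset.sum_cons, Multiset.card_cons]
      push_cast
      field_simp
      ring
    have h4 : u ≤ S.sum / Multiset.card S := by rw [le_div_iff₀ hN]; linarith
    have h5 : S.sum / Multiset.card S ≤ v := by rw [div_le_iff₀ hN]; linarith
    rw [h3, abs_div, abs_of_pos (show (0 : ℝ) < Multiset.card S + 1 by positivity),
      div_mul_cancel₀ _ (by positivity), abs_le]
    constructor <;> linarith [hx.1, hx.2]

open Classical in
theorem noisyAverage_eq_noisyCountLaw (ε δ : ℝ) (S : Multiset ℝ) (I : ℝ × ℝ) :
    noisyAverage ε δ S I = noisyCountLaw ε (Real.sqrt (2 * Real.log (4 / δ)))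
      (2 / ε * Real.log (2 / δ)) ((I.1 + I.2) / 2) (I.2 - I.1)
      (Multiset.card (S.filter fun x => I.1 ≤ x ∧ x ≤ I.2))
      (if (S.filter fun x => I.1 ≤ x ∧ x ≤ I.2) = 0 then (I.1 + I.2) / 2 else
        (S.filter fun x => I.1 ≤ x ∧ x ≤ I.2).sum /
          Multiset.card (S.filter fun x => I.1 ≤ x ∧ x ≤ I.2)) := rfl

theorem isProbabilityMeasure_noisyAverage {ε : ℝ} (hε : 0 < ε) (δ : ℝ) (S : Multiset ℝ)
    (I : ℝ × ℝ) : IsProbabilityMeasure (noisyAverage ε δ S I) := by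
  rw [noisyAverage_eq_noisyCountLaw]
  exact isProbabilityMeasure_noisyCountLaw hε ..

/-- With `c = √(2 log (4 / δ))` and `κ = (2 / ε) log (2 / δ)`, the two tails are `δ / 4` and `δ / 2`, up
to factors of at most `8 / 7`. -/
theorem noisyAverage_budget {ε δ : ℝ} (hε : 0 < ε) (hε' : ε ≤ 1 / 4) (hδ : 0 < δ) (hδ' : δ ≤ 1) :
    Real.exp (ε / 2) * (Real.exp (-(Real.sqrt (2 * Real.log (4 / δ)) ^ 2 / 2) + ε / 2 / 2) +
      Real.exp (-(2 / ε * Real.log (2 / δ) * ε / 2))) ≤ δ := by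
  have hlog : 0 ≤ Real.log (4 / δ) := Real.log_nonneg (by rw [le_div_iff₀ hδ]; linarith)
  have e1 : Real.exp (-(Real.sqrt (2 * Real.log (4 / δ)) ^ 2 / 2)) = δ / 4 := by
    rw [Real.sq_sqrt (by positivity), mul_div_cancel_left₀ _ two_ne_zero, Real.exp_neg,
      Real.exp_log (by positivity), inv_div]
  have e2 : Real.exp (-(2 / ε * Real.log (2 / δ) * ε / 2)) = δ / 2 := by
    rw [show 2 / ε * Real.log (2 / δ) * ε / 2 = Real.log (2 / δ) by field_simp, Real.exp_neg,
      Real.exp_log (by positivity), inv_div]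
  have h8 : Real.exp (1 / 8) ≤ 8 / 7 := by
    have h := Real.add_one_le_exp (-(1 / 8 : ℝ))
    rw [Real.exp_neg] at h
    have := inv_anti₀ (by norm_num) h
    rw [inv_inv] at this
    exact this.trans (by norm_num)
  have h1 : Real.exp (ε / 2) ≤ 8 / 7 := (Real.exp_le_exp.2 (by linarith)).trans h8
  have h2 : Real.exp (ε / 2 / 2) ≤ 8 / 7 := (Real.exp_le_exp.2 (by linarith)).trans h8
  rw [Real.exp_add, e1, e2]
  calc _ ≤ 8 / 7 * (δ / 4 * (8 / 7) + δ / 2) := by gcongr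
    _ ≤ δ := by linarith

theorem noisyAverage_private_cons {ε δ : ℝ} (hε : 0 < ε) (hε' : ε ≤ 1 / 4) (hδ : 0 < δ)
    (hδ' : δ ≤ 1) (x : ℝ) (S : Multiset ℝ) (I : ℝ × ℝ) :
    Indistinguishable ε δ (noisyAverage ε δ (x ::ₘ S) I) (noisyAverage ε δ S I) ∧
      Indistinguishable ε δ (noisyAverage ε δ S I) (noisyAverage ε δ (x ::ₘ S) I) := by
  classical
  have hlog : 3 / 4 ≤ Real.log (4 / δ) := by
    have := Real.one_sub_inv_le_log_of_pos (x := 4 / δ) (by positivity)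
    rw [inv_div] at this
    linarith
  have hc : 0 < Real.sqrt (2 * Real.log (4 / δ)) := Real.sqrt_pos.2 (by linarith)
  have hc2 : ε / 2 ≤ 2 * Real.sqrt (2 * Real.log (4 / δ)) ^ 2 := by
    rw [Real.sq_sqrt (by linarith)]
    linarith
  have hbud := noisyAverage_budget hε hε' hδ hδ'
  rw [noisyAverage_eq_noisyCountLaw, noisyAverage_eq_noisyCountLaw]
  by_cases hx : I.1 ≤ x ∧ x ≤ I.2
  · rw [Multiset.filter_cons_of_pos (p := fun x => I.1 ≤ x ∧ x ≤ I.2) _ hx,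
      if_neg (Multiset.cons_ne_zero)]
    have hmem : ∀ y ∈ S.filter (fun x => I.1 ≤ x ∧ x ≤ I.2), I.1 ≤ y ∧ y ≤ I.2 := fun y hy =>
      (Multiset.mem_filter.1 hy).2
    have hw : 0 ≤ I.2 - I.1 := by linarith [hx.1, hx.2]
    have hdist := abs_average_sub_average_cons_le hx hmem
    have hcard : (Multiset.card (x ::ₘ S.filter fun x => I.1 ≤ x ∧ x ≤ I.2) : ℝ) =
        Multiset.card (S.filter fun x => I.1 ≤ x ∧ x ≤ I.2) + 1 := by
      rw [Multiset.card_cons]; push_cast; ring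
    constructor
    · refine noisyCountLaw_indistinguishable
        (R := Multiset.card (S.filter fun x => I.1 ≤ x ∧ x ≤ I.2) + 1)
        hε hc hc2 hw ?_ (by linarith) (by rw [abs_sub_comm]; exact hdist) hbud
      rw [hcard, add_sub_cancel_left, abs_one]
    · refine noisyCountLaw_indistinguishable
        (R := Multiset.card (S.filter fun x => I.1 ≤ x ∧ x ≤ I.2) + 1)
        hε hc hc2 hw ?_ hcard.le hdist hbud
      rw [hcard, sub_add_cancel_left, abs_neg, abs_one]
  · rw [Multiset.filter_cons_of_neg (p := fun x => I.1 ≤ x ∧ x ≤ I.2) _ hx]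
    have := fun μ : Measure ℝ => (Indistinguishable.refl μ).mono hε.le hδ.le
    exact ⟨this _, this _⟩

end NoisyCount

/-! ### The one-dimensional averages -/

theorem isProbabilityMeasure_average₁ {Λ rmin β ε δ : ℝ} (hε : 0 < ε) (S : Multiset ℝ) :
    IsProbabilityMeasure (average₁ Λ rmin β ε δ S) := by
  have := isProbabilityMeasure_boundingSegment Λ rmin (β / 2) (ε / 2) S
  have := isProbabilityMeasure_noisyAverage (ε := ε / 2) (by positivity) δ S
  constructor
  rw [average₁, Measure.bind_apply MeasurableSet.univ (aemeasurable_boundingSegment ..)]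
  simp

theorem average₁_private_cons {Λ rmin β ε δ : ℝ} (hε : 0 < ε) (hε' : ε ≤ 1 / 2) (hδ : 0 < δ)
    (hδ' : δ ≤ 1) (x : ℝ) (S : Multiset ℝ) :
    Indistinguishable ε δ (average₁ Λ rmin β ε δ (x ::ₘ S)) (average₁ Λ rmin β ε δ S) ∧
      Indistinguishable ε δ (average₁ Λ rmin β ε δ S) (average₁ Λ rmin β ε δ (x ::ₘ S)) := by
  have := isProbabilityMeasure_boundingSegment Λ rmin (β / 2) (ε / 2)
  have hb := boundingSegment_private_cons (Λ := Λ) (g := rmin) (β := β / 2) (half_pos hε).le x S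
  have hn := noisyAverage_private_cons (half_pos hε) (by linarith) hδ hδ' x S
  have h₁ := hb.1.bind (aemeasurable_boundingSegment ..) (aemeasurable_boundingSegment ..)
    fun I => (hn I).1
  have h₂ := hb.2.bind (aemeasurable_boundingSegment ..) (aemeasurable_boundingSegment ..)
    fun I => (hn I).2
  rw [add_halves] at h₁ h₂
  exact ⟨h₁, h₂⟩


/-! ### Advanced composition for independent components -/

section Composition

variable {Ω : Type*} [MeasurableSpace Ω] {d : ℕ}

theorem pi_withDensity_exp {P Q : Fin d → Measure Ω} [∀ i, IsProbabilityMeasure (P i)]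
    [∀ i, IsProbabilityMeasure (Q i)] {ε : ℝ} {h : Fin d → Ω → ℝ}
    (hm : ∀ i, Measurable (h i)) (hb : ∀ i x, |h i x| ≤ ε)
    (hP : ∀ i, P i = (Q i).withDensity fun x => ENNReal.ofReal (Real.exp (h i x))) :
    Measure.pi P = (Measure.pi Q).withDensity
      fun x => ENNReal.ofReal (Real.exp (∑ i, h i (x i))) := by
  refine Measure.pi_eq fun s hs => ?_
  have hS : MeasurableSet (Set.univ.pi s) := MeasurableSet.univ_pi hs
  have hint : ∀ i, Integrable ((s i).indicator fun x => Real.exp (h i x)) (Q i) := fun i => by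
    refine (Integrable.of_mem_Icc 0 (Real.exp ε) (by fun_prop) (ae_of_all _ fun x => ?_)).indicator
      (hs i)
    exact ⟨(Real.exp_pos _).le, Real.exp_le_exp.2 ((le_abs_self _).trans (hb i x))⟩
  have hnn : ∀ i x, 0 ≤ (s i).indicator (fun x => Real.exp (h i x)) x := fun i x =>
    Set.indicator_nonneg (fun x _ => (Real.exp_pos _).le) x
  have hone : ∀ i, P i (s i) =
      ENNReal.ofReal (∫ x, (s i).indicator (fun x => Real.exp (h i x)) x ∂Q i) := fun i => by
    rw [ofReal_integral_eq_lintegral_ofReal (hint i) (ae_of_all _ (hnn i)), hP i,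
      withDensity_apply _ (hs i), ← lintegral_indicator (hs i)]
    refine lintegral_congr fun x => ?_
    by_cases hx : x ∈ s i <;> simp [hx]
  simp_rw [hone]
  rw [← ENNReal.ofReal_prod_of_nonneg fun i _ => integral_nonneg (hnn i),
    ← integral_fintype_prod_eq_prod (𝕜 := ℝ),
    ofReal_integral_eq_lintegral_ofReal (Integrable.fintype_prod_dep hint)
      (ae_of_all _ fun x => Finset.prod_nonneg fun i _ => hnn i _),
    withDensity_apply _ hS, ← lintegral_indicator hS]
  refine lintegral_congr fun x => ?_
  by_cases hx : x ∈ Set.univ.pi s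
  · rw [Set.indicator_of_mem hx, Real.exp_sum]
    congr 1
    exact Finset.prod_congr rfl fun i _ => by
      rw [Set.indicator_of_mem (hx i (Set.mem_univ i))]
  · rw [Set.indicator_of_notMem hx]
    simp only [Set.mem_pi, Set.mem_univ, true_imp_iff, not_forall] at hx
    obtain ⟨i, hi⟩ := hx
    rw [Finset.prod_eq_zero (Finset.mem_univ i) (Set.indicator_of_notMem hi _),
      ENNReal.ofReal_zero]

/-- The relative entropy of two pure `ε`-indistinguishable laws is at most `ε (exp ε - 1)`. -/
theorem integral_log_ratio_le {P Q : Measure Ω} [IsProbabilityMeasure P] [IsProbabilityMeasure Q]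
    {ε : ℝ} {h : Ω → ℝ} (hm : Measurable h) (hb : ∀ x, |h x| ≤ ε)
    (hP : P = Q.withDensity fun x => ENNReal.ofReal (Real.exp (h x))) :
    ∫ x, h x ∂P ≤ ε * (Real.exp ε - 1) := by
  have hbd : ∀ x, -ε ≤ h x ∧ h x ≤ ε := fun x => abs_le.1 (hb x)
  have hε : 0 ≤ ε := by
    have : Nonempty Ω := Q.nonempty_of_neZero
    exact (abs_nonneg _).trans (hb (Classical.arbitrary Ω))
  have ih : Integrable h Q := Integrable.of_mem_Icc (-ε) ε hm.aemeasurable (ae_of_all _ hbd)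
  have ie : Integrable (fun x => Real.exp (h x)) Q :=
    Integrable.of_mem_Icc 0 (Real.exp ε) (by fun_prop)
      (ae_of_all _ fun x => ⟨(Real.exp_pos _).le, Real.exp_le_exp.2 (hbd x).2⟩)
  have hmass : ∫ x, Real.exp (h x) ∂Q = 1 := by
    have h1 : P Set.univ = 1 := measure_univ
    rw [hP, withDensity_apply _ MeasurableSet.univ, Measure.restrict_univ,
      ← ofReal_integral_eq_lintegral_ofReal ie (ae_of_all _ fun x => (Real.exp_pos _).le)] at h1
    exact ENNReal.ofReal_eq_one.1 h1
  have hneg : ∫ x, h x ∂Q ≤ 0 := by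
    have h2 : ∫ x, (h x + 1) ∂Q ≤ ∫ x, Real.exp (h x) ∂Q :=
      integral_mono (ih.add (integrable_const 1)) ie fun x => Real.add_one_le_exp _
    rw [hmass, integral_add ih (integrable_const 1)] at h2
    simpa using h2
  have hpt : ∀ x, Real.exp (h x) * h x ≤ ε * (Real.exp ε - 1) + h x := by
    intro x
    rcases le_total 0 (h x) with h0 | h0
    · have h3 := Real.exp_le_exp.2 (hbd x).2
      have h4 := Real.one_le_exp h0
      have : h x * (Real.exp (h x) - 1) ≤ ε * (Real.exp ε - 1) :=
        mul_le_mul (hbd x).2 (by linarith) (by linarith) hε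
      linarith
    · have h3 : 1 - Real.exp (h x) ≤ ε := by linarith [Real.add_one_le_exp (h x), (hbd x).1]
      have h4 : ε ≤ Real.exp ε - 1 := by linarith [Real.add_one_le_exp ε]
      have h5 : Real.exp (h x) ≤ 1 := Real.exp_le_one_iff.2 h0
      have : (-h x) * (1 - Real.exp (h x)) ≤ ε * (Real.exp ε - 1) :=
        mul_le_mul (by linarith [(hbd x).1]) (h3.trans h4) (by linarith) hε
      linarith
  have hPint : ∫ x, h x ∂P = ∫ x, Real.exp (h x) * h x ∂Q := by
    rw [hP, integral_withDensity_eq_integral_toReal_smul (by fun_prop)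
      (ae_of_all _ fun x => ENNReal.ofReal_lt_top)]
    refine integral_congr_ae (ae_of_all _ fun x => ?_)
    simp [ENNReal.toReal_ofReal (Real.exp_pos _).le]
  have hint : Integrable (fun x => Real.exp (h x) * h x) Q := by
    refine Integrable.of_mem_Icc (-(Real.exp ε * ε)) (Real.exp ε * ε) (by fun_prop)
      (ae_of_all _ fun x => abs_le.1 ?_)
    rw [abs_mul, Real.abs_exp]
    exact mul_le_mul (Real.exp_le_exp.2 (hbd x).2) (hb x) (abs_nonneg _) (Real.exp_pos _).le
  rw [hPint]
  calc ∫ x, Real.exp (h x) * h x ∂Q ≤ ∫ x, (ε * (Real.exp ε - 1) + h x) ∂Q :=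
        integral_mono hint ((integrable_const _).add ih) hpt
    _ = ε * (Real.exp ε - 1) + ∫ x, h x ∂Q := by
        rw [integral_add (integrable_const _) ih]; simp
    _ ≤ _ := by linarith

/-- Advanced composition of purely indistinguishable laws: the privacy loss is a sum of `d`
independent bounded variables, which is concentrated by Hoeffding's inequality. -/
theorem pi_apply_le_of_log_ratio {P Q : Fin d → Measure Ω} [∀ i, IsProbabilityMeasure (P i)]
    [∀ i, IsProbabilityMeasure (Q i)] {ε η : ℝ} (hd : 0 < d) (hε : 0 < ε) (hη : 0 < η)
    (hη' : η ≤ 1) {h : Fin d → Ω → ℝ}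
    (hm : ∀ i, Measurable (h i)) (hb : ∀ i x, |h i x| ≤ ε)
    (hP : ∀ i, P i = (Q i).withDensity fun x => ENNReal.ofReal (Real.exp (h i x))) :
    Indistinguishable (ε * Real.sqrt (2 * d * Real.log (1 / η)) + d * (ε * (Real.exp ε - 1))) η
      (Measure.pi P) (Measure.pi Q) := by
  intro S hS
  set t := ε * Real.sqrt (2 * d * Real.log (1 / η)) with ht
  have hlog : 0 ≤ Real.log (1 / η) := Real.log_nonneg (by rwa [le_div_iff₀ hη, one_mul])
  have hbad : Measure.pi P {x | t + d * (ε * (Real.exp ε - 1)) < ∑ i, h i (x i)} ≤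
      ENNReal.ofReal η := by
    have hsub : ∀ i ∈ Finset.univ, HasSubgaussianMGF
        (fun x : Fin d → Ω => h i (x i) - ∫ y, h i y ∂P i) ((‖ε - -ε‖₊ / 2) ^ 2)
        (Measure.pi P) := fun i _ => by
      have h1 := hasSubgaussianMGF_of_mem_Icc (μ := P i) (hm i).aemeasurable
        (ae_of_all _ fun x => (abs_le.1 (hb i x) : h i x ∈ Set.Icc (-ε) ε))
      have h2 := (measurePreserving_eval P i)
      rw [← h2.map_eq] at h1
      have h3 := HasSubgaussianMGF.of_map h2.measurable.aemeasurable h1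
      rw [h2.map_eq] at h3
      exact h3
    have hind : iIndepFun (fun i (x : Fin d → Ω) => h i (x i) - ∫ y, h i y ∂P i)
        (Measure.pi P) :=
      iIndepFun_pi (X := fun i y => h i y - ∫ y, h i y ∂P i)
        fun i => ((hm i).sub_const _).aemeasurable
    have hH := HasSubgaussianMGF.measure_sum_ge_le_of_iIndepFun hind hsub (ε := t) (by positivity)
    rw [← ofReal_measureReal]
    refine ENNReal.ofReal_le_ofReal ((measureReal_mono ?_).trans (hH.trans (le_of_eq ?_)))
    · intro x hx
      have h4 : ∑ i, ∫ y, h i y ∂P i ≤ d * (ε * (Real.exp ε - 1)) := by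
        refine (Finset.sum_le_card_nsmul _ _ _ fun i _ =>
          integral_log_ratio_le (hm i) (hb i) (hP i)).trans (le_of_eq ?_)
        simp
      have hx : t + d * (ε * (Real.exp ε - 1)) < ∑ i, h i (x i) := hx
      change t ≤ ∑ i, (h i (x i) - ∫ y, h i y ∂P i)
      rw [Finset.sum_sub_distrib]
      linarith
    · have h5 : ((∑ _i : Fin d, (‖ε - -ε‖₊ / 2) ^ 2 : NNReal) : ℝ) = d * ε ^ 2 := by
        rw [sub_neg_eq_add, ← two_mul]
        push_cast
        rw [Real.norm_of_nonneg (by positivity), mul_div_cancel_left₀ _ two_ne_zero]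
        simp
      have hd' : (0 : ℝ) < d := by exact_mod_cast hd
      rw [h5, ht, mul_pow, Real.sq_sqrt (by positivity)]
      rw [show -(ε ^ 2 * (2 * d * Real.log (1 / η))) / (2 * (d * ε ^ 2)) = -Real.log (1 / η) by
        field_simp, one_div, Real.log_inv, neg_neg, Real.exp_log hη]
  have hmeas : Measurable fun x : Fin d → Ω => ∑ i, h i (x i) :=
    Finset.measurable_sum _ fun i _ => (hm i).comp (measurable_pi_apply i)
  have hG : MeasurableSet {x : Fin d → Ω | ∑ i, h i (x i) ≤ t + d * (ε * (Real.exp ε - 1))} :=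
    measurableSet_le hmeas measurable_const
  have hgood : Measure.pi P (S ∩ {x | ∑ i, h i (x i) ≤ t + d * (ε * (Real.exp ε - 1))}) ≤
      ENNReal.ofReal (Real.exp (t + d * (ε * (Real.exp ε - 1)))) * Measure.pi Q S := by
    rw [pi_withDensity_exp hm hb hP, withDensity_apply _ (hS.inter hG)]
    calc _ ≤ ∫⁻ _ in S ∩ {x | ∑ i, h i (x i) ≤ t + d * (ε * (Real.exp ε - 1))},
          ENNReal.ofReal (Real.exp (t + d * (ε * (Real.exp ε - 1)))) ∂Measure.pi Q := by
          refine setLIntegral_mono' (hS.inter hG) fun x hx => ?_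
          exact ENNReal.ofReal_le_ofReal (Real.exp_le_exp.2 hx.2)
      _ ≤ _ := by
          rw [setLIntegral_const]
          gcongr
          exact Set.inter_subset_left
  calc Measure.pi P S
      ≤ Measure.pi P ((S ∩ {x | ∑ i, h i (x i) ≤ t + d * (ε * (Real.exp ε - 1))}) ∪
          {x | t + d * (ε * (Real.exp ε - 1)) < ∑ i, h i (x i)}) := measure_mono fun x hx => by
        rcases le_or_gt (∑ i, h i (x i)) (t + d * (ε * (Real.exp ε - 1))) with h1 | h1
        · exact Or.inl ⟨hx, h1⟩
        · exact Or.inr h1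
    _ ≤ _ := (measure_union_le _ _).trans (add_le_add hgood hbad)

end Composition


section Decomposition

open scoped NNReal

variable {Ω : Type*} [MeasurableSpace Ω]

/-- Densities `f ≤ E g` and `g ≤ E f` can be replaced by densities of equal masses: the heavier one
is interpolated with the minimum of the two. -/
theorem exists_le_lintegral_eq {lam : Measure Ω} {f g : Ω → ℝ≥0} (hf : Measurable f)
    (hg : Measurable g) {E : ℝ≥0} (hE : 1 ≤ E) (hfg : ∀ x, f x ≤ E * g x)
    (hgf : ∀ x, g x ≤ E * f x) (hfin : ∫⁻ x, f x ∂lam ≠ ∞)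
    (hle : ∫⁻ x, g x ∂lam ≤ ∫⁻ x, f x ∂lam) :
    ∃ f₁ : Ω → ℝ≥0, Measurable f₁ ∧ (∀ x, f₁ x ≤ f x) ∧ (∀ x, f₁ x ≤ E * g x) ∧
      (∀ x, g x ≤ E * f₁ x) ∧ ∫⁻ x, f₁ x ∂lam = ∫⁻ x, g x ∂lam := by
  have hmin : Measurable fun x => min (f x) (g x) := hf.min hg
  have hCB : ∫⁻ x, (min (f x) (g x) : ℝ≥0) ∂lam ≤ ∫⁻ x, g x ∂lam :=
    lintegral_mono fun x => ENNReal.coe_le_coe.2 (min_le_right _ _)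
  -- weights `s + t = 1` which interpolate the masses
  obtain ⟨s, t, hst, hmass⟩ : ∃ s t : ℝ≥0, s + t = 1 ∧
      s * ∫⁻ x, f x ∂lam + t * ∫⁻ x, (min (f x) (g x) : ℝ≥0) ∂lam = ∫⁻ x, g x ∂lam := by
    have hB : ∫⁻ x, g x ∂lam ≠ ∞ := ne_top_of_le_ne_top hfin hle
    have hC : ∫⁻ x, (min (f x) (g x) : ℝ≥0) ∂lam ≠ ∞ := ne_top_of_le_ne_top hB hCB
    lift ∫⁻ x, f x ∂lam to ℝ≥0 using hfin with A
    lift ∫⁻ x, g x ∂lam to ℝ≥0 using hB with B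
    lift ∫⁻ x, (min (f x) (g x) : ℝ≥0) ∂lam to ℝ≥0 using hC with C
    norm_cast at hle hCB ⊢
    obtain ⟨s, t, hs, ht, hst, h⟩ : (B : ℝ) ∈ segment ℝ (A : ℝ) (C : ℝ) := by
      rw [segment_symm, segment_eq_Icc (by exact_mod_cast hCB.trans hle)]
      exact ⟨by exact_mod_cast hCB, by exact_mod_cast hle⟩
    refine ⟨⟨s, hs⟩, ⟨t, ht⟩, ?_, ?_⟩
    · exact NNReal.eq hst
    · exact NNReal.eq h
  refine ⟨fun x => s * f x + t * min (f x) (g x), by fun_prop, fun x => ?_, fun x => ?_,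
    fun x => ?_, ?_⟩
  · calc s * f x + t * min (f x) (g x) ≤ s * f x + t * f x := by gcongr; exact min_le_left _ _
      _ = f x := by rw [← add_mul, hst, one_mul]
  · calc s * f x + t * min (f x) (g x) ≤ s * (E * g x) + t * (E * g x) := by
          gcongr
          · exact hfg x
          · exact (min_le_left _ _).trans (hfg x)
      _ = E * g x := by rw [← add_mul, hst, one_mul]
  · have h1 : g x ≤ E * min (f x) (g x) := by
      rw [mul_min_of_nonneg _ _ (zero_le)]
      exact le_min (hgf x) (le_mul_of_one_le_left zero_le hE)
    calc g x = s * g x + t * g x := by rw [← add_mul, hst, one_mul]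
      _ ≤ s * (E * f x) + t * (E * min (f x) (g x)) := by
          gcongr
          · exact hgf x
      _ = _ := by ring
  · rw [← hmass]
    push_cast
    rw [lintegral_add_left (by fun_prop), lintegral_const_mul _ (by fun_prop),
      lintegral_const_mul _ (by fun_prop)]

/-- Indistinguishability in terms of densities: the part of `μ` above `exp ε • ν` has mass at most
`δ`. -/
theorem one_le_lintegral_min_add {lam μ ν : Measure Ω} [IsProbabilityMeasure μ] {ε δ : ℝ}
    {f g : Ω → ℝ≥0} (hf : Measurable f) (hg : Measurable g)
    (hμ : μ = lam.withDensity fun x => f x) (hν : ν = lam.withDensity fun x => g x)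
    (h : Indistinguishable ε δ μ ν) :
    1 ≤ ∫⁻ x, (min (f x) (Real.toNNReal (Real.exp ε) * g x) : ℝ≥0) ∂lam + ENNReal.ofReal δ := by
  set G := {x | f x ≤ Real.toNNReal (Real.exp ε) * g x} with hGdef
  have hG : MeasurableSet G := measurableSet_le hf (by fun_prop)
  have h1 : μ G ≤ ∫⁻ x in G, (min (f x) (Real.toNNReal (Real.exp ε) * g x) : ℝ≥0) ∂lam := by
    rw [hμ, withDensity_apply _ hG]
    exact setLIntegral_mono' hG fun x hx => by rw [min_eq_left (by exact hx)]
  have h2 : ENNReal.ofReal (Real.exp ε) * ν Gᶜ ≤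
      ∫⁻ x in Gᶜ, (min (f x) (Real.toNNReal (Real.exp ε) * g x) : ℝ≥0) ∂lam := by
    rw [hν, withDensity_apply _ hG.compl, ← lintegral_const_mul _ (by fun_prop)]
    refine setLIntegral_mono' hG.compl fun x hx => ?_
    rw [min_eq_right (not_le.1 (by exact hx)).le, ENNReal.coe_mul]
    rfl
  calc (1 : ℝ≥0∞) = μ G + μ Gᶜ := by rw [measure_add_measure_compl hG, measure_univ]
    _ ≤ μ G + (ENNReal.ofReal (Real.exp ε) * ν Gᶜ + ENNReal.ofReal δ) := by
        gcongr
        exact h _ hG.compl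
    _ ≤ _ := by
        rw [← add_assoc, ← lintegral_add_compl _ hG]
        gcongr

theorem exists_density_of_le {μ lam : Measure Ω} [IsFiniteMeasure μ] [IsFiniteMeasure lam]
    (h : μ ≤ lam) : ∃ f : Ω → ℝ≥0, Measurable f ∧ μ = lam.withDensity fun x => f x := by
  refine ⟨fun x => (μ.rnDeriv lam x).toNNReal, (Measure.measurable_rnDeriv μ lam).ennreal_toNNReal,
    ?_⟩
  rw [← Measure.withDensity_rnDeriv_eq μ lam (Measure.absolutelyContinuous_of_le h)]
  refine withDensity_congr_ae ?_
  rw [Measure.withDensity_rnDeriv_eq μ lam (Measure.absolutelyContinuous_of_le h)]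
  filter_upwards [Measure.rnDeriv_lt_top μ lam] with x hx
  rw [ENNReal.coe_toNNReal hx.ne]

/-- Mutually `(ε, δ)`-indistinguishable laws have parts of a common mass of at least `1 - δ`
which are purely `ε`-indistinguishable. -/
theorem exists_pure_part {μ ν : Measure Ω} [IsProbabilityMeasure μ] [IsProbabilityMeasure ν]
    {ε δ : ℝ} (hε : 0 ≤ ε) (hδ : δ < 1) (h : Indistinguishable ε δ μ ν)
    (h' : Indistinguishable ε δ ν μ) :
    ∃ (M : ℝ≥0∞) (P Q : Measure Ω) (r : Ω → ℝ), IsProbabilityMeasure P ∧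
      IsProbabilityMeasure Q ∧ Measurable r ∧ (∀ x, |r x| ≤ ε) ∧
      (P = Q.withDensity fun x => ENNReal.ofReal (Real.exp (r x))) ∧ M • P ≤ μ ∧ M • Q ≤ ν ∧
      1 ≤ M + ENNReal.ofReal δ ∧ M ≤ 1 := by
  set E := Real.toNNReal (Real.exp ε) with hEdef
  have hE : 1 ≤ E := by
    rw [hEdef, Real.one_le_toNNReal]; exact Real.one_le_exp hε
  have hEcoe : (E : ℝ) = Real.exp ε := Real.coe_toNNReal _ (Real.exp_pos _).le
  obtain ⟨f, hf, hμ⟩ := exists_density_of_le (μ := μ) (lam := μ + ν) (Measure.le_add_right le_rfl)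
  obtain ⟨g, hg, hν⟩ := exists_density_of_le (μ := ν) (lam := μ + ν) (Measure.le_add_left le_rfl)
  generalize μ + ν = lam at hμ hν
  have hfmass : ∫⁻ x, f x ∂lam = 1 := by
    rw [← measure_univ (μ := μ), hμ, withDensity_apply _ MeasurableSet.univ,
      Measure.restrict_univ]
  have hgmass : ∫⁻ x, g x ∂lam = 1 := by
    rw [← measure_univ (μ := ν), hν, withDensity_apply _ MeasurableSet.univ,
      Measure.restrict_univ]
  have hf₀ := one_le_lintegral_min_add hf hg hμ hν h
  have hg₀ := one_le_lintegral_min_add hg hf hν hμ h'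
  rw [← hEdef] at hf₀ hg₀
  -- parts of equal masses
  obtain ⟨f₁, g₁, hf₁, hg₁, hf₁f, hg₁g, hfg, hgf, hmass, hone⟩ : ∃ f₁ g₁ : Ω → ℝ≥0,
      Measurable f₁ ∧ Measurable g₁ ∧ (∀ x, f₁ x ≤ f x) ∧ (∀ x, g₁ x ≤ g x) ∧
      (∀ x, f₁ x ≤ E * g₁ x) ∧ (∀ x, g₁ x ≤ E * f₁ x) ∧
      ∫⁻ x, f₁ x ∂lam = ∫⁻ x, g₁ x ∂lam ∧ 1 ≤ ∫⁻ x, f₁ x ∂lam + ENNReal.ofReal δ := by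
    have key : ∀ f g : Ω → ℝ≥0, ∀ x, min (f x) (E * g x) ≤ E * min (g x) (E * f x) := by
      intro f g x
      rw [mul_min_of_nonneg _ _ zero_le]
      refine le_min (min_le_right _ _) ((min_le_left _ _).trans ?_)
      rw [← mul_assoc]
      exact le_mul_of_one_le_left zero_le (one_le_mul hE hE)
    have hm : ∀ {f g : Ω → ℝ≥0}, Measurable f → Measurable g →
        Measurable fun x => min (f x) (E * g x) := fun hf hg => hf.min (hg.const_mul E)
    have hfin : ∀ {f : Ω → ℝ≥0} (g : Ω → ℝ≥0), ∫⁻ x, f x ∂lam = 1 →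
        ∫⁻ x, (min (f x) (E * g x) : ℝ≥0) ∂lam ≠ ∞ := fun g hf =>
      ne_top_of_le_ne_top (by rw [hf]; exact ENNReal.one_ne_top)
        (lintegral_mono fun x => ENNReal.coe_le_coe.2 (min_le_left _ _))
    rcases le_total (∫⁻ x, (min (g x) (E * f x) : ℝ≥0) ∂lam)
      (∫⁻ x, (min (f x) (E * g x) : ℝ≥0) ∂lam) with hle | hle
    · obtain ⟨f₁, hf₁, h1, h2, h3, h4⟩ := exists_le_lintegral_eq (hm hf hg) (hm hg hf) hE
        (key f g) (key g f) (hfin g hfmass) hle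
      exact ⟨f₁, _, hf₁, hm hg hf, fun x => (h1 x).trans (min_le_left _ _),
        fun x => min_le_left _ _, h2, h3, h4, by rwa [h4]⟩
    · obtain ⟨g₁, hg₁, h1, h2, h3, h4⟩ := exists_le_lintegral_eq (hm hg hf) (hm hf hg) hE
        (key g f) (key f g) (hfin f hgmass) hle
      exact ⟨_, g₁, hm hf hg, hg₁, fun x => min_le_left _ _,
        fun x => (h1 x).trans (min_le_left _ _), h3, h2, h4.symm, hf₀⟩
  set M := ∫⁻ x, f₁ x ∂lam with hM
  have hM1 : M ≤ 1 := by
    rw [← hfmass]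
    exact lintegral_mono fun x => ENNReal.coe_le_coe.2 (hf₁f x)
  have hM0 : M ≠ 0 := by
    intro h0
    rw [h0, zero_add, ENNReal.one_le_ofReal] at hone
    linarith
  have hMt : M ≠ ∞ := ne_top_of_le_ne_top ENNReal.one_ne_top hM1
  refine ⟨M, M⁻¹ • lam.withDensity fun x => f₁ x, M⁻¹ • lam.withDensity fun x => g₁ x,
    fun x => Real.log (f₁ x / g₁ x), ⟨?_⟩, ⟨?_⟩, by fun_prop, ?_, ?_, ?_, ?_, hone, hM1⟩
  · rw [Measure.smul_apply, withDensity_apply _ MeasurableSet.univ, Measure.restrict_univ,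
      ← hM, smul_eq_mul, ENNReal.inv_mul_cancel hM0 hMt]
  · rw [Measure.smul_apply, withDensity_apply _ MeasurableSet.univ, Measure.restrict_univ,
      ← hmass, smul_eq_mul, ENNReal.inv_mul_cancel hM0 hMt]
  · intro x
    have h1 : (f₁ x : ℝ) ≤ Real.exp ε * g₁ x := by rw [← hEcoe]; exact_mod_cast hfg x
    have h2 : (g₁ x : ℝ) ≤ Real.exp ε * f₁ x := by rw [← hEcoe]; exact_mod_cast hgf x
    rcases eq_or_ne (g₁ x) 0 with h0 | h0
    · simp [h0, hε]
    have hgp : (0 : ℝ) < g₁ x := by exact_mod_cast pos_iff_ne_zero.2 h0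
    have hfp : (0 : ℝ) < f₁ x := by
      by_contra hc
      have : (f₁ x : ℝ) = 0 := le_antisymm (not_lt.1 hc) (f₁ x).2
      rw [this, mul_zero] at h2
      linarith
    rw [abs_le]
    constructor
    · rw [Real.le_log_iff_exp_le (by positivity), le_div_iff₀ hgp, Real.exp_neg,
        inv_mul_le_iff₀ (Real.exp_pos _)]
      exact h2
    · rw [Real.log_le_iff_le_exp (by positivity), div_le_iff₀ hgp]
      exact h1
  · rw [withDensity_smul_measure, ← withDensity_mul _ (by fun_prop) (by fun_prop)]
    congr 2
    funext x
    rw [Pi.mul_apply]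
    rcases eq_or_ne (g₁ x) 0 with h0 | h0
    · have : f₁ x = 0 := by
        have := hfg x
        rw [h0, mul_zero] at this
        exact le_antisymm this zero_le
      simp [h0, this]
    have hgp : (0 : ℝ) < g₁ x := by exact_mod_cast pos_iff_ne_zero.2 h0
    have hfp : (0 : ℝ) < f₁ x := by
      have := hgf x
      have hne : f₁ x ≠ 0 := by
        intro hc
        rw [hc, mul_zero] at this
        exact h0 (le_antisymm this zero_le)
      exact_mod_cast pos_iff_ne_zero.2 hne
    rw [Real.exp_log (by positivity), ← ENNReal.ofReal_coe_nnreal, ← ENNReal.ofReal_coe_nnreal,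
      ← ENNReal.ofReal_mul hgp.le, mul_div_cancel₀ _ hgp.ne']
  · rw [smul_smul, ENNReal.mul_inv_cancel hM0 hMt, one_smul, hμ]
    exact withDensity_mono (ae_of_all _ fun x => ENNReal.coe_le_coe.2 (hf₁f x))
  · rw [smul_smul, ENNReal.mul_inv_cancel hM0 hMt, one_smul, hν]
    exact withDensity_mono (ae_of_all _ fun x => ENNReal.coe_le_coe.2 (hg₁g x))

/-- Bernoulli's inequality, for the masses `1 - M i ≤ δ` that are lost in the components. -/
theorem one_le_prod_add {d : ℕ} {M : Fin d → ℝ≥0∞} {δ : ℝ≥0∞} (hM : ∀ i, M i ≤ 1)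
    (h : ∀ i, 1 ≤ M i + δ) : 1 ≤ ∏ i, M i + d * δ := by
  have key : ∀ s : Finset (Fin d), 1 ≤ ∏ i ∈ s, M i + s.card * δ := by
    intro s
    induction s using Finset.cons_induction with
    | empty => simp
    | cons a s ha ih =>
      rw [Finset.prod_cons, Finset.card_cons]
      calc (1 : ℝ≥0∞) ≤ M a * 1 + δ := by rw [mul_one]; exact h a
        _ ≤ M a * (∏ i ∈ s, M i + s.card * δ) + δ := by gcongr
        _ ≤ M a * ∏ i ∈ s, M i + 1 * (s.card * δ) + δ := by
            rw [mul_add]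
            gcongr
            exact hM a
        _ = _ := by push_cast; ring
  simpa using key Finset.univ

theorem prod_smul_pi_le {d : ℕ} {μ P : Fin d → Measure Ω} [∀ i, IsProbabilityMeasure (μ i)]
    [∀ i, IsProbabilityMeasure (P i)] {M : Fin d → ℝ≥0∞} (h : ∀ i, M i • P i ≤ μ i) :
    (∏ i, M i) • Measure.pi P ≤ Measure.pi μ := by
  have hle : ((∏ i, M i) • Measure.pi P).toOuterMeasure ≤
      OuterMeasure.pi fun i => (μ i).toOuterMeasure := by
    refine OuterMeasure.le_pi.2 fun s _ => ?_
    change ((∏ i, M i) • Measure.pi P) (Set.univ.pi s) ≤ ∏ i, μ i (s i)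
    rw [Measure.smul_apply, Measure.pi_pi, smul_eq_mul, ← Finset.prod_mul_distrib]
    exact Finset.prod_le_prod' fun i _ => h i (s i)
  rw [Measure.le_iff]
  intro S hS
  refine (hle S).trans (le_of_eq ?_)
  rw [Measure.pi, toMeasure_apply _ _ hS]

/-- Advanced composition for `d` independent components. -/
theorem pi_indistinguishable {d : ℕ} {μ ν : Fin d → Measure Ω} [∀ i, IsProbabilityMeasure (μ i)]
    [∀ i, IsProbabilityMeasure (ν i)] {ε δ η : ℝ} (hd : 0 < d) (hε : 0 < ε) (hδ : 0 ≤ δ)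
    (hδ' : δ < 1) (hη : 0 < η) (hη' : η ≤ 1) (h : ∀ i, Indistinguishable ε δ (μ i) (ν i))
    (h' : ∀ i, Indistinguishable ε δ (ν i) (μ i)) :
    Indistinguishable (ε * Real.sqrt (2 * d * Real.log (1 / η)) + d * (ε * (Real.exp ε - 1)))
      (d * δ + η) (Measure.pi μ) (Measure.pi ν) := by
  choose M P Q r hP hQ hr hrb hPQ hMP hMQ hone hM using
    fun i => exists_pure_part hε.le hδ' (h i) (h' i)
  have hpure := pi_apply_le_of_log_ratio hd hε hη hη' hr hrb hPQ
  have hμ := prod_smul_pi_le hMP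
  have hν := prod_smul_pi_le hMQ
  have hK := one_le_prod_add hM hone
  have hK1 : ∏ i, M i ≤ 1 := Finset.prod_le_one' fun i _ => hM i
  intro S hS
  set K := ∏ i, M i
  have h1 : Measure.pi μ S ≤ K * Measure.pi P S + d * ENNReal.ofReal δ := by
    rw [← ENNReal.add_le_add_iff_right (measure_ne_top (Measure.pi μ) Sᶜ),
      measure_add_measure_compl hS, measure_univ]
    calc (1 : ℝ≥0∞) ≤ K + d * ENNReal.ofReal δ := hK
      _ = K * (Measure.pi P S + Measure.pi P Sᶜ) + d * ENNReal.ofReal δ := by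
          rw [measure_add_measure_compl hS, measure_univ, mul_one]
      _ = K * Measure.pi P S + d * ENNReal.ofReal δ + K * Measure.pi P Sᶜ := by ring
      _ ≤ _ := by
          gcongr
          exact hμ Sᶜ
  calc Measure.pi μ S ≤ K * Measure.pi P S + d * ENNReal.ofReal δ := h1
    _ ≤ K * (ENNReal.ofReal (Real.exp
          (ε * Real.sqrt (2 * d * Real.log (1 / η)) + d * (ε * (Real.exp ε - 1)))) *
          Measure.pi Q S + ENNReal.ofReal η) + d * ENNReal.ofReal δ := by
        gcongr
        exact hpure S hS
    _ = ENNReal.ofReal (Real.exp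
          (ε * Real.sqrt (2 * d * Real.log (1 / η)) + d * (ε * (Real.exp ε - 1)))) *
          (K * Measure.pi Q S) + (d * ENNReal.ofReal δ + K * ENNReal.ofReal η) := by ring
    _ ≤ _ := by
        rw [ENNReal.ofReal_add (by positivity) hη.le, ENNReal.ofReal_mul (Nat.cast_nonneg d),
          ENNReal.ofReal_natCast]
        gcongr
        · exact hν S
        · exact mul_le_of_le_one_left zero_le hK1

end Decomposition


/-! ### The standard averaging subroutine -/

/-- The parameters of the coordinates make up the parameters of the composition. -/
theorem coordinate_budget {d : ℕ} (hd : 0 < d) {ε δ : ℝ} (hε : 0 < ε) (hε' : ε < 1) (hδ : 0 < δ)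
    (hδ' : δ < 1) :
    0 < ε / (2 * Real.sqrt (2 * d * Real.log (2 / δ))) ∧
      ε / (2 * Real.sqrt (2 * d * Real.log (2 / δ))) ≤ 1 / 2 ∧
      ε / (2 * Real.sqrt (2 * d * Real.log (2 / δ))) *
          Real.sqrt (2 * d * Real.log (1 / (δ / 2))) +
        d * (ε / (2 * Real.sqrt (2 * d * Real.log (2 / δ))) *
          (Real.exp (ε / (2 * Real.sqrt (2 * d * Real.log (2 / δ)))) - 1)) ≤ ε := by
  have hd' : (1 : ℝ) ≤ d := by exact_mod_cast hd
  have hL : 1 / 2 ≤ Real.log (2 / δ) := by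
    have := Real.one_sub_inv_le_log_of_pos (x := 2 / δ) (by positivity)
    rw [inv_div] at this
    linarith
  rw [show 1 / (δ / 2) = 2 / δ by field_simp]
  have hsq : Real.sqrt (2 * d * Real.log (2 / δ)) ^ 2 = 2 * d * Real.log (2 / δ) :=
    Real.sq_sqrt (by positivity)
  have ha : 1 ≤ Real.sqrt (2 * d * Real.log (2 / δ)) := by
    rw [Real.one_le_sqrt]
    nlinarith
  set a := Real.sqrt (2 * d * Real.log (2 / δ))
  set e := ε / (2 * a) with he
  have he0 : 0 < e := by positivity
  have he1 : e ≤ 1 / 2 := by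
    rw [he, div_le_iff₀ (by positivity)]
    linarith
  have hea : e * a = ε / 2 := by rw [he]; field_simp
  refine ⟨he0, he1, ?_⟩
  have hexp : Real.exp e - 1 ≤ 2 * e := by
    have h1 := Real.add_one_le_exp (-e)
    have h2 : Real.exp e * Real.exp (-e) = 1 := by rw [← Real.exp_add]; simp
    have h3 : Real.exp e * (1 - e) ≤ 1 := by
      calc _ ≤ Real.exp e * Real.exp (-e) := by gcongr; linarith
        _ = 1 := h2
    nlinarith
  have h4 : d * (e * (Real.exp e - 1)) ≤ d * (e * (2 * e)) := by gcongr
  have h5 : (e * a) ^ 2 = ε ^ 2 / 4 := by rw [hea]; ring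
  rw [mul_pow, hsq] at h5
  have h6 : d * e ^ 2 ≤ d * e ^ 2 * (2 * Real.log (2 / δ)) :=
    le_mul_of_one_le_right (by positivity) (by linarith)
  rw [hea]
  nlinarith

theorem privateAverager_boundedAverager {d : ℕ} (hd : 0 < d) (Λ rmin : ℝ) :
    PrivateAverager Λ rmin (boundedAverager d) := by
  intro β ε δ _ _ hε hε' hδ hδ' S _
  obtain ⟨he0, he1, hbudget⟩ := coordinate_budget hd hε hε' hδ hδ'
  have hd' : (1 : ℝ) ≤ d := by exact_mod_cast hd
  have hmeas : Measurable (WithLp.toLp 2 : (Fin d → ℝ) → Pt d) := WithLp.measurable_toLp 2 _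
  have hprob := fun S => isProbabilityMeasure_average₁ (Λ := Λ) (rmin := rmin) (β := β / d)
    (δ := δ / (2 * d)) he0 S
  refine ⟨Measure.isProbabilityMeasure_map hmeas.aemeasurable, fun x _ => ?_⟩
  have hδ₁ : δ / (2 * d) < 1 := by
    rw [div_lt_one (by positivity)]
    linarith
  have hcons := fun i : Fin d => average₁_private_cons (Λ := Λ) (rmin := rmin) (β := β / d)
    (δ := δ / (2 * d)) he0 he1 (by positivity) hδ₁.le (x i) (S.map fun x => x i)
  have hsum : (d : ℝ) * (δ / (2 * d)) + δ / 2 ≤ δ := le_of_eq (by field_simp; ring)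
  have hmap : ∀ i : Fin d, (x ::ₘ S).map (fun x => x i) = x i ::ₘ S.map fun x => x i :=
    fun i => Multiset.map_cons _ _ _
  unfold boundedAverager
  simp only [hmap]
  constructor
  · exact ((pi_indistinguishable hd he0 (by positivity) hδ₁ (half_pos hδ) (by linarith)
      (fun i => (hcons i).2) (fun i => (hcons i).1)).mono hbudget hsum).map hmeas
  · exact ((pi_indistinguishable hd he0 (by positivity) hδ₁ (half_pos hδ) (by linarith)
      (fun i => (hcons i).1) (fun i => (hcons i).2)).mono hbudget hsum).map hmeas

end KTuple

theorem mainTheorem1 (d k n : ℕ) (hd : 0 < d) (hk : 0 < k) (Λ rmin ε δ β : ℝ)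
    (hΛ : 0 < Λ) (hrmin : 0 ≤ rmin) (hrmin' : rmin ≤ Λ)
    (hε : 0 < ε) (hε' : ε ≤ 1) (hδ : 0 < δ) (hδ' : δ ≤ 1) (hβ : 0 < β) (hβ' : β ≤ 1)
    (hm : (KTuple.AdmissibleSizes n (ε / 2) (δ / 4) (β / 2)).Nonempty)
    (hn : 2 * KTuple.ell n (ε / 2) (δ / 4) (β / 2) + 2 ≤ (n : ℝ)) :
    KTuple.DifferentiallyPrivateOn {X : Sym (KTuple.Pt d) k | ∀ x ∈ X, ‖x‖ ≤ Λ} ε δ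
      (KTuple.privatekAverages (n := n) (KTuple.boundedAverager d) Λ rmin ε δ β) ∧
    ∀ avg : KTuple.Averager d, KTuple.PrivateAverager Λ rmin avg →
      KTuple.DifferentiallyPrivateOn {X : Sym (KTuple.Pt d) k | ∀ x ∈ X, ‖x‖ ≤ Λ} ε δ
        (KTuple.privatekAverages (n := n) avg Λ rmin ε δ β) :=
  have h := fun (avg : KTuple.Averager d) (havg : KTuple.PrivateAverager Λ rmin avg) =>
    KTuple.privatekAverages_private hk hε hε' hδ hδ' hβ hβ' hm havg
  ⟨h _ (KTuple.privateAverager_boundedAverager hd Λ rmin), h⟩
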